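/- Let $k'>k\ge 3$ be integers and $\lambda,\mu>0$. Let $\mathbb S$ be the space of real symmetric $2\times2$ matrices, $A:B=\sum_{i,j}A_{ij}B_{ij}$, and $\mathcal A\sigma=\frac1{2\mu}\bigl(\sigma-\frac{\lambda}{2\mu+2\lambda}\mathrm{tr}(\sigma)I\bigr)$. For a triangle $K$ with barycentric coordinates $\lambda_1,\lambda_2,\lambda_3$ put $b=\lambda_1\lambda_2\lambda_3$ and $P_{k,k'}(K)=P_k(K)+bP_{k'-3}(K)$. Fix a $P_{k,k'}$-Lagrange element with a quadrature rule on its nodes: finitely many nodes $\chi_1,\dots,\chi_r$ in the closed triangle, given by barycentric coordinates that are the same for all triangles $K$, such that a function in $P_{k,k'}(K)$ is uniquely determined by arbitrarily prescribed nodal values, and weights $w_i=\operatorname{meas}(K)\,\omega_i$ with $\omega_i$ independent of $K$, such that $\sum_i w_i=\operatorname{meas}(K)$, all $w_i>0$, and the rule $I_{k,k',K}(f)=\sum_i w_if(\chi_i)\approx\int_K f\,dx$ is exact for polynomials of degree at most $k+k'-2$. Let $\Omega\subset\mathbb R^2$ be a bounded polygonal region, and let $\mathcal T_h$ be a conforming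 triangulation of $\Omega$, i.e. a finite set of nondegenerate closed triangles with union $\overline\Omega$, two distinct ones being disjoint or meeting exactly in a common vertex or a common edge. Write $(\cdot,\cdot)$ and $\|\cdot\|_0$ for the $L^2(\Omega)$ inner product and norm, $\operatorname{div}$ for the row-wise weak divergence, $H(\operatorname{div},\Omega;\mathbb S)$ for the symmetric $L^2$ matrix fields with divergence in $L^2$, $P_m(K;X)$ for the $X$-valued polynomials of degree at most $m$, and $P_i^{\mathrm{hom}}(K;\mathbb S)$ for the homogeneous ones of degree $i$. Define $$\widetilde\Sigma_{k,h}=\{\tau\in H^1(\Omega;\mathbb S):\tau|_K\in P_k(K;\mathbb S)\ \forall K\in\mathcal T_h\},$$ $$B_{k,h}=\{\tau\in H(\operatorname{div},\Omega;\mathbb S):\tau|_K\in P_k(K;\mathbb S),\ \tau|_K\,\nu|_{\partial K}=0\ \forall K\in\mathcal T_h\},$$ where $\nu$ is the normal along $\partial K$, $$\Lambda_{k,k'}=\Bigl\{\tau\in H(\operatorname{div},\Omega;\mathbb S):\tau|_K\in\sum_{i=k-2}^{k'-3}b\,P_i^{\mathrm{hom}}(K;\mathbb S)\ \forall K\in\mathcal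 T_h\Bigr\},$$ $$\Sigma_{k,k',h}=\widetilde\Sigma_{k,h}+B_{k,h}+\Lambda_{k,k'},\qquad V_{k,k',h}=\{v\in L^2(\Omega;\mathbb R^2):v|_K\in P_{k-1}(K;\mathbb R^2)\ \forall K\in\mathcal T_h\}+\operatorname{div}\Lambda_{k,k'},$$ and $(\mathcal A\sigma,\tau)_h=\sum_{K\in\mathcal T_h}I_{k,k',K}(\mathcal A\sigma|_K:\tau|_K)$ for $\sigma,\tau\in\Sigma_{k,k',h}$, where on each $K$ the nodal values are those of the polynomials $\sigma|_K,\tau|_K$. 1. There is a constant $C>0$, depending only on $\lambda,\mu$ and the chosen element and quadrature rule (in particular not on $\Omega$, the triangulation or $h$), such that for all such $\Omega$ and $\mathcal T_h$ $$(\mathcal A\tau,\tau)_h\ \ge\ C\,\|\tau\|_0^2\qquad\forall\,\tau\in\Sigma_{k,k',h}.$$ 2. For all such $\Omega$ and $\mathcal T_h$ and every $f\in L^2(\Omega;\mathbb R^2)$, the mass-lumped scheme: find $(\sigma_h,u_h)\in\Sigma_{k,k',h}\times V_{k,k',h}$ such that $$(\mathcal A\sigma_h,\tau_h)_h+(\operatorname{div}\tau_h,u_h)=0\quad\forall\tau_h\in\Sigma_{k,k',h},\qquad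 -(\operatorname{div}\sigma_h,v_h)=(f,v_h)\quad\forall v_h\in V_{k,k',h},$$ has exactly one solution. -/

import Mathlib

open MeasureTheory Set
open scoped ContDiff Matrix

noncomputable section

namespace LumpedElasticity

/-! ### Points, polynomials, triangles -/

/-- The plane `ℝ²`. -/
abbrev Plane := EuclideanSpace ℝ (Fin 2)

/-- Real polynomials in the two Cartesian coordinates. -/
abbrev Poly := MvPolynomial (Fin 2) ℝ

/-- The value of a polynomial at a point of the plane. -/
def pval (p : Poly) (x : Plane) : ℝ := MvPolynomial.eval (fun i => x i) p

/-- The value of a matrix of polynomials at a point. -/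
def mval (τ : Matrix (Fin 2) (Fin 2) Poly) (x : Plane) : Matrix (Fin 2) (Fin 2) ℝ :=
  Matrix.of fun i j => pval (τ i j) x

/-- Nondegenerate triangles (three affinely independent vertices `K.points 0, 1, 2`). -/
abbrev Triangle := Affine.Simplex ℝ Plane 2

/-- The closed triangle as a set of points. -/
def Triangle.body (K : Triangle) : Set Plane := convexHull ℝ (Set.range K.points)

/-- The area of a triangle. -/
def Triangle.area (K : Triangle) : ℝ := volume.real K.body

/-- The point of `K` with barycentric coordinates `α`. -/
def Triangle.pointOf (K : Triangle) (α : Fin 3 → ℝ) : Plane := ∑ j, α j • K.points j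

/-- The barycentric coordinate function of `K` that belongs to the vertex `K.points j`, as a
polynomial: `det (p - x, q - x) / det (p - a, q - a)` with `a = K.points j` and `p, q` the two
other vertices (indices are modulo 3). -/
def Triangle.bary (K : Triangle) (j : Fin 3) : Poly :=
  let a := K.points j
  let p := K.points (j + 1)
  let q := K.points (j + 2)
  MvPolynomial.C ((p 0 - a 0) * (q 1 - a 1) - (p 1 - a 1) * (q 0 - a 0))⁻¹ *
    ((MvPolynomial.C (p 0) - MvPolynomial.X 0) * (MvPolynomial.C (q 1) - MvPolynomial.X 1)
      - (MvPolynomial.C (p 1) - MvPolynomial.X 1) * (MvPolynomial.C (q 0) - MvPolynomial.X 0))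

/-- The cubic bubble function `b = λ₁ λ₂ λ₃` of `K`. -/
def Triangle.bubble (K : Triangle) : Poly := K.bary 0 * K.bary 1 * K.bary 2

/-- The reference triangle with vertices `(0,0)`, `(1,0)`, `(0,1)`. -/
def refTriangle : Triangle where
  points := ![!₂[0, 0], !₂[1, 0], !₂[0, 1]]
  independent := by
    rw [affineIndependent_iff_linearIndependent_vsub ℝ _ (0 : Fin 3), Fintype.linearIndependent_iff]
    intro g hg i
    have hu : (Finset.univ : Finset {x : Fin 3 // x ≠ 0}) = {⟨1, by decide⟩, ⟨2, by decide⟩} := by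
      decide
    rw [hu, Finset.sum_pair (by decide)] at hg
    have e0 := congrArg (fun v : Plane => v 0) hg
    have e1 := congrArg (fun v : Plane => v 1) hg
    simp at e0 e1
    obtain ⟨i, hne⟩ := i
    fin_cases i
    · simp at hne
    · exact e0
    · exact e1

/-! ### The local space `P_{k,k'}` and mass-lumping quadrature rules -/

/-- `P_{k,k'}(K) = P_k(K) + b P_{k'-3}(K)`. -/
def Pkk (k k' : ℕ) (K : Triangle) : Set Poly :=
  {p | ∃ q s : Poly, q.totalDegree ≤ k ∧ s.totalDegree ≤ k' - 3 ∧ p = q + K.bubble * s}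

/-- A `P_{k,k'}`-Lagrange element together with the quadrature rule supported on its nodes, given
in barycentric coordinates.  On a triangle `K` the nodes are the points with barycentric
coordinates `node i` and the weights are `w_i = area K * weight i`.  The Lagrange property and the
degree of exactness are imposed on the reference triangle. -/
structure LumpingRule (k k' : ℕ) where
  /-- the number of nodes -/
  r : ℕ
  /-- barycentric coordinates of the nodes -/
  node : Fin r → Fin 3 → ℝ
  /-- weights relative to the area -/
  weight : Fin r → ℝ
  node_nonneg : ∀ i j, 0 ≤ node i j
  node_sum : ∀ i, ∑ j, node i j = 1
  /-- `P_{k,k'}`-functions are uniquely determined by arbitrary nodal values. -/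
  unisolvent : ∀ y : Fin r → ℝ,
    ∃! p : Poly, p ∈ Pkk k k' refTriangle ∧ ∀ i, pval p (refTriangle.pointOf (node i)) = y i
  /-- the weights on `K` add up to the area of `K` -/
  weight_sum : ∑ i, weight i = 1
  /-- the weights are strictly positive -/
  weight_pos : ∀ i, 0 < weight i
  /-- the rule is exact for polynomials of degree at most `k + k' - 2` -/
  exact : ∀ p : Poly, p.totalDegree ≤ k + k' - 2 →
    ∫ x in refTriangle.body, pval p x =
      refTriangle.area * ∑ i, weight i * pval p (refTriangle.pointOf (node i))

/-- The quadrature operator `I_{k,k',K}`, `f ↦ ∑ w_i f(χ_i)`. -/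
def LumpingRule.quad {k k' : ℕ} (Q : LumpingRule k k') (K : Triangle) (f : Plane → ℝ) : ℝ :=
  ∑ i, (K.area * Q.weight i) * f (K.pointOf (Q.node i))

/-! ### Domains and conforming triangulations -/

/-- Bounded polygonal regions: bounded open sets that lie locally on one side of their boundary,
the boundary being a finite union of line segments. (Connectedness is not needed.) -/
structure IsPolygonal (Ω : Set Plane) : Prop where
  isOpen : IsOpen Ω
  bounded : Bornology.IsBounded Ω
  regular : interior (closure Ω) = Ω
  frontier_eq : ∃ S : Finset (Plane × Plane), frontier Ω = ⋃ e ∈ S, segment ℝ e.1 e.2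

/-- Conforming triangulations of `Ω`: finitely many triangles that cover the closure of `Ω`, any
two distinct ones being disjoint or meeting exactly in a common vertex or in a common edge. -/
structure Triangulation (Ω : Set Plane) where
  cells : Finset Triangle
  cover : ⋃ K ∈ cells, K.body = closure Ω
  conforming : ∀ K ∈ cells, ∀ L ∈ cells, K ≠ L →
    K.body ∩ L.body = ∅ ∨
    (∃ i j, K.points i = L.points j ∧ K.body ∩ L.body = {K.points i}) ∨
    (∃ i i' j j', i ≠ i' ∧ K.points i = L.points j ∧ K.points i' = L.points j' ∧
      K.body ∩ L.body = segment ℝ (K.points i) (K.points i'))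

/-! ### Sobolev spaces through weak derivatives -/

/-- Test functions `C_c^∞(Ω)`. -/
def IsTest (Ω : Set Plane) (φ : Plane → ℝ) : Prop :=
  ContDiff ℝ ∞ φ ∧ HasCompactSupport φ ∧ tsupport φ ⊆ Ω

/-- The classical partial derivative in the direction of the `j`-th coordinate. -/
def pderiv (j : Fin 2) (φ : Plane → ℝ) (x : Plane) : ℝ :=
  fderiv ℝ φ x (EuclideanSpace.single j 1)

/-- `u ∈ L²(Ω)`. -/
def MemL2 (Ω : Set Plane) (u : Plane → ℝ) : Prop := MemLp u 2 (volume.restrict Ω)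

/-- `v ∈ L²(Ω; ℝ²)`. -/
def MemL2Vec (Ω : Set Plane) (v : Plane → Fin 2 → ℝ) : Prop := ∀ i, MemL2 Ω fun x => v x i

/-- `u ∈ H¹(Ω)`: `u` and its weak first partial derivatives are in `L²(Ω)`. -/
def MemH1 (Ω : Set Plane) (u : Plane → ℝ) : Prop :=
  MemL2 Ω u ∧ ∀ j, ∃ g, MemL2 Ω g ∧
    ∀ φ, IsTest Ω φ → ∫ x in Ω, u x * pderiv j φ x = - ∫ x in Ω, g x * φ x

/-- `g` is the weak (row-wise) divergence of the matrix field `τ` in `Ω`. -/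
def IsWeakDiv (Ω : Set Plane) (τ : Plane → Matrix (Fin 2) (Fin 2) ℝ) (g : Plane → Fin 2 → ℝ) :
    Prop :=
  ∀ φ, IsTest Ω φ → ∀ i,
    ∫ x in Ω, ∑ j, τ x i j * pderiv j φ x = - ∫ x in Ω, g x i * φ x

/-- `τ ∈ H(div, Ω; 𝕊)`: symmetric square-integrable matrix fields with square-integrable weak
divergence. -/
def MemHDiv (Ω : Set Plane) (τ : Plane → Matrix (Fin 2) (Fin 2) ℝ) : Prop :=
  (∀ᵐ x ∂(volume.restrict Ω), (τ x).IsSymm) ∧ (∀ i j, MemL2 Ω fun x => τ x i j) ∧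
    ∃ g, MemL2Vec Ω g ∧ IsWeakDiv Ω τ g

open Classical in
/-- The weak divergence of `τ ∈ H(div, Ω; 𝕊)`, unique up to equality almost everywhere in `Ω`. -/
def weakDiv (Ω : Set Plane) (τ : Plane → Matrix (Fin 2) (Fin 2) ℝ) : Plane → Fin 2 → ℝ :=
  if h : ∃ g, MemL2Vec Ω g ∧ IsWeakDiv Ω τ g then h.choose else 0

/-- The `L²` inner product of vector fields. -/
def innerVec (Ω : Set Plane) (v w : Plane → Fin 2 → ℝ) : ℝ := ∫ x in Ω, ∑ i, v x i * w x i

/-- The Frobenius product `A : B`. -/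
def ddot (A B : Matrix (Fin 2) (Fin 2) ℝ) : ℝ := ∑ i, ∑ j, A i j * B i j

/-- The `L²` norm of a matrix field. -/
def normMat (Ω : Set Plane) (τ : Plane → Matrix (Fin 2) (Fin 2) ℝ) : ℝ :=
  Real.sqrt (∫ x in Ω, ddot (τ x) (τ x))

/-! ### Piecewise polynomial fields -/

variable {Ω : Set Plane}

/-- Piecewise polynomial matrix fields: one matrix of polynomials for each cell. A square-integrable
field that is polynomial on each cell is the same as such a family; the family also supplies the
one-sided values on the boundary of each cell. -/
abbrev MatField (T : Triangulation Ω) := T.cells → Matrix (Fin 2) (Fin 2) Poly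

/-- Piecewise polynomial vector fields. -/
abbrev VecField (T : Triangulation Ω) := T.cells → Fin 2 → Poly

/-- The matrix field on the plane given by a piecewise polynomial (defined almost everywhere; it is
set to zero on the boundaries of the cells). -/
def matFun (T : Triangulation Ω) (τ : MatField T) (x : Plane) : Matrix (Fin 2) (Fin 2) ℝ :=
  ∑ K : T.cells, (interior K.1.body).indicator (fun x => mval (τ K) x) x

/-- The vector field on the plane given by a piecewise polynomial. -/
def vecFun (T : Triangulation Ω) (v : VecField T) (x : Plane) : Fin 2 → ℝ :=
  ∑ K : T.cells, (interior K.1.body).indicator (fun x i => pval (v K i) x) x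

/-- `P_m(K; 𝕊)`. -/
def PolyS (m : ℕ) : Set (Matrix (Fin 2) (Fin 2) Poly) :=
  {τ | τ.IsSymm ∧ ∀ i j, (τ i j).totalDegree ≤ m}

/-- The `H(div)` bubbles `B_{k,K}`: polynomials in `P_k(K; 𝕊)` with `τ ν = 0` on each edge, where
`ν` is normal to the edge. -/
def BubbleS (k : ℕ) (K : Triangle) : Set (Matrix (Fin 2) (Fin 2) Poly) :=
  {τ | τ ∈ PolyS k ∧ ∀ i j : Fin 3, i ≠ j → ∀ x ∈ segment ℝ (K.points i) (K.points j),
    ∀ ν : Plane, inner ℝ ν (K.points j - K.points i) = 0 → mval τ x *ᵥ (fun l => ν l) = 0}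

/-- The `H¹`-conforming part of the Hu-Zhang stress space. -/
def SigmaTilde (k : ℕ) (T : Triangulation Ω) : Set (MatField T) :=
  {τ | (∀ i j, MemH1 Ω fun x => matFun T τ x i j) ∧ ∀ K, τ K ∈ PolyS k}

/-- The global `H(div)` bubble space `B_{k,h}`. -/
def BubbleSpace (k : ℕ) (T : Triangulation Ω) : Set (MatField T) :=
  {τ | MemHDiv Ω (matFun T τ) ∧ ∀ K : T.cells, τ K ∈ BubbleS k K.1}

/-- The Hu-Zhang stress space `Σ_{k,h}`. -/
def SigmaHZ (k : ℕ) (T : Triangulation Ω) : Set (MatField T) :=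
  {τ | ∃ a ∈ SigmaTilde k T, ∃ b ∈ BubbleSpace k T, τ = a + b}

/-- The enrichment `Λ_{k,k'}`: on each cell, elements of `∑ b P_i^hom(K; 𝕊)`, `k-2 ≤ i ≤ k'-3`. -/
def Enrich (k k' : ℕ) (T : Triangulation Ω) : Set (MatField T) :=
  {τ | MemHDiv Ω (matFun T τ) ∧ ∀ K : T.cells, ∃ q : ℕ → Matrix (Fin 2) (Fin 2) Poly,
    (∀ n, (q n).IsSymm ∧ ∀ i j, (q n i j).IsHomogeneous n) ∧
    τ K = K.1.bubble • ∑ n ∈ Finset.Icc (k - 2) (k' - 3), q n}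

/-- The stress space `Σ_{k,k',h} = Σ_{k,h} ⊕ Λ_{k,k'}`. -/
def StressSpace (k k' : ℕ) (T : Triangulation Ω) : Set (MatField T) :=
  {τ | ∃ a ∈ SigmaHZ k T, ∃ b ∈ Enrich k k' T, τ = a + b}

/-- The Hu-Zhang displacement space `V_{k,h}` (piecewise `P_{k-1}`). -/
def VHZ (k : ℕ) (T : Triangulation Ω) : Set (VecField T) :=
  {v | ∀ K i, (v K i).totalDegree ≤ k - 1}

/-- The displacement space `V_{k,k',h} = V_{k,h} + div Λ_{k,k'}`. -/
def DispSpace (k k' : ℕ) (T : Triangulation Ω) : Set (VecField T) :=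
  {v | ∃ w ∈ VHZ k T, ∃ τ ∈ Enrich k k' T,
    vecFun T v =ᵐ[volume.restrict Ω] vecFun T w + weakDiv Ω (matFun T τ)}

/-! ### The mass-lumped scheme -/

/-- The compliance tensor `𝒜σ = (σ - λ/(2μ+2λ) tr(σ) I) / (2μ)`. -/
def compliance (lam mu : ℝ) (σ : Matrix (Fin 2) (Fin 2) ℝ) : Matrix (Fin 2) (Fin 2) ℝ :=
  (1 / (2 * mu)) • (σ - (lam / (2 * mu + 2 * lam) * σ.trace) • (1 : Matrix (Fin 2) (Fin 2) ℝ))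

/-- The lumped form `(𝒜σ, τ)_h = ∑_K I_{k,k',K}(𝒜σ : τ)`. -/
def lumped {k k' : ℕ} (Q : LumpingRule k k') (lam mu : ℝ) (T : Triangulation Ω)
    (σ τ : MatField T) : ℝ :=
  ∑ K : T.cells, Q.quad K.1 fun x => ddot (compliance lam mu (mval (σ K) x)) (mval (τ K) x)

/-- `(σ, u)` solves the mass-lumped mixed scheme with body force `f`. -/
structure IsLumpedSolution {k k' : ℕ} (Q : LumpingRule k k') (lam mu : ℝ) (T : Triangulation Ω)
    (f : Plane → Fin 2 → ℝ) (σ : MatField T) (u : VecField T) : Prop where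
  stress_mem : σ ∈ StressSpace k k' T
  displacement_mem : u ∈ DispSpace k k' T
  constitutive : ∀ τ ∈ StressSpace k k' T,
    lumped Q lam mu T σ τ + innerVec Ω (weakDiv Ω (matFun T τ)) (vecFun T u) = 0
  equilibrium : ∀ v ∈ DispSpace k k' T,
    - innerVec Ω (weakDiv Ω (matFun T σ)) (vecFun T v) = innerVec Ω f (vecFun T v)

end LumpedElasticity

end

/-! Coercivity. The compliance tensor has eigenvalue `1/(2μ)` on trace-free matrices and
`1/(2(μ+λ))` on multiples of the identity, so `𝒜A : A` dominates `|A|²/(2(μ+λ))` at every node. It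
remains to bound an `L²` norm by the weighted sum of squared nodal values. On the reference triangle
this follows by expanding in the nodal basis, which unisolvence supplies, and applying
Cauchy-Schwarz with the positive weights (`LumpingRule.exists_bound_refTriangle`). Affine maps
preserve degrees, barycentric coordinates and hence the bubble, and both sides scale with the area,
so one constant serves all triangles.

Solvability. The scheme is a finite-dimensional square saddle point system, so uniqueness gives
existence. Testing the homogeneous system with its own solution leaves `(𝒜σ, σ)_h = 0`, hence `σ =
0`. What remains is that a displacement `u` orthogonal to the divergences of all discrete stresses
vanishes (`eq_zero_of_orthogonal`). There are three steps.

(a) `u` is a rigid motion on each cell (`isRigid_of_orthogonal`). Write `u = w + div τ` with `w` of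
degree at most `k - 1` and `τ` in the enrichment, and let `div β` be the projection of `w` to the
divergences of the `H(div)` bubbles. The remainder `w - div β` is orthogonal to the divergences of
the fields `λ_p λ_q g t tᵀ`; taking for `g` its own tangential strain shows that all three edge
strains vanish, so it is rigid. Rigid motions are orthogonal to the divergence of every symmetric
field with zero normal trace, so testing `u` with `β + τ` gives `div (β + τ) = 0`, and `u = w - div
β`.

(b) `u` has no jumps on interior edges and vanishes on boundary edges. The test stress is `λ_p λ_q
Q` on the cells at the edge, with `Q` symmetric, affine and such that `Qν` is the jump (or the
trace) of `u`. It has degree 3, vanishes on the other edges and belongs to `H¹`; the pairing is a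
weighted integral of the squared jump.

(c) A rigid motion vanishing on an edge is zero. If `u` were nonzero on some cells, follow a ray
from one of them, chosen to miss all vertices, to the last point where it meets their union. That
point is inside an edge. By (b) the edge is interior and the cell behind it also carries a nonzero
`u`, but the ray continues into this cell, a contradiction. No connectedness is used.

Since fields are families of polynomials, one also needs that the weak divergence, an
almost-everywhere class, is the cellwise one (`ae_eq_pdiv`), and that almost-everywhere equality
determines the polynomials (`vecFun_injective`). -/

noncomputable section

namespace LumpedElasticity

variable {Ω : Set Plane}

/-! ### Evaluation of polynomials -/

@[simp] lemma pval_add (p q : Poly) (x : Plane) : pval (p + q) x = pval p x + pval q x := by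
  simp [pval]
@[simp] lemma pval_sub (p q : Poly) (x : Plane) : pval (p - q) x = pval p x - pval q x := by
  simp [pval]
@[simp] lemma pval_mul (p q : Poly) (x : Plane) : pval (p * q) x = pval p x * pval q x := by
  simp [pval]
@[simp] lemma pval_zero (x : Plane) : pval 0 x = 0 := by simp [pval]
@[simp] lemma pval_C (c : ℝ) (x : Plane) : pval (MvPolynomial.C c) x = c := by simp [pval]
@[simp] lemma pval_X (i : Fin 2) (x : Plane) : pval (MvPolynomial.X i) x = x i := by simp [pval]
@[simp] lemma pval_smul (c : ℝ) (p : Poly) (x : Plane) : pval (c • p) x = c * pval p x := by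
  simp [pval, MvPolynomial.smul_eval]
@[simp] lemma pval_pow (p : Poly) (n : ℕ) (x : Plane) : pval (p ^ n) x = pval p x ^ n := by
  simp [pval]
lemma pval_sum {ι : Type*} (s : Finset ι) (f : ι → Poly) (x : Plane) :
    pval (∑ i ∈ s, f i) x = ∑ i ∈ s, pval (f i) x := by
  simp [pval]

@[fun_prop] lemma contDiff_pval (p : Poly) : ContDiff ℝ ∞ (pval p) := by
  induction p using MvPolynomial.induction_on with
  | C a => simpa [funext (pval_C a)] using contDiff_const
  | add p q hp hq => simpa [funext (pval_add p q)] using hp.add hq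
  | mul_X p i hp =>
    have : pval (p * MvPolynomial.X i) = fun x => pval p x * x i := by ext x; simp
    rw [this]
    fun_prop

@[fun_prop] lemma continuous_pval (p : Poly) : Continuous (pval p) := (contDiff_pval p).continuous

@[fun_prop] lemma differentiable_pval (p : Poly) : Differentiable ℝ (pval p) :=
  (contDiff_pval p).differentiable (by simp)

lemma pderiv_pval (j : Fin 2) (p : Poly) (x : Plane) :
    pderiv j (pval p) x = pval (MvPolynomial.pderiv j p) x := by
  unfold pderiv
  induction p using MvPolynomial.induction_on with
  | C a => simp [funext (pval_C a)]
  | add p q hp hq =>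
    have : pval (p + q) = pval p + pval q := by ext x; simp
    rw [this, fderiv_add (by fun_prop) (by fun_prop)]
    simp [hp, hq]
  | mul_X p i hp =>
    have : pval (p * MvPolynomial.X i) = pval p * fun x => x i := by ext x; simp
    have h2 : fderiv ℝ (fun x : Plane => x i) x = EuclideanSpace.proj i :=
      ContinuousLinearMap.fderiv (EuclideanSpace.proj i : Plane →L[ℝ] ℝ)
    rw [this, fderiv_mul (by fun_prop) (by fun_prop), h2]
    simp [hp, MvPolynomial.pderiv_X, Pi.single_apply]
    split_ifs <;> simp_all

/-- A polynomial that vanishes on a nonempty open set is zero. -/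
lemma eq_zero_of_pval_eq_zero {U : Set Plane} (hU : IsOpen U) (hne : U.Nonempty) {p : Poly}
    (h : ∀ x ∈ U, pval p x = 0) : p = 0 := by
  obtain ⟨x, hx⟩ := hne
  -- A ball for the maximum norm is a product of intervals, so it is enough that the polynomial
  -- vanishes on a product of infinite sets.
  have hV : IsOpen ((fun y : Fin 2 → ℝ => (WithLp.toLp 2 y : Plane)) ⁻¹' U) :=
    hU.preimage (PiLp.continuous_toLp 2 _)
  obtain ⟨ε, hε, hb⟩ := Metric.isOpen_iff.1 hV x.ofLp (by simpa using hx)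
  refine MvPolynomial.funext_set (fun i => Metric.ball (x i) ε) (fun i => ?_) (fun y hy => ?_)
  · rw [Real.ball_eq_Ioo]; exact Set.Ioo_infinite (by linarith)
  · have hy' : y ∈ Metric.ball x.ofLp ε := by
      rw [ball_pi _ hε]; exact hy
    simpa [pval] using h _ (hb hy')

lemma totalDegree_pderiv_le (p : Poly) (i : Fin 2) {n : ℕ} (h : p.totalDegree ≤ n) :
    (MvPolynomial.pderiv i p).totalDegree ≤ n - 1 := by
  refine Finset.sup_le fun m hm => ?_
  rw [MvPolynomial.mem_support_iff, MvPolynomial.coeff_pderiv] at hm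
  have h1 := MvPolynomial.le_totalDegree (p := p)
    (MvPolynomial.mem_support_iff.2 (left_ne_zero_of_mul hm))
  rw [Finsupp.sum_add_index' (by simp) (by simp), Finsupp.sum_single_index rfl] at h1
  omega

/-! ### Barycentric coordinates -/

/-- Twice the signed area. -/
def Triangle.det (K : Triangle) : ℝ :=
  (K.points 1 0 - K.points 0 0) * (K.points 2 1 - K.points 0 1)
    - (K.points 1 1 - K.points 0 1) * (K.points 2 0 - K.points 0 0)

/-- A normal vector of the edge opposite to the vertex `j`: the gradient of `K.det * K.bary j`. -/
def Triangle.nrm (K : Triangle) (j : Fin 3) : Fin 2 → ℝ :=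
  ![K.points (j + 1) 1 - K.points (j + 2) 1, K.points (j + 2) 0 - K.points (j + 1) 0]

lemma Triangle.det_ne_zero (K : Triangle) : K.det ≠ 0 := by
  intro h
  have hi := K.independent
  rw [affineIndependent_iff] at hi
  have key : ∀ a b : ℝ, (∀ i, a * (K.points 1 i - K.points 0 i)
      + b * (K.points 2 i - K.points 0 i) = 0) → a = 0 ∧ b = 0 := by
    intro a b hab
    have := hi Finset.univ ![-a - b, a, b] (by simp [Fin.sum_univ_three]; ring) (by
      ext i
      have := hab i
      simp [Fin.sum_univ_three]
      linarith)
    exact ⟨by simpa using this 1, by simpa using this 2⟩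
  unfold Triangle.det at h
  -- If the determinant vanishes, the coordinates of the two edge vectors are themselves the
  -- coefficients of linear relations between these vectors. So all the coordinates are zero, and
  -- then any coefficients give a relation.
  obtain ⟨h1, h2⟩ := key (K.points 2 0 - K.points 0 0) (-(K.points 1 0 - K.points 0 0)) (by
    intro i; fin_cases i <;> simp <;> linarith)
  obtain ⟨h3, h4⟩ := key (K.points 2 1 - K.points 0 1) (-(K.points 1 1 - K.points 0 1)) (by
    intro i; fin_cases i <;> simp <;> linarith)
  have := key 1 0 (by intro i; fin_cases i <;> simp <;> linarith)
  simp at this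

lemma Triangle.det_eq (K : Triangle) (j : Fin 3) :
    (K.points (j + 1) 0 - K.points j 0) * (K.points (j + 2) 1 - K.points j 1)
    - (K.points (j + 1) 1 - K.points j 1) * (K.points (j + 2) 0 - K.points j 0) = K.det := by
  unfold Triangle.det
  fin_cases j <;> simp <;> ring

/-- The coordinate is the affine function with gradient `K.nrm j / K.det` that vanishes on the
opposite edge; the base point is one end of that edge. -/
lemma Triangle.det_mul_bary (K : Triangle) (j : Fin 3) (x : Plane) :
    K.det * pval (K.bary j) x =
      K.nrm j 0 * (x 0 - K.points (j + 1) 0) + K.nrm j 1 * (x 1 - K.points (j + 1) 1) := by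
  have := K.det_ne_zero
  simp only [Triangle.bary, K.det_eq j, pval_mul, pval_C, pval_sub, pval_X, Triangle.nrm]
  field_simp
  simp
  ring

lemma Triangle.pval_bary (K : Triangle) (j : Fin 3) (x : Plane) :
    pval (K.bary j) x = K.det⁻¹ *
      (K.nrm j 0 * (x 0 - K.points (j + 1) 0) + K.nrm j 1 * (x 1 - K.points (j + 1) 1)) := by
  rw [← K.det_mul_bary, inv_mul_cancel_left₀ K.det_ne_zero]

lemma Triangle.totalDegree_bary (K : Triangle) (j : Fin 3) : (K.bary j).totalDegree ≤ 1 := by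
  have h : K.bary j = MvPolynomial.C (K.det⁻¹ * K.nrm j 0) * MvPolynomial.X 0
      + MvPolynomial.C (K.det⁻¹ * K.nrm j 1) * MvPolynomial.X 1
      - MvPolynomial.C (K.det⁻¹ * (K.nrm j 0 * K.points (j + 1) 0
        + K.nrm j 1 * K.points (j + 1) 1)) := by
    refine MvPolynomial.funext fun x => ?_
    have := K.pval_bary j (WithLp.toLp 2 x)
    simp only [pval] at this
    simp [this]; ring
  rw [h]
  refine (MvPolynomial.totalDegree_sub _ _).trans (max_le ?_ ((MvPolynomial.totalDegree_C _).trans_le zero_le_one))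
  refine (MvPolynomial.totalDegree_add _ _).trans (max_le ?_ ?_) <;>
  exact (MvPolynomial.totalDegree_mul _ _).trans
    (by rw [MvPolynomial.totalDegree_C, MvPolynomial.totalDegree_X])

lemma Triangle.sum_bary (K : Triangle) (x : Plane) : ∑ j, pval (K.bary j) x = 1 := by
  have h := K.det_ne_zero
  simp only [Fin.sum_univ_three, K.pval_bary]
  field_simp
  simp [Triangle.nrm, Triangle.det]
  ring

lemma Triangle.sum_bary_mul (K : Triangle) (x : Plane) (i : Fin 2) :
    ∑ j, pval (K.bary j) x * K.points j i = x i := by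
  have h := K.det_ne_zero
  simp only [Fin.sum_univ_three, K.pval_bary]
  field_simp
  fin_cases i <;> simp [Triangle.nrm, Triangle.det] <;> ring

lemma Triangle.pointOf_bary (K : Triangle) (x : Plane) :
    K.pointOf (fun j => pval (K.bary j) x) = x := by
  ext i
  have := K.sum_bary_mul x i
  simpa [Triangle.pointOf, Fin.sum_univ_three] using this

lemma Triangle.bary_pointOf (K : Triangle) (α : Fin 3 → ℝ) (h : ∑ j, α j = 1) (j : Fin 3) :
    pval (K.bary j) (K.pointOf α) = α j := by
  have hd := K.det_ne_zero
  rw [K.pval_bary]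
  rw [Fin.sum_univ_three] at h
  obtain h : α 0 = 1 - α 1 - α 2 := by linarith
  field_simp
  fin_cases j <;> simp [Triangle.pointOf, Fin.sum_univ_three, Triangle.nrm, Triangle.det, h] <;> ring

/-- Barycentric coordinates are affine. -/
lemma Triangle.bary_lineMap (K : Triangle) (j : Fin 3) (x y : Plane) (t : ℝ) :
    pval (K.bary j) (AffineMap.lineMap x y t) =
      (1 - t) * pval (K.bary j) x + t * pval (K.bary j) y := by
  simp only [K.pval_bary, AffineMap.lineMap_apply]
  simp
  ring

lemma Triangle.bary_points (K : Triangle) (j i : Fin 3) :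
    pval (K.bary j) (K.points i) = if i = j then 1 else 0 := by
  have : K.points i = K.pointOf (Pi.single i 1) := by
    simp [Triangle.pointOf, Pi.single_apply]
  rw [this, K.bary_pointOf _ (by simp)]
  simp [Pi.single_apply, eq_comm]

/-- The three half-planes are convex and contain the vertices; conversely, the barycentric
coordinates of a point are the weights of a convex combination. -/
lemma Triangle.body_eq (K : Triangle) : K.body = {x | ∀ j, 0 ≤ pval (K.bary j) x} := by
  apply Subset.antisymm
  · refine convexHull_min ?_ ?_
    · rintro _ ⟨i, rfl⟩ j
      rw [K.bary_points]; split_ifs <;> simp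
    · intro x hx y hy a b ha hb hab j
      obtain rfl : a = 1 - b := by linarith
      have := K.bary_lineMap j x y b
      rw [AffineMap.lineMap_apply_module] at this
      rw [this]
      exact add_nonneg (mul_nonneg ha (hx j)) (mul_nonneg hb (hy j))
  · intro x hx
    rw [← K.pointOf_bary x]
    exact (convex_convexHull ℝ _).sum_mem (fun j _ => hx j) (K.sum_bary x)
      (fun j _ => subset_convexHull ℝ _ (mem_range_self j))

lemma Triangle.interior_body (K : Triangle) :
    interior K.body = {x | ∀ j, 0 < pval (K.bary j) x} := by
  apply Subset.antisymm
  · intro x hx j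
    have hxb : x ∈ K.body := interior_subset hx
    rw [K.body_eq] at hxb
    refine lt_of_le_of_ne (hxb j) fun h0 => ?_
    -- From a point with zero `j`-th coordinate, a short move directly away from vertex `j` makes
    -- that coordinate negative and so leaves the triangle.
    have hc : Filter.Tendsto (fun t : ℝ => (AffineMap.lineMap x (K.points j) t : Plane))
        (nhds 0) (nhds x) := by
      have := (AffineMap.lineMap_continuous (R := ℝ) (p := x) (q := K.points j)).tendsto 0
      simpa using this
    obtain ⟨ε, hε, hb⟩ := Metric.eventually_nhds_iff.1
      (hc.eventually (mem_interior_iff_mem_nhds.1 hx))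
    have : AffineMap.lineMap x (K.points j) (-(ε / 2)) ∈ K.body :=
      hb (y := -(ε / 2)) (by rw [Real.dist_eq, sub_zero, abs_neg, abs_of_pos (by linarith)]; linarith)
    rw [K.body_eq] at this
    have := this j
    rw [K.bary_lineMap, ← h0, K.bary_points] at this
    simp at this
    linarith
  · refine interior_maximal (fun x hx => ?_) ?_
    · rw [K.body_eq]; exact fun j => (hx j).le
    · simp only [ofPred_forall]
      exact isOpen_iInter_of_finite fun j => isOpen_lt continuous_const (continuous_pval _)

lemma Triangle.isCompact_body (K : Triangle) : IsCompact K.body :=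
  (Set.finite_range _).isCompact_convexHull (𝕜 := ℝ)
lemma Triangle.convex_body (K : Triangle) : Convex ℝ K.body := convex_convexHull ℝ _
lemma Triangle.isClosed_body (K : Triangle) : IsClosed K.body := K.isCompact_body.isClosed
lemma Triangle.measurableSet_body (K : Triangle) : MeasurableSet K.body :=
  K.isClosed_body.measurableSet

lemma Triangle.interior_nonempty (K : Triangle) : (interior K.body).Nonempty := by
  refine ⟨K.pointOf fun _ => 1 / 3, ?_⟩
  rw [K.interior_body]
  intro j
  rw [K.bary_pointOf _ (by norm_num)]
  norm_num

lemma Triangle.interior_ae_eq (K : Triangle) : interior K.body =ᵐ[volume] K.body :=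
  interior_ae_eq_of_null_frontier (K.convex_body.addHaar_frontier volume)

/-! ### The affine parametrization of a triangle -/

lemma det_refTriangle : refTriangle.det = 1 := by
  simp [Triangle.det, refTriangle]

lemma bary_refTriangle (x : Plane) (j : Fin 3) :
    pval (refTriangle.bary j) x = ![1 - x 0 - x 1, x 0, x 1] j := by
  rw [refTriangle.pval_bary, det_refTriangle]
  fin_cases j <;> simp [Triangle.nrm, refTriangle] <;> ring

/-- The affine map from the reference triangle onto `K`. -/
def Triangle.aff (K : Triangle) (x : Plane) : Plane :=
  K.pointOf fun j => pval (refTriangle.bary j) x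

lemma Triangle.bary_aff (K : Triangle) (j : Fin 3) (x : Plane) :
    pval (K.bary j) (K.aff x) = pval (refTriangle.bary j) x :=
  K.bary_pointOf _ (refTriangle.sum_bary x) j

lemma Triangle.aff_pointOf (K : Triangle) (α : Fin 3 → ℝ) (h : ∑ j, α j = 1) :
    K.aff (refTriangle.pointOf α) = K.pointOf α := by
  simp only [Triangle.aff, refTriangle.bary_pointOf α h]

lemma Triangle.aff_injective (K : Triangle) : Function.Injective K.aff := by
  intro x y h
  rw [← refTriangle.pointOf_bary x, ← refTriangle.pointOf_bary y]
  congr 1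
  ext j
  rw [← K.bary_aff, ← K.bary_aff, h]

lemma Triangle.image_aff (K : Triangle) : K.aff '' refTriangle.body = K.body := by
  ext y
  rw [K.body_eq, refTriangle.body_eq]
  constructor
  · rintro ⟨x, hx, rfl⟩ j
    rw [K.bary_aff]; exact hx j
  · intro hy
    refine ⟨refTriangle.pointOf fun j => pval (K.bary j) y, fun j => ?_, ?_⟩
    · rw [refTriangle.bary_pointOf _ (K.sum_bary y)]; exact hy j
    · rw [K.aff_pointOf _ (K.sum_bary y), K.pointOf_bary]

/-- The linear part of `K.aff`. -/
def Triangle.lin (K : Triangle) : Plane →L[ℝ] Plane :=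
  LinearMap.toContinuousLinearMap (Matrix.toLin (EuclideanSpace.basisFun (Fin 2) ℝ).toBasis
    (EuclideanSpace.basisFun (Fin 2) ℝ).toBasis
    !![K.points 1 0 - K.points 0 0, K.points 2 0 - K.points 0 0;
      K.points 1 1 - K.points 0 1, K.points 2 1 - K.points 0 1])

lemma Triangle.lin_apply (K : Triangle) (x : Plane) (i : Fin 2) :
    K.lin x i = (K.points 1 i - K.points 0 i) * x 0 + (K.points 2 i - K.points 0 i) * x 1 := by
  simp only [Triangle.lin, LinearMap.coe_toContinuousLinearMap', Matrix.toLin_apply]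
  fin_cases i <;> simp [Fin.sum_univ_two, Matrix.mulVec, dotProduct]

lemma Triangle.lin_det (K : Triangle) : K.lin.det = K.det := by
  simp only [Triangle.lin, ContinuousLinearMap.det, LinearMap.coe_toContinuousLinearMap,
    LinearMap.det_toLin, Matrix.det_fin_two_of, Triangle.det]
  ring

lemma Triangle.aff_eq (K : Triangle) (x : Plane) : K.aff x = K.points 0 + K.lin x := by
  ext i
  simp [Triangle.aff, Triangle.pointOf, Fin.sum_univ_three, K.lin_apply, bary_refTriangle]
  ring

lemma Triangle.hasFDerivAt_aff (K : Triangle) (x : Plane) : HasFDerivAt K.aff K.lin x := by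
  rw [show K.aff = fun x => K.points 0 + K.lin x from funext K.aff_eq]
  exact K.lin.hasFDerivAt.const_add _

@[fun_prop] lemma Triangle.contDiff_aff (K : Triangle) : ContDiff ℝ 1 K.aff := by
  rw [show K.aff = fun x => K.points 0 + K.lin x from funext K.aff_eq]
  fun_prop

lemma Triangle.integral_body (K : Triangle) (g : Plane → ℝ) :
    ∫ x in K.body, g x = |K.det| * ∫ x in refTriangle.body, g (K.aff x) := by
  rw [← K.image_aff, integral_image_eq_integral_abs_det_fderiv_smul volume
    refTriangle.measurableSet_body (fun x _ => (K.hasFDerivAt_aff x).hasFDerivWithinAt)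
    K.aff_injective.injOn, K.lin_det]
  simp [integral_const_mul]

/-! ### Iterated integrals over the reference triangle -/

lemma integral_refTriangle_eq_prod (g : Plane → ℝ) :
    ∫ x in refTriangle.body, g x =
      ∫ z in {z : ℝ × ℝ | 0 ≤ z.1 ∧ 0 ≤ z.2 ∧ z.1 + z.2 ≤ 1}, g !₂[z.1, z.2] := by
  have h1 : MeasurePreserving (MeasurableEquiv.toLp 2 (Fin 2 → ℝ)) :=
    PiLp.volume_preserving_toLp (Fin 2)
  have h2 := (volume_preserving_finTwoArrow ℝ).symm
  have h3 := h1.comp h2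
  rw [← h3.setIntegral_preimage_emb
    ((MeasurableEquiv.toLp 2 (Fin 2 → ℝ)).measurableEmbedding.comp
      MeasurableEquiv.finTwoArrow.symm.measurableEmbedding)]
  congr 2
  ext z
  rw [refTriangle.body_eq]
  simp only [mem_preimage, mem_ofPred_eq, bary_refTriangle, Fin.forall_fin_succ]
  simp
  constructor
  · rintro ⟨a, b, c⟩; exact ⟨b, c, by linarith⟩
  · rintro ⟨a, b, c⟩; exact ⟨by linarith, a, b⟩

lemma integral_unitTriangle (g : ℝ × ℝ → ℝ) (hg : Continuous g) :
    ∫ z in {z : ℝ × ℝ | 0 ≤ z.1 ∧ 0 ≤ z.2 ∧ z.1 + z.2 ≤ 1}, g z =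
      ∫ s in (0 : ℝ)..1, ∫ t in (0 : ℝ)..(1 - s), g (s, t) := by
  set S := {z : ℝ × ℝ | 0 ≤ z.1 ∧ 0 ≤ z.2 ∧ z.1 + z.2 ≤ 1} with hS
  have hcl : IsClosed S := by
    refine (isClosed_le continuous_const continuous_fst).inter
      ((isClosed_le continuous_const continuous_snd).inter
      (isClosed_le (continuous_fst.add continuous_snd) continuous_const))
  have hcp : IsCompact S := by
    refine (isCompact_Icc (a := ((0, 0) : ℝ × ℝ)) (b := (1, 1))).of_isClosed_subset hcl ?_
    rintro ⟨a, b⟩ ⟨h1, h2, h3⟩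
    simp only at h1 h2 h3
    exact ⟨⟨h1, h2⟩, ⟨by simp; linarith, by simp; linarith⟩⟩
  have hint : Integrable (S.indicator g) :=
    (hg.continuousOn.integrableOn_compact hcp).integrable_indicator hcl.measurableSet
  rw [← integral_indicator hcl.measurableSet, Measure.volume_eq_prod, integral_prod _ hint,
    intervalIntegral.integral_of_le zero_le_one, ← integral_Icc_eq_integral_Ioc,
    ← integral_indicator measurableSet_Icc]
  congr 1
  ext s
  by_cases hs : s ∈ Icc (0 : ℝ) 1
  · rw [indicator_of_mem hs, intervalIntegral.integral_of_le (by linarith [hs.2]),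
      ← integral_Icc_eq_integral_Ioc, ← integral_indicator measurableSet_Icc]
    congr 1
    ext t
    have : (s, t) ∈ S ↔ t ∈ Icc (0 : ℝ) (1 - s) := by
      simp only [hS, mem_ofPred_eq, mem_Icc]
      constructor
      · rintro ⟨a, b, c⟩; exact ⟨b, by linarith⟩
      · rintro ⟨b, c⟩; exact ⟨hs.1, b, by linarith⟩
    simp only [indicator, this]
  · rw [indicator_of_notMem hs]
    convert integral_zero ℝ ℝ with t
    refine indicator_of_notMem (fun h => hs ?_) _
    obtain ⟨a, b, c⟩ := h
    simp only at a b c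
    exact ⟨a, by linarith⟩

lemma integral_refTriangle (g : Plane → ℝ) (hg : Continuous g) :
    ∫ x in refTriangle.body, g x = ∫ s in (0 : ℝ)..1, ∫ t in (0 : ℝ)..(1 - s), g !₂[s, t] := by
  rw [integral_refTriangle_eq_prod]
  exact integral_unitTriangle (fun z => g !₂[z.1, z.2]) (by fun_prop)

/-- Both orders of integration are needed, so that either partial derivative can be integrated
first. -/
lemma integral_refTriangle_symm (g : Plane → ℝ) (hg : Continuous g) :
    ∫ x in refTriangle.body, g x = ∫ t in (0 : ℝ)..1, ∫ s in (0 : ℝ)..(1 - t), g !₂[s, t] := by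
  rw [integral_refTriangle_eq_prod,
    ← integral_unitTriangle (fun z => g !₂[z.2, z.1]) (by fun_prop), Measure.volume_eq_prod,
    ← (Measure.measurePreserving_swap (μ := (volume : Measure ℝ))
      (ν := volume)).setIntegral_preimage_emb MeasurableEquiv.prodComm.measurableEmbedding]
  congr 2
  ext z
  simp
  constructor
  · rintro ⟨a, b, c⟩; exact ⟨b, a, by linarith⟩
  · rintro ⟨a, b, c⟩; exact ⟨b, a, by linarith⟩

/-! ### Green's formula on a triangle -/

/-- The integral of `F` over the edge, parametrized over `[0, 1]`, that is
opposite to the vertex `j`. -/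
def Triangle.edgeInt (K : Triangle) (j : Fin 3) (F : Plane → ℝ) : ℝ :=
  ∫ t in (0 : ℝ)..1, F (AffineMap.lineMap (K.points (j + 1)) (K.points (j + 2)) t)

lemma lineMap_coord (x y : Plane) (t : ℝ) (i : Fin 2) :
    AffineMap.lineMap x y t i = (1 - t) * x i + t * y i := by
  simp [AffineMap.lineMap_apply_module]

lemma integral_lineMap_symm (F : Plane → ℝ) (a b : Plane) :
    ∫ t in (0 : ℝ)..1, F (AffineMap.lineMap a b t) =
      ∫ t in (0 : ℝ)..1, F (AffineMap.lineMap b a t) := by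
  have := intervalIntegral.integral_comp_sub_left (a := 0) (b := 1)
    (fun t => F (AffineMap.lineMap b a t)) (1 : ℝ)
  simpa [AffineMap.lineMap_apply_one_sub] using this

lemma pderiv_eq (j : Fin 2) (F : Plane → ℝ) (x : Plane) :
    pderiv j F x = fderiv ℝ F x (EuclideanSpace.single j 1) := rfl

lemma hasDerivAt_coord_zero {G : Plane → ℝ} (hG : Differentiable ℝ G) (s t : ℝ) :
    HasDerivAt (fun s => G !₂[s, t]) (pderiv 0 G !₂[s, t]) s := by
  have h : HasDerivAt (fun s : ℝ => (!₂[s, t] : Plane)) (EuclideanSpace.single 0 1) s := by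
    have h1 : (fun s : ℝ => (!₂[s, t] : Plane)) =
        fun s : ℝ => !₂[0, t] + s • (EuclideanSpace.single 0 1 : Plane) := by
      ext s i
      fin_cases i <;> simp
    rw [h1]
    simpa using ((hasDerivAt_id s).smul_const
      (EuclideanSpace.single 0 (1 : ℝ) : Plane)).const_add !₂[0, t]
  exact (hG _).hasFDerivAt.comp_hasDerivAt s h

lemma hasDerivAt_coord_one {G : Plane → ℝ} (hG : Differentiable ℝ G) (s t : ℝ) :
    HasDerivAt (fun t => G !₂[s, t]) (pderiv 1 G !₂[s, t]) t := by
  have h : HasDerivAt (fun t : ℝ => (!₂[s, t] : Plane)) (EuclideanSpace.single 1 1) t := by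
    have h1 : (fun t : ℝ => (!₂[s, t] : Plane)) =
        fun t : ℝ => !₂[s, 0] + t • (EuclideanSpace.single 1 1 : Plane) := by
      ext t i
      fin_cases i <;> simp
    rw [h1]
    simpa using ((hasDerivAt_id t).smul_const
      (EuclideanSpace.single 1 (1 : ℝ) : Plane)).const_add !₂[s, 0]
  exact (hG _).hasFDerivAt.comp_hasDerivAt t h

@[fun_prop] lemma continuous_pderiv {G : Plane → ℝ} (hG : ContDiff ℝ 1 G) (j : Fin 2) :
    Continuous (pderiv j G) :=
  (hG.continuous_fderiv (by simp)).clm_apply continuous_const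

/-- Fundamental theorem of calculus on horizontal lines: they enter through the edge opposite to
vertex 1 and leave through the edge opposite to vertex 0. The height is the parameter on both edges,
so no length factors appear. -/
lemma integral_pderiv_zero_refTriangle {G : Plane → ℝ} (hG : ContDiff ℝ 1 G) :
    ∫ x in refTriangle.body, pderiv 0 G x =
      refTriangle.edgeInt 0 G - refTriangle.edgeInt 1 G := by
  have hc := continuous_pderiv hG 0
  rw [integral_refTriangle_symm _ hc]
  have h1 : ∀ t : ℝ, ∫ s in (0 : ℝ)..(1 - t), pderiv 0 G !₂[s, t] =
      G !₂[1 - t, t] - G !₂[0, t] := fun t =>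
    intervalIntegral.integral_eq_sub_of_hasDerivAt
      (fun s _ => hasDerivAt_coord_zero (hG.differentiable (by simp)) s t)
      (Continuous.intervalIntegrable (by fun_prop) _ _)
  have hGc := hG.continuous
  simp_rw [h1]
  rw [intervalIntegral.integral_sub (Continuous.intervalIntegrable (by fun_prop) _ _)
    (Continuous.intervalIntegrable (by fun_prop) _ _)]
  congr 1
  · unfold Triangle.edgeInt
    congr! 3 with t
    ext i
    fin_cases i <;> simp [refTriangle, AffineMap.lineMap_apply] <;> ring
  · unfold Triangle.edgeInt
    rw [integral_lineMap_symm]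
    congr! 3 with t
    ext i
    fin_cases i <;> simp [refTriangle, AffineMap.lineMap_apply]

lemma integral_pderiv_one_refTriangle {G : Plane → ℝ} (hG : ContDiff ℝ 1 G) :
    ∫ x in refTriangle.body, pderiv 1 G x =
      refTriangle.edgeInt 0 G - refTriangle.edgeInt 2 G := by
  have hc := continuous_pderiv hG 1
  rw [integral_refTriangle _ hc]
  have h1 : ∀ s : ℝ, ∫ t in (0 : ℝ)..(1 - s), pderiv 1 G !₂[s, t] =
      G !₂[s, 1 - s] - G !₂[s, 0] := fun s =>
    intervalIntegral.integral_eq_sub_of_hasDerivAt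
      (fun t _ => hasDerivAt_coord_one (hG.differentiable (by simp)) s t)
      (Continuous.intervalIntegrable (by fun_prop) _ _)
  have hGc := hG.continuous
  simp_rw [h1]
  rw [intervalIntegral.integral_sub (Continuous.intervalIntegrable (by fun_prop) _ _)
    (Continuous.intervalIntegrable (by fun_prop) _ _)]
  congr 1
  · unfold Triangle.edgeInt
    rw [integral_lineMap_symm]
    congr! 3 with t
    ext i
    fin_cases i <;> simp [refTriangle, AffineMap.lineMap_apply] <;> ring
  · unfold Triangle.edgeInt
    congr! 3 with t
    ext i
    fin_cases i <;> simp [refTriangle, AffineMap.lineMap_apply]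

lemma Triangle.aff_lineMap (K : Triangle) (i j : Fin 3) (t : ℝ) :
    K.aff (AffineMap.lineMap (refTriangle.points i) (refTriangle.points j) t) =
      AffineMap.lineMap (K.points i) (K.points j) t := by
  ext l
  have h1 (z : Plane) : K.aff z l = ∑ m, pval (refTriangle.bary m) z * K.points m l := by
    simp [Triangle.aff, Triangle.pointOf, Fin.sum_univ_three]
  rw [h1, lineMap_coord]
  simp only [refTriangle.bary_lineMap, refTriangle.bary_points, add_mul, mul_assoc, ite_mul,
    one_mul, zero_mul, Finset.sum_add_distrib, ← Finset.mul_sum, Finset.sum_ite_eq,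
    Finset.mem_univ, if_true]

lemma Triangle.edgeInt_comp_aff (K : Triangle) (j : Fin 3) (F : Plane → ℝ) :
    refTriangle.edgeInt j (fun x => F (K.aff x)) = K.edgeInt j F := by
  simp only [Triangle.edgeInt, K.aff_lineMap]

/-- The chain rule solved by Cramer's rule: the normals of the edges opposite to vertices 1 and 2
form the adjugate of the linear part of `K.aff`. -/
lemma Triangle.pderiv_comp_aff (K : Triangle) {F : Plane → ℝ} (hF : Differentiable ℝ F)
    (i : Fin 2) (x : Plane) : K.det * pderiv i F (K.aff x) =
      - (K.nrm 1 i * (-pderiv 0 (fun x => F (K.aff x)) x)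
        + K.nrm 2 i * (-pderiv 1 (fun x => F (K.aff x)) x)) := by
  have h : fderiv ℝ (fun x => F (K.aff x)) x = (fderiv ℝ F (K.aff x)).comp K.lin :=
    ((hF _).hasFDerivAt.comp x (K.hasFDerivAt_aff x)).fderiv
  simp only [pderiv_eq, h, ContinuousLinearMap.comp_apply]
  have hv : K.det • (EuclideanSpace.single i 1 : Plane) =
      K.nrm 1 i • K.lin (EuclideanSpace.single 0 1) +
        K.nrm 2 i • K.lin (EuclideanSpace.single 1 1) := by
    ext l
    simp only [PiLp.smul_apply, PiLp.add_apply, K.lin_apply]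
    fin_cases i <;> fin_cases l <;> simp [Triangle.nrm, Triangle.det] <;> ring
  rw [← smul_eq_mul, ← map_smul, hv]
  simp
  ring

/-- The outward normal (scaled by the length) of the edge opposite to the vertex `j` is
`- K.sgnrm j`. -/
def Triangle.sgnrm (K : Triangle) (j : Fin 3) (i : Fin 2) : ℝ := SignType.sign K.det * K.nrm j i

lemma Triangle.sum_nrm (K : Triangle) (i : Fin 2) : K.nrm 0 i = - K.nrm 1 i - K.nrm 2 i := by
  fin_cases i <;> simp [Triangle.nrm]

/-- **Green's formula** on a triangle. -/
lemma Triangle.green (K : Triangle) {F : Plane → ℝ} (hF : ContDiff ℝ 1 F) (i : Fin 2) :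
    ∫ x in K.body, pderiv i F x = - ∑ j, K.sgnrm j i * K.edgeInt j F := by
  have hd := K.det_ne_zero
  have hG : ContDiff ℝ 1 (fun x => F (K.aff x)) := hF.comp K.contDiff_aff
  have hint : ∀ j : Fin 2, IntegrableOn (pderiv j (fun x => F (K.aff x))) refTriangle.body :=
    fun j => (continuous_pderiv hG j).continuousOn.integrableOn_compact refTriangle.isCompact_body
  rw [K.integral_body]
  have h1 : ∀ x, |K.det| * pderiv i F (K.aff x) =
      SignType.sign K.det * K.nrm 1 i * pderiv 0 (fun x => F (K.aff x)) x
        + SignType.sign K.det * K.nrm 2 i * pderiv 1 (fun x => F (K.aff x)) x := by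
    intro x
    have := K.pderiv_comp_aff (hF.differentiable (by simp)) i x
    rw [← sign_mul_self K.det]
    linear_combination (SignType.sign K.det : ℝ) * this
  rw [← integral_const_mul]
  simp_rw [h1]
  rw [integral_add ((hint 0).const_mul _) ((hint 1).const_mul _), integral_const_mul,
    integral_const_mul, integral_pderiv_zero_refTriangle hG, integral_pderiv_one_refTriangle hG]
  -- Both reference integrals contribute to the edge opposite to vertex 0, whose normal is minus the
  -- sum of the other two.
  simp only [K.edgeInt_comp_aff, Fin.sum_univ_three, Triangle.sgnrm, K.sum_nrm]
  ring

/-! ### Cells of a triangulation -/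

lemma Triangle.bary_ne_zero (K : Triangle) (j : Fin 3) : K.bary j ≠ 0 := by
  intro h
  have := K.bary_points j j
  simp [h] at this

lemma Triangle.bary_eq_zero_of_mem_segment (K : Triangle) {i i' j : Fin 3} (hi : i ≠ j)
    (hi' : i' ≠ j) {x : Plane} (hx : x ∈ segment ℝ (K.points i) (K.points i')) :
    pval (K.bary j) x = 0 := by
  rw [segment_eq_image_lineMap] at hx
  obtain ⟨t, -, rfl⟩ := hx
  simp [K.bary_lineMap, K.bary_points, hi, hi']

/-- Two cells meet within a vertex or an edge, where some barycentric coordinate is zero. If the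
open cells overlapped, that coordinate would vanish on an open set and be the zero polynomial. -/
lemma Triangulation.disjoint_interior (T : Triangulation Ω) :
    Pairwise (Function.onFun Disjoint fun K : T.cells => interior K.1.body) := by
  intro K L hKL
  have hKL' : K.1 ≠ L.1 := fun h => hKL (Subtype.ext h)
  rw [Function.onFun, Set.disjoint_iff_inter_eq_empty]
  by_contra hne
  rw [← ne_eq, ← Set.nonempty_iff_ne_empty] at hne
  have ho : IsOpen (interior K.1.body ∩ interior L.1.body) :=
    isOpen_interior.inter isOpen_interior
  have hsub : interior K.1.body ∩ interior L.1.body ⊆ K.1.body ∩ L.1.body :=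
    inter_subset_inter interior_subset interior_subset
  have key : ∀ i i' : Fin 3, K.1.body ∩ L.1.body ⊆ segment ℝ (K.1.points i) (K.1.points i') →
      False := by
    intro i i' h
    obtain ⟨j, hj, hj'⟩ : ∃ j : Fin 3, i ≠ j ∧ i' ≠ j := by
      clear h
      revert i i'
      decide
    exact K.1.bary_ne_zero j (eq_zero_of_pval_eq_zero ho hne fun x hx =>
      K.1.bary_eq_zero_of_mem_segment hj hj' (h (hsub hx)))
  rcases T.conforming K.1 K.2 L.1 L.2 hKL' with h | ⟨i, j, -, h⟩ | ⟨i, i', j, j', -, -, -, h⟩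
  · obtain ⟨x, hx⟩ := hne
    simpa [h] using hsub hx
  · exact key i i (by rw [h, segment_same])
  · exact key i i' h.le

lemma Triangulation.body_subset (T : Triangulation Ω) (K : T.cells) : K.1.body ⊆ closure Ω := by
  rw [← T.cover]
  exact subset_biUnion_of_mem (u := fun K : Triangle => K.body) K.2

/-- Cells are only known to lie in `closure Ω`. Regularity, `interior (closure Ω) = Ω`, excludes
slits inside a cell. -/
lemma Triangulation.interior_subset (hΩ : IsPolygonal Ω) (T : Triangulation Ω) (K : T.cells) :
    interior K.1.body ⊆ Ω := by
  exact (interior_mono (T.body_subset K)).trans hΩ.regular.le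

lemma Triangulation.ae_eq (hΩ : IsPolygonal Ω) (T : Triangulation Ω) :
    Ω =ᵐ[volume] ⋃ K : T.cells, interior K.1.body := by
  refine Filter.EventuallyLE.antisymm ?_
    (Filter.Eventually.of_forall (iUnion_subset fun K => T.interior_subset hΩ K))
  have h1 : (⋃ K : T.cells, interior K.1.body) =ᵐ[volume] ⋃ K : T.cells, K.1.body :=
    Filter.EventuallyEq.countable_iUnion fun K => K.1.interior_ae_eq
  refine Filter.EventuallyLE.trans ?_ h1.symm.le
  refine Filter.Eventually.of_forall ?_
  intro x hx
  have hx' := subset_closure hx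
  rw [← T.cover] at hx'
  simp only [mem_iUnion, exists_prop] at hx'
  obtain ⟨K, hK, hxK⟩ := hx'
  exact mem_iUnion.2 ⟨⟨K, hK⟩, hxK⟩

lemma Triangulation.ae_restrict (hΩ : IsPolygonal Ω) (T : Triangulation Ω) {P : Plane → Prop}
    (h : ∀ K : T.cells, ∀ᵐ x, x ∈ interior K.1.body → P x) :
    ∀ᵐ x ∂(volume.restrict Ω), P x := by
  rw [ae_restrict_iff' hΩ.isOpen.measurableSet]
  have h2 := (T.ae_eq hΩ).mem_iff
  filter_upwards [ae_all_iff.2 h, h2] with x hx hx2 hxΩ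
  obtain ⟨K, hK⟩ := mem_iUnion.1 (hx2.1 hxΩ)
  exact hx K hK

/-- Integration over `Ω`, cell by cell. -/
lemma Triangulation.integral_eq (hΩ : IsPolygonal Ω) (T : Triangulation Ω) {G : Plane → ℝ}
    {g : T.cells → Plane → ℝ} (hg : ∀ K, Continuous (g K))
    (h : ∀ K, EqOn G (g K) (interior K.1.body)) :
    ∫ x in Ω, G x = ∑ K : T.cells, ∫ x in K.1.body, g K x := by
  have hi : ∀ K : T.cells, IntegrableOn (g K) (interior K.1.body) := fun K =>
    ((hg K).continuousOn.integrableOn_compact K.1.isCompact_body).mono_set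
      _root_.interior_subset
  rw [setIntegral_congr_set (T.ae_eq hΩ), integral_iUnion_fintype
    (fun K => isOpen_interior.measurableSet) T.disjoint_interior
    (fun K => (hi K).congr_fun (h K).symm isOpen_interior.measurableSet)]
  refine Finset.sum_congr rfl fun K _ => ?_
  rw [setIntegral_congr_fun isOpen_interior.measurableSet (h K),
    setIntegral_congr_set K.1.interior_ae_eq]

/-! ### Piecewise polynomials as functions -/

/-- The function given by a scalar piecewise polynomial. -/
def scalFun (T : Triangulation Ω) (u : T.cells → Poly) (x : Plane) : ℝ :=
  ∑ K : T.cells, (interior K.1.body).indicator (pval (u K)) x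

lemma scalFun_eq (T : Triangulation Ω) (u : T.cells → Poly) (K : T.cells) {x : Plane}
    (hx : x ∈ interior K.1.body) : scalFun T u x = pval (u K) x := by
  unfold scalFun
  rw [Finset.sum_eq_single K, indicator_of_mem hx]
  · intro L _ hL
    exact indicator_of_notMem (fun hxL =>
      Set.disjoint_left.1 (T.disjoint_interior hL) hxL hx) _
  · simp

lemma matFun_apply (T : Triangulation Ω) (τ : MatField T) (x : Plane) (i j : Fin 2) :
    matFun T τ x i j = scalFun T (fun K => τ K i j) x := by
  simp only [matFun, scalFun, Matrix.sum_apply]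
  refine Finset.sum_congr rfl fun K _ => ?_
  by_cases h : x ∈ interior K.1.body <;> simp [h, mval]

lemma vecFun_apply (T : Triangulation Ω) (v : VecField T) (x : Plane) (i : Fin 2) :
    vecFun T v x i = scalFun T (fun K => v K i) x := by
  simp only [vecFun, scalFun, Finset.sum_apply]
  refine Finset.sum_congr rfl fun K _ => ?_
  by_cases h : x ∈ interior K.1.body <;> simp [h]

lemma scalFun_add (T : Triangulation Ω) (u v : T.cells → Poly) (x : Plane) :
    scalFun T (fun K => u K + v K) x = scalFun T u x + scalFun T v x := by
  simp only [scalFun, ← Finset.sum_add_distrib]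
  refine Finset.sum_congr rfl fun K _ => ?_
  by_cases h : x ∈ interior K.1.body <;> simp [h]

lemma scalFun_smul (T : Triangulation Ω) (c : ℝ) (u : T.cells → Poly) (x : Plane) :
    scalFun T (fun K => c • u K) x = c * scalFun T u x := by
  simp only [scalFun, Finset.mul_sum]
  refine Finset.sum_congr rfl fun K _ => ?_
  by_cases h : x ∈ interior K.1.body <;> simp [h]

lemma memL2_scalFun (Ω' : Set Plane) (T : Triangulation Ω) (u : T.cells → Poly) :
    MemL2 Ω' (scalFun T u) := by
  unfold MemL2 scalFun
  refine memLp_finsetSum _ fun K _ => ?_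
  rw [memLp_indicator_iff_restrict isOpen_interior.measurableSet]
  refine MemLp.mono_measure (Measure.restrict_mono_measure Measure.restrict_le_self _) ?_
  refine MemLp.mono_measure (Measure.restrict_mono _root_.interior_subset le_rfl) ?_
  obtain ⟨C, hC⟩ := K.1.isCompact_body.exists_bound_of_continuousOn
    (continuous_pval (u K)).continuousOn
  have : IsFiniteMeasure (volume.restrict K.1.body) :=
    ⟨by simpa using K.1.isCompact_body.measure_lt_top⟩
  exact MemLp.of_bound (continuous_pval _).aestronglyMeasurable C
    ((ae_restrict_iff' K.1.measurableSet_body).2 (Filter.Eventually.of_forall hC))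

/-! ### Weak divergence of piecewise polynomials -/

/-- Piecewise divergence. -/
def pdiv (T : Triangulation Ω) (τ : MatField T) : VecField T :=
  fun K i => ∑ j, MvPolynomial.pderiv j (τ K i j)

lemma IsTest.contDiff_one {φ : Plane → ℝ} (h : IsTest Ω φ) : ContDiff ℝ 1 φ :=
  h.1.of_le (by simp)

lemma pderiv_pval_mul (p : Poly) {φ : Plane → ℝ} (hφ : ContDiff ℝ 1 φ) (j : Fin 2) (x : Plane) :
    pderiv j (fun x => pval p x * φ x) x =
      pval (MvPolynomial.pderiv j p) x * φ x + pval p x * pderiv j φ x := by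
  rw [← pderiv_pval]
  simp only [pderiv_eq]
  rw [fderiv_fun_mul (by fun_prop) (hφ.differentiable (by simp) x)]
  simp
  ring

/-- The cellwise derivatives are weak derivatives as soon as the boundary contributions of the cells
cancel. The hypothesis states this cancellation before Green's formula turns it into edge integrals.
-/
lemma memH1_of_forall (hΩ : IsPolygonal Ω) (T : Triangulation Ω) (u : T.cells → Poly)
    (h : ∀ φ, IsTest Ω φ → ∀ i,
      ∑ K : T.cells, ∫ x in K.1.body, pderiv i (fun x => pval (u K) x * φ x) x = 0) :
    MemH1 Ω (scalFun T u) := by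
  refine ⟨memL2_scalFun Ω T u, fun j =>
    ⟨scalFun T fun K => MvPolynomial.pderiv j (u K), memL2_scalFun Ω T _, fun φ hφ => ?_⟩⟩
  have hc := hφ.contDiff_one
  have hc0 := hc.continuous
  have hc1 := continuous_pderiv hc j
  rw [T.integral_eq hΩ (g := fun K x => pval (u K) x * pderiv j φ x)
      (fun K => by fun_prop) (fun K x hx => by simp only [scalFun_eq T _ K hx]),
    T.integral_eq hΩ (g := fun K x => pval (MvPolynomial.pderiv j (u K)) x * φ x)
      (fun K => by fun_prop) (fun K x hx => by simp only [scalFun_eq T _ K hx]),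
    eq_neg_iff_add_eq_zero, ← Finset.sum_add_distrib, ← h φ hφ j]
  refine Finset.sum_congr rfl fun K _ => ?_
  rw [← integral_add
    (Continuous.continuousOn (by fun_prop) |>.integrableOn_compact K.1.isCompact_body)
    (Continuous.continuousOn (by fun_prop) |>.integrableOn_compact K.1.isCompact_body)]
  congr 1
  ext x
  rw [pderiv_pval_mul _ hc]
  ring

/-- The analogue for the divergence: the contributions are summed over `j`, so only normal
components have to cancel. -/
lemma isWeakDiv_of_forall (hΩ : IsPolygonal Ω) (T : Triangulation Ω) (τ : MatField T)
    (h : ∀ φ, IsTest Ω φ → ∀ i, ∑ K : T.cells, ∑ j,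
      ∫ x in K.1.body, pderiv j (fun x => pval (τ K i j) x * φ x) x = 0) :
    IsWeakDiv Ω (matFun T τ) (vecFun T (pdiv T τ)) := by
  intro φ hφ i
  have hc := hφ.contDiff_one
  have hc0 := hc.continuous
  have hc1 := fun j => continuous_pderiv hc j
  rw [T.integral_eq hΩ (g := fun K x => ∑ j, pval (τ K i j) x * pderiv j φ x)
      (fun K => by fun_prop)
      (fun K x hx => by simp only [matFun_apply, scalFun_eq T _ K hx]),
    T.integral_eq hΩ (g := fun K x => pval (pdiv T τ K i) x * φ x)
      (fun K => by fun_prop) (fun K x hx => by simp only [vecFun_apply, scalFun_eq T _ K hx]),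
    eq_neg_iff_add_eq_zero, ← Finset.sum_add_distrib, ← h φ hφ i]
  refine Finset.sum_congr rfl fun K _ => ?_
  have hI : ∀ g : Plane → ℝ, Continuous g → IntegrableOn g K.1.body := fun g hg =>
    hg.continuousOn.integrableOn_compact K.1.isCompact_body
  rw [← integral_add (hI _ (by fun_prop)) (hI _ (by fun_prop)),
    ← integral_finsetSum _ (fun j _ => ?_)]
  · congr 1
    ext x
    simp only [pderiv_pval_mul _ hc, pdiv, pval_sum, Finset.sum_mul, ← Finset.sum_add_distrib]
    exact Finset.sum_congr rfl fun j _ => by ring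
  · refine hI _ (continuous_pderiv (ContDiff.mul ?_ hc) j)
    exact (contDiff_pval _).of_le (by simp)

lemma IsTest.mono {Ω' : Set Plane} (h : Ω ⊆ Ω') {φ : Plane → ℝ} (hφ : IsTest Ω φ) :
    IsTest Ω' φ := ⟨hφ.1, hφ.2.1, hφ.2.2.trans h⟩

lemma integral_pval_mul_pderiv {φ : Plane → ℝ} (hφ : IsTest Ω φ) (p : Poly) (j : Fin 2) :
    ∫ x, pval p x * pderiv j φ x = - ∫ x, pval (MvPolynomial.pderiv j p) x * φ x := by
  have hc := hφ.contDiff_one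
  have hc0 := hc.continuous
  have hc1 := continuous_pderiv hc j
  have hs : HasCompactSupport (pderiv j φ) := hφ.2.1.fderiv_apply (𝕜 := ℝ) _
  simp only [← pderiv_pval]
  have hcp : Continuous (pderiv j (pval p)) := continuous_pderiv ((contDiff_pval p).of_le (by simp)) j
  refine integral_mul_fderiv_eq_neg_fderiv_mul_of_integrable ?_ ?_ ?_ ?_ ?_
  · exact Continuous.integrable_of_hasCompactSupport (hcp.mul hc0) hφ.2.1.mul_left
  · exact Continuous.integrable_of_hasCompactSupport (by fun_prop) hs.mul_left
  · exact Continuous.integrable_of_hasCompactSupport (by fun_prop) hφ.2.1.mul_left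
  · exact fun x _ => differentiable_pval p x
  · exact fun x _ => hc.differentiable (by simp) x

lemma IsPolygonal.isFiniteMeasure (hΩ : IsPolygonal Ω) :
    IsFiniteMeasure (volume.restrict Ω) :=
  ⟨by simpa using hΩ.bounded.measure_lt_top⟩

/-- Test functions supported in one open cell see a single polynomial, which can be integrated by
parts classically. The fundamental lemma of the calculus of variations then identifies `g` on that
cell, and the open cells fill `Ω` up to a null set. -/
lemma ae_eq_pdiv (hΩ : IsPolygonal Ω) (T : Triangulation Ω) (τ : MatField T)
    {g : Plane → Fin 2 → ℝ} (hg : MemL2Vec Ω g) (h : IsWeakDiv Ω (matFun T τ) g) :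
    g =ᵐ[volume.restrict Ω] vecFun T (pdiv T τ) := by
  have := hΩ.isFiniteMeasure
  have hgi : ∀ i, IntegrableOn (fun x => g x i) Ω := fun i =>
    (hg i).integrable (by norm_num)
  refine T.ae_restrict hΩ fun K => ?_
  have key : ∀ i, ∀ᵐ x, x ∈ interior K.1.body → g x i - pval (pdiv T τ K i) x = 0 := by
    intro i
    have hpi : IntegrableOn (pval (pdiv T τ K i)) (interior K.1.body) :=
      ((continuous_pval _).continuousOn.integrableOn_compact K.1.isCompact_body).mono_set
        _root_.interior_subset
    have hgi' := (hgi i).mono_set (T.interior_subset hΩ K)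
    refine isOpen_interior.ae_eq_zero_of_integral_contDiff_smul_eq_zero
      (hgi'.sub hpi).locallyIntegrableOn fun φ h1 h2 h3 => ?_
    have hφ : IsTest (interior K.1.body) φ := ⟨h1, h2, h3⟩
    have hφΩ := hφ.mono (T.interior_subset hΩ K)
    have hφ0 : ∀ x, x ∉ interior K.1.body → φ x = 0 := fun x hx =>
      image_eq_zero_of_notMem_tsupport fun hx' => hx (h3 hx')
    have hdφ0 : ∀ j, ∀ x, x ∉ interior K.1.body → pderiv j φ x = 0 := fun j x hx => by
      rw [pderiv_eq, image_eq_zero_of_notMem_tsupport (f := fderiv ℝ φ)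
        (fun hx' => hx (h3 (tsupport_fderiv_subset ℝ hx')))]
      rfl
    have e := h φ hφΩ i
    -- Both integrals are cut down from `Ω` to the cell; the left one is then extended to the plane,
    -- where integration by parts has no boundary term.
    rw [setIntegral_eq_of_subset_of_forall_sdiff_eq_zero hΩ.isOpen.measurableSet
        (T.interior_subset hΩ K) (fun x hx => by simp [hdφ0 _ _ hx.2]),
      setIntegral_eq_of_subset_of_forall_sdiff_eq_zero hΩ.isOpen.measurableSet
        (T.interior_subset hΩ K) (fun x hx => by simp [hφ0 _ hx.2]),
      setIntegral_congr_fun (g := fun x => ∑ j, pval (τ K i j) x * pderiv j φ x)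
        isOpen_interior.measurableSet
        (fun x hx => by simp only [matFun_apply, scalFun_eq T _ K hx]),
      setIntegral_eq_integral_of_forall_compl_eq_zero (fun x hx => by simp [hdφ0 _ _ hx]),
      integral_finsetSum _ (fun j _ => ?_)] at e
    · simp only [integral_pval_mul_pderiv hφ, Finset.sum_neg_distrib, neg_inj] at e
      rw [← integral_finsetSum _ (fun j _ => ?_)] at e
      · rw [← setIntegral_eq_integral_of_forall_compl_eq_zero
          (s := interior K.1.body) (fun x hx => by simp [hφ0 _ hx])]
        rw [← setIntegral_eq_integral_of_forall_compl_eq_zero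
          (s := interior K.1.body) (fun x hx => by simp [hφ0 _ hx])] at e
        obtain ⟨C, hC⟩ := hφ.1.continuous.bounded_above_of_compact_support hφ.2.1
        simp only [smul_eq_mul, mul_sub]
        rw [integral_sub, sub_eq_zero]
        · simp only [mul_comm (φ _)]
          rw [← e]
          simp only [pdiv, pval_sum, Finset.sum_mul]
        · exact hgi'.bdd_mul hφ.1.continuous.aestronglyMeasurable (Filter.Eventually.of_forall hC)
        · exact hpi.bdd_mul hφ.1.continuous.aestronglyMeasurable (Filter.Eventually.of_forall hC)
      · exact Continuous.integrable_of_hasCompactSupport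
          ((continuous_pval _).mul hφ.1.continuous) hφ.2.1.mul_left
    · exact Continuous.integrable_of_hasCompactSupport
        ((continuous_pval _).mul (continuous_pderiv hφ.contDiff_one j))
        (HasCompactSupport.mul_left (hφ.2.1.fderiv_apply (𝕜 := ℝ) _))
  filter_upwards [ae_all_iff.2 key] with x hx hxK
  ext i
  rw [vecFun_apply, scalFun_eq T _ K hxK]
  exact sub_eq_zero.1 (hx i hxK)

lemma weakDiv_ae_eq (hΩ : IsPolygonal Ω) (T : Triangulation Ω) {τ : MatField T}
    (h : MemHDiv Ω (matFun T τ)) :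
    weakDiv Ω (matFun T τ) =ᵐ[volume.restrict Ω] vecFun T (pdiv T τ) := by
  rw [weakDiv, dif_pos h.2.2]
  exact ae_eq_pdiv hΩ T τ h.2.2.choose_spec.1 h.2.2.choose_spec.2

lemma poly_eq_of_ae {K : Triangle} {p q : Poly}
    (h : ∀ᵐ x, x ∈ interior K.body → pval p x = pval q x) : p = q := by
  rw [← sub_eq_zero]
  refine eq_zero_of_pval_eq_zero isOpen_interior K.interior_nonempty fun x hx => ?_
  have := Measure.eqOn_open_of_ae_eq
    ((ae_restrict_iff' isOpen_interior.measurableSet).2 h) isOpen_interior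
    (continuous_pval p).continuousOn (continuous_pval q).continuousOn hx
  simp [this]

/-- Membership in `DispSpace` is an equation almost everywhere; this makes it an equation between
families of polynomials. -/
lemma vecFun_injective (hΩ : IsPolygonal Ω) (T : Triangulation Ω) {v w : VecField T}
    (h : vecFun T v =ᵐ[volume.restrict Ω] vecFun T w) : v = w := by
  ext1 K; ext1 i
  refine poly_eq_of_ae (K := K.1) ?_
  rw [Filter.EventuallyEq, ae_restrict_iff' hΩ.isOpen.measurableSet] at h
  filter_upwards [h] with x hx hxK
  have := congrFun (hx (T.interior_subset hΩ K hxK)) i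
  rwa [vecFun_apply, vecFun_apply, scalFun_eq T _ K hxK, scalFun_eq T _ K hxK] at this

/-! ### Rigid motions -/

lemma pderiv_comm (i j : Fin 2) (p : Poly) :
    MvPolynomial.pderiv i (MvPolynomial.pderiv j p) =
      MvPolynomial.pderiv j (MvPolynomial.pderiv i p) := by
  ext m
  simp only [MvPolynomial.coeff_pderiv]
  rcases eq_or_ne i j with rfl | h
  · rfl
  · rw [add_right_comm]
    simp [h, h.symm]
    ring

lemma eq_C_of_pderiv_eq_zero {p : Poly} (h : ∀ i, MvPolynomial.pderiv i p = 0) :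
    ∃ c, p = MvPolynomial.C c := by
  refine ⟨MvPolynomial.coeff 0 p, ?_⟩
  ext m
  rw [MvPolynomial.coeff_C]
  split_ifs with hm
  · rw [hm]
  · obtain ⟨i, hi⟩ : ∃ i, m i ≠ 0 := by
      by_contra! hc
      exact hm (Finsupp.ext fun i => (hc i).symm)
    have hm' : m - Finsupp.single i 1 + Finsupp.single i 1 = m :=
      tsub_add_cancel_of_le (by simpa using Nat.one_le_iff_ne_zero.2 hi)
    have := MvPolynomial.coeff_pderiv (i := i) p (m - Finsupp.single i 1)
    rw [h i, hm', MvPolynomial.coeff_zero] at this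
    have h2 : ((m - Finsupp.single i 1 : Fin 2 →₀ ℕ) i : ℝ) + 1 ≠ 0 := by positivity
    exact (mul_eq_zero.1 this.symm).resolve_right h2

/-- Rigid motions: polynomial vector fields with vanishing symmetric gradient. -/
def IsRigid (w : Fin 2 → Poly) : Prop :=
  ∀ i j, MvPolynomial.pderiv i (w j) + MvPolynomial.pderiv j (w i) = 0

/-- The rotation rate `∂₁w₀ = -∂₀w₁` is constant: its first derivatives vanish because mixed
derivatives commute and `∂₀w₀ = ∂₁w₁ = 0`. -/
lemma IsRigid.exists_eq {w : Fin 2 → Poly} (h : IsRigid w) :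
    ∃ a b e : ℝ, w 0 = MvPolynomial.C a + MvPolynomial.C e * MvPolynomial.X 1 ∧
      w 1 = MvPolynomial.C b - MvPolynomial.C e * MvPolynomial.X 0 := by
  have h0 : MvPolynomial.pderiv 0 (w 0) = 0 := by simpa using h 0 0
  have h1 : MvPolynomial.pderiv 1 (w 1) = 0 := by simpa using h 1 1
  have h01 : MvPolynomial.pderiv 0 (w 1) = -MvPolynomial.pderiv 1 (w 0) :=
    eq_neg_of_add_eq_zero_left (h 0 1)
  obtain ⟨e, he⟩ : ∃ e, MvPolynomial.pderiv 1 (w 0) = MvPolynomial.C e := by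
    refine eq_C_of_pderiv_eq_zero fun i => ?_
    fin_cases i
    · change MvPolynomial.pderiv 0 _ = _
      rw [pderiv_comm, h0, map_zero]
    · change MvPolynomial.pderiv 1 _ = _
      rw [← neg_eq_zero, ← map_neg, ← h01, pderiv_comm, h1, map_zero]
  obtain ⟨a, ha⟩ : ∃ a, w 0 - MvPolynomial.C e * MvPolynomial.X 1 = MvPolynomial.C a := by
    refine eq_C_of_pderiv_eq_zero fun i => ?_
    fin_cases i
    · change MvPolynomial.pderiv 0 _ = _
      simp [h0, MvPolynomial.pderiv_X]
    · change MvPolynomial.pderiv 1 _ = _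
      simp [he]
  obtain ⟨b, hb⟩ : ∃ b, w 1 + MvPolynomial.C e * MvPolynomial.X 0 = MvPolynomial.C b := by
    refine eq_C_of_pderiv_eq_zero fun i => ?_
    fin_cases i
    · change MvPolynomial.pderiv 0 _ = _
      simp [h01, he]
    · change MvPolynomial.pderiv 1 _ = _
      simp [h1, MvPolynomial.pderiv_X]
  exact ⟨a, b, e, sub_eq_iff_eq_add.1 ha, eq_sub_of_add_eq hb⟩

lemma IsRigid.totalDegree_le {w : Fin 2 → Poly} (h : IsRigid w) (i : Fin 2) :
    (w i).totalDegree ≤ 1 := by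
  obtain ⟨a, b, e, h0, h1⟩ := h.exists_eq
  fin_cases i
  · simp only [Fin.zero_eta, h0]
    refine (MvPolynomial.totalDegree_add _ _).trans (max_le (by simp) ?_)
    exact (MvPolynomial.totalDegree_mul _ _).trans
      (by rw [MvPolynomial.totalDegree_C, MvPolynomial.totalDegree_X])
  · simp only [Fin.mk_one, h1]
    refine (MvPolynomial.totalDegree_sub _ _).trans (max_le (by simp) ?_)
    exact (MvPolynomial.totalDegree_mul _ _).trans
      (by rw [MvPolynomial.totalDegree_C, MvPolynomial.totalDegree_X])

lemma IsRigid.sub {v w : Fin 2 → Poly} (hv : IsRigid v) (hw : IsRigid w) : IsRigid (v - w) := by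
  intro i j
  have h1 := hv i j
  have h2 := hw i j
  simp only [Pi.sub_apply, map_sub]
  linear_combination h1 - h2

/-- A rigid motion that vanishes at two points is zero. -/
lemma IsRigid.eq_zero {w : Fin 2 → Poly} (h : IsRigid w) {x y : Plane} (hxy : x ≠ y)
    (hx : ∀ i, pval (w i) x = 0) (hy : ∀ i, pval (w i) y = 0) : w = 0 := by
  obtain ⟨a, b, e, h0, h1⟩ := h.exists_eq
  have x0 := hx 0
  have x1 := hx 1
  have y0 := hy 0
  have y1 := hy 1
  simp only [h0, h1, pval_add, pval_sub, pval_mul, pval_C, pval_X] at x0 x1 y0 y1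
  -- With a nonzero rotation rate the zero is unique: subtracting the equations at `x` and `y` gives
  -- `e (x - y) = 0`.
  have he : e = 0 := by
    by_contra he
    refine hxy ?_
    ext i
    fin_cases i
    · exact mul_left_cancel₀ he (show e * x 0 = e * y 0 by linarith)
    · exact mul_left_cancel₀ he (show e * x 1 = e * y 1 by linarith)
  subst he
  ext1 i
  fin_cases i
  · simp only [Fin.zero_eta, h0, Pi.zero_apply]
    simp_all
  · simp only [Fin.mk_one, h1, Pi.zero_apply]
    simp_all

/-! ### Integration by parts for matrix fields on one triangle -/

lemma Triangle.integrableOn (K : Triangle) {g : Plane → ℝ} (hg : Continuous g) :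
    IntegrableOn g K.body := hg.continuousOn.integrableOn_compact K.isCompact_body

lemma Triangle.edgeInt_congr (K : Triangle) (j : Fin 3) {F G : Plane → ℝ}
    (h : ∀ x ∈ openSegment ℝ (K.points (j + 1)) (K.points (j + 2)), F x = G x) :
    K.edgeInt j F = K.edgeInt j G := by
  unfold Triangle.edgeInt
  rw [intervalIntegral.integral_of_le zero_le_one, intervalIntegral.integral_of_le zero_le_one,
    integral_Ioc_eq_integral_Ioo, integral_Ioc_eq_integral_Ioo]
  refine setIntegral_congr_fun measurableSet_Ioo fun t ht => h _ ?_
  rw [openSegment_eq_image_lineMap]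
  exact mem_image_of_mem _ ht

lemma Triangle.edgeInt_zero (K : Triangle) (j : Fin 3) {F : Plane → ℝ}
    (h : ∀ x ∈ openSegment ℝ (K.points (j + 1)) (K.points (j + 2)), F x = 0) :
    K.edgeInt j F = 0 := by
  rw [K.edgeInt_congr j h]
  simp [Triangle.edgeInt]

lemma Triangle.green_vec (K : Triangle) {F : Fin 2 → Plane → ℝ} (hF : ∀ l, ContDiff ℝ 1 (F l)) :
    ∑ l, ∫ x in K.body, pderiv l (F l) x =
      - ∑ j, SignType.sign K.det * K.edgeInt j fun x => ∑ l, K.nrm j l * F l x := by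
  have hI : ∀ (j : Fin 3) (l : Fin 2), IntervalIntegrable
      (fun t : ℝ => K.nrm j l * F l (AffineMap.lineMap (K.points (j + 1)) (K.points (j + 2)) t))
      volume 0 1 := fun j l => by
    have := (hF l).continuous
    exact Continuous.intervalIntegrable (by fun_prop) _ _
  simp only [K.green (hF _), Finset.sum_neg_distrib]
  rw [Finset.sum_comm]
  congr 1
  refine Finset.sum_congr rfl fun j _ => ?_
  simp only [Triangle.edgeInt, Triangle.sgnrm]
  rw [intervalIntegral.integral_finsetSum (fun l _ => hI j l), Finset.mul_sum]
  simp only [intervalIntegral.integral_const_mul, mul_assoc]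

/-- The normal component of the matrix polynomial `τ` vanishes on `∂K`. -/
def NormalZero (K : Triangle) (τ : Matrix (Fin 2) (Fin 2) Poly) : Prop :=
  ∀ (j : Fin 3) (i : Fin 2), ∀ x ∈ segment ℝ (K.points (j + 1)) (K.points (j + 2)),
    ∑ l, K.nrm j l * pval (τ i l) x = 0

lemma contDiff_one_pval (p : Poly) : ContDiff ℝ 1 (pval p) := (contDiff_pval p).of_le (by simp)

lemma NormalZero.green {K : Triangle} {τ : Matrix (Fin 2) (Fin 2) Poly} (h : NormalZero K τ)
    {φ : Plane → ℝ} (hφ : ContDiff ℝ 1 φ) (i : Fin 2) :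
    ∑ l, ∫ x in K.body, pderiv l (fun x => pval (τ i l) x * φ x) x = 0 := by
  rw [K.green_vec (F := fun l x => pval (τ i l) x * φ x)
    (fun l => (contDiff_one_pval _).mul hφ), neg_eq_zero]
  refine Finset.sum_eq_zero fun j _ => ?_
  rw [K.edgeInt_zero j, mul_zero]
  intro x hx
  have := h j i x (openSegment_subset_segment ℝ _ _ hx)
  simp only [← mul_assoc, ← Finset.sum_mul, this, zero_mul]

/-- Integration by parts against a vector polynomial. -/
lemma Triangle.green_div (K : Triangle) (τ : Matrix (Fin 2) (Fin 2) Poly) (w : Fin 2 → Poly) :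
    ∫ x in K.body, ∑ i, pval (∑ l, MvPolynomial.pderiv l (τ i l)) x * pval (w i) x =
      - (∑ j, SignType.sign K.det *
          K.edgeInt j fun x => ∑ i, (∑ l, K.nrm j l * pval (τ i l) x) * pval (w i) x)
      - ∫ x in K.body, pval (∑ i, ∑ l, τ i l * MvPolynomial.pderiv l (w i)) x := by
  have h := K.green_vec (F := fun l => pval (∑ i, τ i l * w i)) (fun l => contDiff_one_pval _)
  have h2 : ∀ j, (K.edgeInt j fun x => ∑ l, K.nrm j l * pval (∑ i, τ i l * w i) x) =
      K.edgeInt j fun x => ∑ i, (∑ l, K.nrm j l * pval (τ i l) x) * pval (w i) x := by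
    intro j
    congr 1
    ext x
    simp [Fin.sum_univ_two]
    ring
  simp only [h2] at h
  rw [← h, ← integral_finsetSum _ (fun l _ => ?_), ← integral_sub]
  · congr 1
    ext x
    simp only [pderiv_pval]
    simp [Fin.sum_univ_two, Derivation.leibniz]
    ring
  · exact K.integrableOn (continuous_finsetSum _ fun l _ =>
      continuous_pderiv (contDiff_one_pval _) l)
  · exact K.integrableOn (by fun_prop)
  · exact K.integrableOn (continuous_pderiv (contDiff_one_pval _) l)

/-- A symmetric matrix contracted with a gradient sees only the symmetric part of the gradient. -/
lemma IsRigid.sum_mul_pderiv {w : Fin 2 → Poly} (hw : IsRigid w)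
    {τ : Matrix (Fin 2) (Fin 2) Poly} (hτ : τ.IsSymm) :
    ∑ i, ∑ l, τ i l * MvPolynomial.pderiv l (w i) = 0 := by
  have h0 : MvPolynomial.pderiv 0 (w 0) = 0 := by simpa using hw 0 0
  have h1 : MvPolynomial.pderiv 1 (w 1) = 0 := by simpa using hw 1 1
  have h01 := hw 0 1
  have hs : τ 1 0 = τ 0 1 := hτ.apply 0 1
  simp only [Fin.sum_univ_two, h0, h1, hs]
  linear_combination τ 0 1 * h01

lemma NormalZero.green_div {K : Triangle} {τ : Matrix (Fin 2) (Fin 2) Poly} (h : NormalZero K τ)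
    (w : Fin 2 → Poly) :
    ∫ x in K.body, ∑ i, pval (∑ l, MvPolynomial.pderiv l (τ i l)) x * pval (w i) x =
      - ∫ x in K.body, pval (∑ i, ∑ l, τ i l * MvPolynomial.pderiv l (w i)) x := by
  rw [K.green_div, Finset.sum_eq_zero, neg_zero, zero_sub]
  intro j _
  rw [K.edgeInt_zero j, mul_zero]
  intro x hx
  simp [h j _ x (openSegment_subset_segment ℝ _ _ hx)]

/-! ### Bubbles with vanishing normal component -/

lemma Triangle.sum_nrm_mul (K : Triangle) (j : Fin 3) :
    ∑ l, K.nrm j l * (K.points (j + 2) l - K.points (j + 1) l) = 0 := by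
  simp [Triangle.nrm, Fin.sum_univ_two]
  ring

lemma NormalZero.of_mem_bubbleS {k : ℕ} {K : Triangle} {τ : Matrix (Fin 2) (Fin 2) Poly}
    (h : τ ∈ BubbleS k K) : NormalZero K τ := by
  intro j i x hx
  have := congrFun (h.2 (j + 1) (j + 2) (by simp) x hx (WithLp.toLp 2 (K.nrm j)) (by
    have := K.sum_nrm_mul j
    simp only [Fin.sum_univ_two] at this
    simp [PiLp.inner_apply, Fin.sum_univ_two]
    linarith)) i
  simp only [mval, Matrix.mulVec, dotProduct, Matrix.of_apply, Pi.zero_apply] at this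
  simpa only [mul_comm] using this

lemma NormalZero.bubble_smul (K : Triangle) (q : Matrix (Fin 2) (Fin 2) Poly) :
    NormalZero K (K.bubble • q) := by
  intro j i x hx
  have h0 : pval (K.bary j) x = 0 :=
    K.bary_eq_zero_of_mem_segment (by simp) (by simp) hx
  have : pval K.bubble x = 0 := by
    simp only [Triangle.bubble, pval_mul]
    fin_cases j <;> simp_all
  simp [this]

lemma Triangle.integral_pval_eq_zero (K : Triangle) {p : Poly}
    (hp : ∀ x ∈ K.body, 0 ≤ pval p x) (h : ∫ x in K.body, pval p x = 0) : p = 0 := by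
  rw [setIntegral_eq_zero_iff_of_nonneg_ae
    ((ae_restrict_iff' K.measurableSet_body).2 (Filter.Eventually.of_forall hp))
    (K.integrableOn (continuous_pval p)), Filter.EventuallyEq,
    ae_restrict_iff' K.measurableSet_body] at h
  refine poly_eq_of_ae (K := K) ?_
  filter_upwards [h] with x hx hxK
  simpa using hx (_root_.interior_subset hxK)

/-- The bubble `λ_p λ_q g t tᵀ` that belongs to the edge `[p, q]` opposite to the vertex `j`, where
`t` is the tangent vector. -/
def Triangle.edgeBubble (K : Triangle) (j : Fin 3) (g : Poly) : Matrix (Fin 2) (Fin 2) Poly :=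
  Matrix.of fun a b => K.bary (j + 1) * K.bary (j + 2) * g *
    (MvPolynomial.C (K.points (j + 2) a - K.points (j + 1) a) *
      MvPolynomial.C (K.points (j + 2) b - K.points (j + 1) b))

lemma Triangle.edgeBubble_isSymm (K : Triangle) (j : Fin 3) (g : Poly) :
    (K.edgeBubble j g).IsSymm := by
  refine Matrix.IsSymm.ext fun a b => ?_
  simp only [Triangle.edgeBubble, Matrix.of_apply]
  ring

lemma Triangle.totalDegree_bary_mul (K : Triangle) (i j : Fin 3) {k : ℕ} (hk : 2 ≤ k) {g : Poly}
    (hg : g.totalDegree ≤ k - 2) : (K.bary i * K.bary j * g).totalDegree ≤ k := by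
  have h1 := MvPolynomial.totalDegree_mul (K.bary i * K.bary j) g
  have h2 := MvPolynomial.totalDegree_mul (K.bary i) (K.bary j)
  have h3 := K.totalDegree_bary i
  have h4 := K.totalDegree_bary j
  omega

lemma Triangle.edgeBubble_mem_bubbleS (K : Triangle) (j : Fin 3) {k : ℕ} (hk : 2 ≤ k) {g : Poly}
    (hg : g.totalDegree ≤ k - 2) : K.edgeBubble j g ∈ BubbleS k K := by
  refine ⟨⟨K.edgeBubble_isSymm j g, fun a b => ?_⟩, fun i i' hii x hx ν hν => ?_⟩
  · simp only [Triangle.edgeBubble, Matrix.of_apply, ← map_mul]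
    refine (MvPolynomial.totalDegree_mul _ _).trans ?_
    rw [MvPolynomial.totalDegree_C, add_zero]
    exact K.totalDegree_bary_mul _ _ hk hg
  -- On the two other edges a barycentric factor vanishes; on the edge itself `t tᵀ ν = 0` because
  -- `ν` is orthogonal to `t`.
  · have key : pval (K.bary (j + 1)) x * pval (K.bary (j + 2)) x *
        ∑ l, ν l * (K.points (j + 2) l - K.points (j + 1) l) = 0 := by
      simp only [PiLp.inner_apply, Fin.sum_univ_two, PiLp.sub_apply, RCLike.inner_apply,
        conj_trivial] at hν
      by_cases h1 : i ≠ j + 1 ∧ i' ≠ j + 1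
      · rw [K.bary_eq_zero_of_mem_segment h1.1 h1.2 hx]; simp
      by_cases h2 : i ≠ j + 2 ∧ i' ≠ j + 2
      · rw [K.bary_eq_zero_of_mem_segment h2.1 h2.2 hx]; simp
      have h3 : (i = j + 1 ∧ i' = j + 2) ∨ (i = j + 2 ∧ i' = j + 1) := by
        clear hν hx hg
        revert i i' j
        decide
      rw [Fin.sum_univ_two]
      rcases h3 with ⟨rfl, rfl⟩ | ⟨rfl, rfl⟩
      · linear_combination pval (K.bary (j + 1)) x * pval (K.bary (j + 2)) x * hν
      · linear_combination -pval (K.bary (j + 1)) x * pval (K.bary (j + 2)) x * hν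
    ext a
    simp only [mval, Triangle.edgeBubble, Matrix.mulVec, dotProduct, Matrix.of_apply,
      Pi.zero_apply, pval_mul, pval_C, Fin.sum_univ_two] at key ⊢
    linear_combination pval g x * (K.points (j + 2) a - K.points (j + 1) a) * key

/-- The strain `t · ε(w) t` of `w` along the edge with tangent vector `t` opposite to `j`. -/
def Triangle.edgeStrain (K : Triangle) (j : Fin 3) (w : Fin 2 → Poly) : Poly :=
  ∑ a, ∑ b, MvPolynomial.C (K.points (j + 2) a - K.points (j + 1) a) *
    MvPolynomial.C (K.points (j + 2) b - K.points (j + 1) b) * MvPolynomial.pderiv b (w a)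

lemma Triangle.totalDegree_edgeStrain (K : Triangle) (j : Fin 3) {w : Fin 2 → Poly} {n : ℕ}
    (hw : ∀ i, (w i).totalDegree ≤ n) : (K.edgeStrain j w).totalDegree ≤ n - 1 := by
  refine MvPolynomial.totalDegree_finsetSum_le fun a _ =>
    MvPolynomial.totalDegree_finsetSum_le fun b _ => ?_
  rw [← map_mul]
  refine (MvPolynomial.totalDegree_mul _ _).trans ?_
  rw [MvPolynomial.totalDegree_C, zero_add]
  exact totalDegree_pderiv_le _ _ (hw a)

/-- With the strain itself as the factor `g`, integration by parts gives minus the integral of `λ_p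
λ_q (t · ε(w) t)²`, whose integrand is nonnegative on the triangle. -/
lemma Triangle.edgeStrain_eq_zero (K : Triangle) (j : Fin 3) {w : Fin 2 → Poly}
    (h : ∫ x in K.body, ∑ i, pval (∑ l, MvPolynomial.pderiv l
      (K.edgeBubble j (K.edgeStrain j w) i l)) x * pval (w i) x = 0) :
    K.edgeStrain j w = 0 := by
  have hN : NormalZero K (K.edgeBubble j (K.edgeStrain j w)) :=
    NormalZero.of_mem_bubbleS (k := (K.edgeStrain j w).totalDegree + 2)
      (K.edgeBubble_mem_bubbleS j (by omega) (by omega))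
  rw [hN.green_div, neg_eq_zero] at h
  have e : ∑ i, ∑ l, K.edgeBubble j (K.edgeStrain j w) i l * MvPolynomial.pderiv l (w i) =
      K.bary (j + 1) * K.bary (j + 2) * K.edgeStrain j w ^ 2 := by
    rw [pow_two, ← mul_assoc]
    nth_rw 3 [Triangle.edgeStrain]
    simp only [Triangle.edgeBubble, Matrix.of_apply, Finset.mul_sum, mul_assoc]
  rw [e] at h
  have := K.integral_pval_eq_zero (fun x hx => ?_) h
  · simpa [K.bary_ne_zero] using this
  · rw [K.body_eq] at hx
    rw [pval_mul, pval_mul, pval_pow]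
    exact mul_nonneg (mul_nonneg (hx _) (hx _)) (sq_nonneg _)

/-- The matrices `t tᵀ` of the three edge tangents span the symmetric matrices, so three vanishing
edge strains leave no symmetric gradient. -/
lemma Triangle.isRigid_of_edgeStrain (K : Triangle) {w : Fin 2 → Poly}
    (h : ∀ j, K.edgeStrain j w = 0) : IsRigid w := by
  have hd : (MvPolynomial.C K.det : Poly) ≠ 0 := by simpa using K.det_ne_zero
  have h0 := h 0
  have h1 := h 1
  have h2 := h 2
  simp only [Triangle.edgeStrain, Fin.sum_univ_two, Fin.isValue, zero_add, map_sub,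
    show (1 : Fin 3) + 1 = 2 from rfl, show (1 : Fin 3) + 2 = 0 from rfl,
    show (2 : Fin 3) + 1 = 0 from rfl, show (2 : Fin 3) + 2 = 1 from rfl] at h0 h1 h2
  have hD : (MvPolynomial.C K.det : Poly) =
    (MvPolynomial.C (K.points 1 0) - MvPolynomial.C (K.points 0 0)) *
      (MvPolynomial.C (K.points 2 1) - MvPolynomial.C (K.points 0 1))
    - (MvPolynomial.C (K.points 1 1) - MvPolynomial.C (K.points 0 1)) *
      (MvPolynomial.C (K.points 2 0) - MvPolynomial.C (K.points 0 0)) := by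
    simp [Triangle.det]
  generalize MvPolynomial.C K.det = D at *
  generalize (MvPolynomial.C (K.points 0 0) : Poly) = a0 at *
  generalize (MvPolynomial.C (K.points 0 1) : Poly) = a1 at *
  generalize (MvPolynomial.C (K.points 1 0) : Poly) = b0 at *
  generalize (MvPolynomial.C (K.points 1 1) : Poly) = b1 at *
  generalize (MvPolynomial.C (K.points 2 0) : Poly) = c0 at *
  generalize (MvPolynomial.C (K.points 2 1) : Poly) = c1 at *
  -- Put `s = b - a` and `r = c - a`. Then `h2`, `h1`, `h0` concern `ε(s,s)`, `ε(r,r)`,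
  -- `ε(r-s,r-s)`, so `h1 + h2 - h0` concerns `2ε(s,r)`. The coefficients come from `D e₀ = r₁ s -
  -- s₁ r` and `D e₁ = s₀ r - r₀ s`.
  have e00 : D ^ 2 * MvPolynomial.pderiv 0 (w 0) = 0 := by
    rw [hD]
    linear_combination (c1 - a1) ^ 2 * h2 + (b1 - a1) ^ 2 * h1
      - (b1 - a1) * (c1 - a1) * (h1 + h2 - h0)
  have e11 : D ^ 2 * MvPolynomial.pderiv 1 (w 1) = 0 := by
    rw [hD]
    linear_combination (c0 - a0) ^ 2 * h2 + (b0 - a0) ^ 2 * h1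
      - (b0 - a0) * (c0 - a0) * (h1 + h2 - h0)
  have e01 : D ^ 2 * (MvPolynomial.pderiv 0 (w 1) + MvPolynomial.pderiv 1 (w 0)) = 0 := by
    rw [hD]
    linear_combination -2 * (c1 - a1) * (c0 - a0) * h2 - 2 * (b1 - a1) * (b0 - a0) * h1
      + ((b1 - a1) * (c0 - a0) + (b0 - a0) * (c1 - a1)) * (h1 + h2 - h0)
  have hD2 : D ^ 2 ≠ 0 := pow_ne_zero _ hd
  have e00' := (mul_eq_zero.1 e00).resolve_left hD2
  have e11' := (mul_eq_zero.1 e11).resolve_left hD2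
  have e01' := (mul_eq_zero.1 e01).resolve_left hD2
  intro i j
  fin_cases i <;> fin_cases j
  · simp [e00']
  · exact e01'
  · simpa [add_comm] using e01'
  · simp [e11']

/-- The boundary term of each cell vanishes by itself, so no matching between cells is required. -/
lemma memHDiv_of_normalZero (hΩ : IsPolygonal Ω) (T : Triangulation Ω) {τ : MatField T}
    (hs : ∀ K, (τ K).IsSymm) (h : ∀ K, NormalZero K.1 (τ K)) : MemHDiv Ω (matFun T τ) := by
  refine ⟨Filter.Eventually.of_forall fun x => Matrix.IsSymm.ext fun i j => ?_, fun i j => ?_,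
    vecFun T (pdiv T τ), fun i => ?_, isWeakDiv_of_forall hΩ T τ fun φ hφ i => ?_⟩
  · simp only [matFun_apply, (hs _).apply]
  · simp only [matFun_apply]
    exact memL2_scalFun _ _ _
  · simp only [vecFun_apply]
    exact memL2_scalFun _ _ _
  · exact Finset.sum_eq_zero fun K _ => (h K).green hφ.contDiff_one i

/-! ### Linear structure of the Sobolev spaces -/

lemma MemL2.integrable_mul (hΩ : IsPolygonal Ω) {u : Plane → ℝ} (hu : MemL2 Ω u) {φ : Plane → ℝ}
    (hc : Continuous φ) (hs : HasCompactSupport φ) :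
    Integrable (fun x => u x * φ x) (volume.restrict Ω) := by
  have := hΩ.isFiniteMeasure
  obtain ⟨C, hC⟩ := hc.bounded_above_of_compact_support hs
  have hui : Integrable u (volume.restrict Ω) := MemLp.integrable (by norm_num) hu
  exact hui.mul_bdd hc.aestronglyMeasurable (Filter.Eventually.of_forall hC)

lemma IsTest.continuous {φ : Plane → ℝ} (h : IsTest Ω φ) : Continuous φ := h.1.continuous

lemma IsTest.continuous_pderiv {φ : Plane → ℝ} (h : IsTest Ω φ) (j : Fin 2) :
    Continuous (pderiv j φ) := LumpedElasticity.continuous_pderiv h.contDiff_one j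

lemma IsTest.hasCompactSupport_pderiv {φ : Plane → ℝ} (h : IsTest Ω φ) (j : Fin 2) :
    HasCompactSupport (pderiv j φ) := h.2.1.fderiv_apply (𝕜 := ℝ) _

lemma MemH1.add (hΩ : IsPolygonal Ω) {u v : Plane → ℝ} (hu : MemH1 Ω u) (hv : MemH1 Ω v) :
    MemH1 Ω (fun x => u x + v x) := by
  refine ⟨hu.1.add hv.1, fun j => ?_⟩
  obtain ⟨g, hg, hg'⟩ := hu.2 j
  obtain ⟨g2, hg2, hg2'⟩ := hv.2 j
  refine ⟨fun x => g x + g2 x, hg.add hg2, fun φ hφ => ?_⟩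
  simp only [add_mul]
  rw [integral_add (hu.1.integrable_mul hΩ (hφ.continuous_pderiv j) (hφ.hasCompactSupport_pderiv j))
      (hv.1.integrable_mul hΩ (hφ.continuous_pderiv j) (hφ.hasCompactSupport_pderiv j)),
    integral_add (hg.integrable_mul hΩ hφ.continuous hφ.2.1)
      (hg2.integrable_mul hΩ hφ.continuous hφ.2.1), hg' φ hφ, hg2' φ hφ]
  ring

lemma MemH1.const_mul {u : Plane → ℝ} (hu : MemH1 Ω u) (c : ℝ) :
    MemH1 Ω (fun x => c * u x) := by
  refine ⟨MemLp.const_mul hu.1 c, fun j => ?_⟩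
  obtain ⟨g, hg, hg'⟩ := hu.2 j
  refine ⟨fun x => c * g x, MemLp.const_mul hg c, fun φ hφ => ?_⟩
  simp only [mul_assoc, integral_const_mul, hg' φ hφ]
  ring

lemma memH1_zero : MemH1 Ω (fun _ => 0) :=
  ⟨MemLp.zero, fun _ => ⟨fun _ => 0, MemLp.zero, by simp⟩⟩

lemma MemHDiv.add (hΩ : IsPolygonal Ω) {σ τ : Plane → Matrix (Fin 2) (Fin 2) ℝ}
    (hσ : MemHDiv Ω σ) (hτ : MemHDiv Ω τ) : MemHDiv Ω (fun x => σ x + τ x) := by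
  obtain ⟨s1, m1, g1, hg1, h1⟩ := hσ
  obtain ⟨s2, m2, g2, hg2, h2⟩ := hτ
  refine ⟨?_, fun i j => (m1 i j).add (m2 i j), fun x => g1 x + g2 x,
    fun i => (hg1 i).add (hg2 i), fun φ hφ i => ?_⟩
  · filter_upwards [s1, s2] with x hx1 hx2 using hx1.add hx2
  · have e1 := h1 φ hφ i
    have e2 := h2 φ hφ i
    have I : ∀ {ρ : Plane → Matrix (Fin 2) (Fin 2) ℝ}, (∀ i j, MemL2 Ω fun x => ρ x i j) →
        Integrable (fun x => ∑ j, ρ x i j * pderiv j φ x) (volume.restrict Ω) := fun m =>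
      integrable_finsetSum _ fun j _ =>
        (m i j).integrable_mul hΩ (hφ.continuous_pderiv j) (hφ.hasCompactSupport_pderiv j)
    simp only [Matrix.add_apply, add_mul, Finset.sum_add_distrib, Pi.add_apply]
    rw [integral_add (I m1) (I m2), integral_add ((hg1 i).integrable_mul hΩ hφ.continuous hφ.2.1)
      ((hg2 i).integrable_mul hΩ hφ.continuous hφ.2.1), e1, e2]
    ring

lemma MemHDiv.const_smul {τ : Plane → Matrix (Fin 2) (Fin 2) ℝ}
    (hτ : MemHDiv Ω τ) (c : ℝ) : MemHDiv Ω (fun x => c • τ x) := by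
  obtain ⟨s1, m1, g1, hg1, h1⟩ := hτ
  refine ⟨?_, fun i j => MemLp.const_mul (m1 i j) c, fun x => c • g1 x,
    fun i => MemLp.const_mul (hg1 i) c, fun φ hφ i => ?_⟩
  · filter_upwards [s1] with x hx1 using hx1.smul c
  · have e1 := h1 φ hφ i
    simp only [Matrix.smul_apply, Pi.smul_apply, smul_eq_mul, mul_assoc, ← Finset.mul_sum,
      integral_const_mul, e1]
    ring

lemma memHDiv_of_memH1 (hΩ : IsPolygonal Ω) {τ : Plane → Matrix (Fin 2) (Fin 2) ℝ}
    (hs : ∀ᵐ x ∂(volume.restrict Ω), (τ x).IsSymm) (h : ∀ i j, MemH1 Ω fun x => τ x i j) :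
    MemHDiv Ω τ := by
  choose h1 g hg hg' using h
  refine ⟨hs, h1, fun x i => ∑ j, g i j j x, fun i => memLp_finsetSum _ fun j _ => hg i j j,
    fun φ hφ i => ?_⟩
  simp only [Finset.sum_mul]
  rw [integral_finsetSum _ (fun j _ => (h1 i j).integrable_mul hΩ (hφ.continuous_pderiv j)
      (hφ.hasCompactSupport_pderiv j)),
    integral_finsetSum _ (fun j _ => (hg i j j).integrable_mul hΩ hφ.continuous hφ.2.1),
    ← Finset.sum_neg_distrib]
  exact Finset.sum_congr rfl fun j _ => hg' i j j φ hφ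

/-! ### The finite element spaces as subspaces -/

lemma matFun_add (T : Triangulation Ω) (σ τ : MatField T) :
    matFun T (σ + τ) = fun x => matFun T σ x + matFun T τ x := by
  ext x i j
  simp only [matFun_apply, Matrix.add_apply, Pi.add_apply, scalFun_add]

lemma matFun_smul (T : Triangulation Ω) (c : ℝ) (τ : MatField T) :
    matFun T (c • τ) = fun x => c • matFun T τ x := by
  ext x i j
  simp only [matFun_apply, Matrix.smul_apply, Pi.smul_apply, scalFun_smul, smul_eq_mul]

lemma vecFun_add (T : Triangulation Ω) (v w : VecField T) :
    vecFun T (v + w) = vecFun T v + vecFun T w := by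
  ext x i
  simp only [vecFun_apply, Pi.add_apply, scalFun_add]

lemma vecFun_smul (T : Triangulation Ω) (c : ℝ) (v : VecField T) :
    vecFun T (c • v) = c • vecFun T v := by
  ext x i
  simp only [vecFun_apply, Pi.smul_apply, scalFun_smul, smul_eq_mul]

lemma totalDegree_add_le {p q : Poly} {m : ℕ} (hp : p.totalDegree ≤ m) (hq : q.totalDegree ≤ m) :
    (p + q).totalDegree ≤ m := (MvPolynomial.totalDegree_add _ _).trans (max_le hp hq)

lemma totalDegree_smul_le' {p : Poly} {m : ℕ} (hp : p.totalDegree ≤ m) (c : ℝ) :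
    (c • p).totalDegree ≤ m := (MvPolynomial.totalDegree_smul_le _ _).trans hp

lemma PolyS.add {m : ℕ} {σ τ : Matrix (Fin 2) (Fin 2) Poly} (hσ : σ ∈ PolyS m)
    (hτ : τ ∈ PolyS m) : σ + τ ∈ PolyS m :=
  ⟨hσ.1.add hτ.1, fun i j => totalDegree_add_le (hσ.2 i j) (hτ.2 i j)⟩

lemma PolyS.smul {m : ℕ} {τ : Matrix (Fin 2) (Fin 2) Poly} (hτ : τ ∈ PolyS m) (c : ℝ) :
    c • τ ∈ PolyS m :=
  ⟨hτ.1.smul c, fun i j => totalDegree_smul_le' (hτ.2 i j) c⟩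

lemma PolyS.zero (m : ℕ) : (0 : Matrix (Fin 2) (Fin 2) Poly) ∈ PolyS m :=
  ⟨Matrix.isSymm_zero, by simp⟩

lemma matFun_zero (T : Triangulation Ω) : matFun T 0 = fun _ => 0 := by
  ext x i j
  simp [matFun_apply, scalFun, funext pval_zero]

lemma memHDiv_zero (T : Triangulation Ω) : MemHDiv Ω (matFun T 0) := by
  rw [matFun_zero]
  exact ⟨Filter.Eventually.of_forall fun _ => Matrix.isSymm_zero, fun _ _ => MemLp.zero,
    fun _ _ => 0, fun _ => MemLp.zero, by intro φ _ i; simp⟩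

/-- `SigmaTilde` as a subspace. -/
def sigmaTildeSub (hΩ : IsPolygonal Ω) (k : ℕ) (T : Triangulation Ω) :
    Submodule ℝ (MatField T) where
  carrier := SigmaTilde k T
  add_mem' := by
    intro σ τ hσ hτ
    refine ⟨fun i j => ?_, fun K => PolyS.add (hσ.2 K) (hτ.2 K)⟩
    rw [matFun_add]
    exact (hσ.1 i j).add hΩ (hτ.1 i j)
  zero_mem' := ⟨fun i j => by rw [matFun_zero]; exact memH1_zero, fun K => PolyS.zero k⟩
  smul_mem' := by
    intro c τ hτ
    refine ⟨fun i j => ?_, fun K => PolyS.smul (hτ.2 K) c⟩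
    rw [matFun_smul]
    exact (hτ.1 i j).const_mul c

lemma mval_add (σ τ : Matrix (Fin 2) (Fin 2) Poly) (x : Plane) :
    mval (σ + τ) x = mval σ x + mval τ x := by
  ext i j; simp [mval]

lemma mval_smul (c : ℝ) (τ : Matrix (Fin 2) (Fin 2) Poly) (x : Plane) :
    mval (c • τ) x = c • mval τ x := by
  ext i j; simp [mval]

lemma mval_zero (x : Plane) : mval 0 x = 0 := by
  ext i j; simp [mval]

/-- `BubbleSpace` as a subspace. -/
def bubbleSub (hΩ : IsPolygonal Ω) (k : ℕ) (T : Triangulation Ω) :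
    Submodule ℝ (MatField T) where
  carrier := BubbleSpace k T
  add_mem' := by
    intro σ τ hσ hτ
    refine ⟨?_, fun K => ⟨PolyS.add (hσ.2 K).1 (hτ.2 K).1, fun i j hij x hx ν hν => ?_⟩⟩
    · rw [matFun_add]
      exact hσ.1.add hΩ hτ.1
    · rw [Pi.add_apply, mval_add, Matrix.add_mulVec, (hσ.2 K).2 i j hij x hx ν hν,
        (hτ.2 K).2 i j hij x hx ν hν, add_zero]
  zero_mem' := ⟨memHDiv_zero T, fun K => ⟨PolyS.zero k, fun i j hij x hx ν hν => by
    rw [Pi.zero_apply, mval_zero, Matrix.zero_mulVec]⟩⟩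
  smul_mem' := by
    intro c τ hτ
    refine ⟨?_, fun K => ⟨PolyS.smul (hτ.2 K).1 c, fun i j hij x hx ν hν => ?_⟩⟩
    · rw [matFun_smul]
      exact hτ.1.const_smul c
    · rw [Pi.smul_apply, mval_smul, Matrix.smul_mulVec, (hτ.2 K).2 i j hij x hx ν hν, smul_zero]

/-- `Enrich` as a subspace. -/
def enrichSub (hΩ : IsPolygonal Ω) (k k' : ℕ) (T : Triangulation Ω) :
    Submodule ℝ (MatField T) where
  carrier := Enrich k k' T
  add_mem' := by
    intro σ τ hσ hτ
    refine ⟨?_, fun K => ?_⟩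
    · rw [matFun_add]
      exact hσ.1.add hΩ hτ.1
    · obtain ⟨q, hq, hq'⟩ := hσ.2 K
      obtain ⟨r, hr, hr'⟩ := hτ.2 K
      refine ⟨q + r, fun n => ⟨(hq n).1.add (hr n).1, fun i j =>
        ((hq n).2 i j).add ((hr n).2 i j)⟩, ?_⟩
      simp only [Pi.add_apply, hq', hr', Finset.sum_add_distrib, smul_add]
  zero_mem' := ⟨memHDiv_zero T, fun K => ⟨0, fun n => ⟨Matrix.isSymm_zero, fun i j =>
    MvPolynomial.isHomogeneous_zero _ _ _⟩, by simp⟩⟩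
  smul_mem' := by
    intro c τ hτ
    refine ⟨?_, fun K => ?_⟩
    · rw [matFun_smul]
      exact hτ.1.const_smul c
    · obtain ⟨q, hq, hq'⟩ := hτ.2 K
      refine ⟨c • q, fun n => ⟨(hq n).1.smul c, fun i j => ?_⟩, ?_⟩
      · exact (MvPolynomial.homogeneousSubmodule _ _ n).smul_mem c ((hq n).2 i j)
      · simp only [Pi.smul_apply, hq', ← Finset.smul_sum]
        rw [smul_comm]

/-- `StressSpace` as a subspace. -/
def stressSub (hΩ : IsPolygonal Ω) (k k' : ℕ) (T : Triangulation Ω) :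
    Submodule ℝ (MatField T) :=
  sigmaTildeSub hΩ k T ⊔ bubbleSub hΩ k T ⊔ enrichSub hΩ k k' T

lemma mem_stressSub (hΩ : IsPolygonal Ω) (k k' : ℕ) (T : Triangulation Ω) (τ : MatField T) :
    τ ∈ stressSub hΩ k k' T ↔ τ ∈ StressSpace k k' T := by
  simp only [stressSub, Submodule.mem_sup]
  constructor
  · rintro ⟨_, ⟨a, ha, b, hb, rfl⟩, c, hc, rfl⟩
    exact ⟨_, ⟨a, ha, b, hb, rfl⟩, c, hc, rfl⟩
  · rintro ⟨_, ⟨a, ha, b, hb, rfl⟩, c, hc, rfl⟩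
    exact ⟨_, ⟨a, ha, b, hb, rfl⟩, c, hc, rfl⟩

/-! ### Local form, degree and finite dimension of the discrete spaces -/

lemma SigmaTilde.memHDiv (hΩ : IsPolygonal Ω) {k : ℕ} {T : Triangulation Ω} {τ : MatField T}
    (h : τ ∈ SigmaTilde k T) : MemHDiv Ω (matFun T τ) := by
  refine memHDiv_of_memH1 hΩ (Filter.Eventually.of_forall fun x => Matrix.IsSymm.ext fun i j => ?_)
    h.1
  simp only [matFun_apply, (h.2 _).1.apply]

lemma StressSpace.memHDiv (hΩ : IsPolygonal Ω) {k k' : ℕ} {T : Triangulation Ω} {τ : MatField T}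
    (h : τ ∈ StressSpace k k' T) : MemHDiv Ω (matFun T τ) := by
  obtain ⟨_, ⟨a, ha, b, hb, rfl⟩, c, hc, rfl⟩ := h
  rw [matFun_add, matFun_add]
  exact ((SigmaTilde.memHDiv hΩ ha).add hΩ hb.1).add hΩ hc.1

lemma Enrich.exists_eq {k k' : ℕ} {T : Triangulation Ω} {τ : MatField T}
    (h : τ ∈ Enrich k k' T) (K : T.cells) : ∃ q : Matrix (Fin 2) (Fin 2) Poly, q.IsSymm ∧
      (∀ i j, (q i j).totalDegree ≤ k' - 3) ∧ τ K = K.1.bubble • q := by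
  obtain ⟨q, hq, hq'⟩ := h.2 K
  refine ⟨_, Matrix.IsSymm.ext fun i j => ?_, fun i j => ?_, hq'⟩
  · simp only [Matrix.sum_apply, ((hq _).1).apply]
  · rw [Matrix.sum_apply]
    refine MvPolynomial.totalDegree_finsetSum_le fun n hn => ?_
    exact ((hq n).2 i j).totalDegree_le.trans (Finset.mem_Icc.1 hn).2

lemma Enrich.isSymm {k k' : ℕ} {T : Triangulation Ω} {τ : MatField T}
    (h : τ ∈ Enrich k k' T) (K : T.cells) : (τ K).IsSymm := by
  obtain ⟨q, hq, -, e⟩ := Enrich.exists_eq h K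
  rw [e]
  exact hq.smul _

lemma Enrich.normalZero {k k' : ℕ} {T : Triangulation Ω} {τ : MatField T}
    (h : τ ∈ Enrich k k' T) (K : T.cells) : NormalZero K.1 (τ K) := by
  obtain ⟨q, -, -, e⟩ := Enrich.exists_eq h K
  rw [e]
  exact NormalZero.bubble_smul _ _

/-- On each cell, the entries of a discrete stress field are in `P_{k,k'}`. -/
lemma StressSpace.mem_Pkk {k k' : ℕ} {T : Triangulation Ω} {τ : MatField T}
    (h : τ ∈ StressSpace k k' T) (K : T.cells) (i j : Fin 2) : τ K i j ∈ Pkk k k' K.1 := by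
  obtain ⟨_, ⟨a, ha, b, hb, rfl⟩, c, hc, rfl⟩ := h
  obtain ⟨q, -, hq, e⟩ := Enrich.exists_eq hc K
  refine ⟨a K i j + b K i j, q i j, totalDegree_add_le ((ha.2 K).2 i j) ((hb.2 K).1.2 i j),
    hq i j, ?_⟩
  simp [e]

lemma Triangle.totalDegree_bubble (K : Triangle) : K.bubble.totalDegree ≤ 3 := by
  have h1 := MvPolynomial.totalDegree_mul (K.bary 0 * K.bary 1) (K.bary 2)
  have h2 := MvPolynomial.totalDegree_mul (K.bary 0) (K.bary 1)
  have h3 := K.totalDegree_bary 0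
  have h4 := K.totalDegree_bary 1
  have h5 := K.totalDegree_bary 2
  unfold Triangle.bubble
  omega

/-- Only finite dimension is at stake; the generous bound also absorbs the truncated subtraction in
`k' - 3`. -/
lemma totalDegree_of_mem_Pkk {k k' : ℕ} {K : Triangle} {p : Poly} (h : p ∈ Pkk k k' K) :
    p.totalDegree ≤ k + k' + 3 := by
  obtain ⟨q, s, hq, hs, rfl⟩ := h
  have := K.totalDegree_bubble
  have h2 := MvPolynomial.totalDegree_mul K.bubble s
  exact totalDegree_add_le (by omega) (by omega)

/-- Spaces of piecewise polynomials of bounded degree are finite-dimensional. -/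
lemma finite_of_totalDegree_le {ι : Type*} [Finite ι] (m : ℕ) (S : Submodule ℝ (ι → Poly))
    (h : ∀ v ∈ S, ∀ i, (v i).totalDegree ≤ m) : Module.Finite ℝ S := by
  have hle : S ≤ Submodule.pi univ fun _ : ι => MvPolynomial.restrictTotalDegree (Fin 2) ℝ m :=
    fun v hv i _ => (MvPolynomial.mem_restrictTotalDegree _ _ _).2 (h v hv i)
  let f : S →ₗ[ℝ] (ι → MvPolynomial.restrictTotalDegree (Fin 2) ℝ m) :=
    LinearMap.pi fun i => ((LinearMap.proj i).comp S.subtype).codRestrict _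
      fun v => hle v.2 i (mem_univ i)
  have : Module.Finite ℝ (MvPolynomial.restrictTotalDegree (Fin 2) ℝ m) := inferInstance
  refine Module.Finite.of_injective f fun v w hvw => ?_
  ext1
  funext i
  exact congrArg Subtype.val (congrFun hvw i)

lemma finite_stressSub (hΩ : IsPolygonal Ω) (k k' : ℕ) (T : Triangulation Ω) :
    Module.Finite ℝ (stressSub hΩ k k' T) := by
  let e : MatField T →ₗ[ℝ] (T.cells × Fin 2 × Fin 2 → Poly) :=
    { toFun := fun τ z => τ z.1 z.2.1 z.2.2
      map_add' := fun _ _ => rfl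
      map_smul' := fun _ _ => rfl }
  have he : Function.Injective e := fun σ τ h => by
    ext1 K; ext1 i j
    exact congrFun h (K, i, j)
  have := finite_of_totalDegree_le (k + k' + 3) ((stressSub hΩ k k' T).map e) (by
    rintro _ ⟨τ, hτ, rfl⟩ z
    exact totalDegree_of_mem_Pkk
      (StressSpace.mem_Pkk ((mem_stressSub hΩ k k' T τ).1 hτ) z.1 z.2.1 z.2.2))
  exact Module.Finite.equiv (Submodule.equivMapOfInjective e he _).symm

/-- The piecewise divergence as a linear map. -/
def pdivLin (T : Triangulation Ω) : MatField T →ₗ[ℝ] VecField T where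
  toFun := pdiv T
  map_add' σ τ := by
    ext1 K; ext1 i
    simp [pdiv, Finset.sum_add_distrib]
  map_smul' c τ := by
    ext1 K; ext1 i
    simp only [pdiv, Pi.smul_apply, Matrix.smul_apply, Finset.smul_sum, RingHom.id_apply]
    exact Finset.sum_congr rfl fun j _ => (MvPolynomial.pderiv j).map_smul c _

@[simp] lemma pdivLin_apply (T : Triangulation Ω) (τ : MatField T) :
    pdivLin T τ = pdiv T τ := rfl

/-- `VHZ` as a subspace. -/
def vhzSub (k : ℕ) (T : Triangulation Ω) : Submodule ℝ (VecField T) where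
  carrier := VHZ k T
  add_mem' hv hw := fun K i => totalDegree_add_le (hv K i) (hw K i)
  zero_mem' := fun K i => by simp
  smul_mem' c v hv := fun K i => totalDegree_smul_le' (hv K i) c

/-- `DispSpace` as a subspace. -/
def dispSub (hΩ : IsPolygonal Ω) (k k' : ℕ) (T : Triangulation Ω) :
    Submodule ℝ (VecField T) :=
  vhzSub k T ⊔ (enrichSub hΩ k k' T).map (pdivLin T)

/-- Replaces the almost-everywhere class `weakDiv` in the definition by the linear map `pdivLin`,
which makes linear algebra available. -/
lemma mem_dispSub (hΩ : IsPolygonal Ω) (k k' : ℕ) (T : Triangulation Ω) (v : VecField T) :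
    v ∈ dispSub hΩ k k' T ↔ v ∈ DispSpace k k' T := by
  simp only [dispSub, Submodule.mem_sup, Submodule.mem_map]
  have key : ∀ w, ∀ τ ∈ Enrich k k' T, vecFun T w + weakDiv Ω (matFun T τ)
      =ᵐ[volume.restrict Ω] vecFun T (w + pdiv T τ) := by
    intro w τ hτ
    rw [vecFun_add]
    exact Filter.EventuallyEq.rfl.add (weakDiv_ae_eq hΩ T hτ.1)
  constructor
  · rintro ⟨w, hw, _, ⟨τ, hτ, rfl⟩, rfl⟩
    exact ⟨w, hw, τ, hτ, (key w τ hτ).symm⟩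
  · rintro ⟨w, hw, τ, hτ, h⟩
    exact ⟨w, hw, _, ⟨τ, hτ, rfl⟩, (vecFun_injective hΩ T (h.trans (key w τ hτ))).symm⟩

lemma finite_dispSub (hΩ : IsPolygonal Ω) (k k' : ℕ) (T : Triangulation Ω) :
    Module.Finite ℝ (dispSub hΩ k k' T) := by
  have h1 : Module.Finite ℝ (vhzSub k T) := by
    let e : VecField T →ₗ[ℝ] (T.cells × Fin 2 → Poly) :=
      { toFun := fun τ z => τ z.1 z.2
        map_add' := fun _ _ => rfl
        map_smul' := fun _ _ => rfl }
    have he : Function.Injective e := fun σ τ h => by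
      ext1 K; ext1 i
      exact congrFun h (K, i)
    have := finite_of_totalDegree_le (k - 1) ((vhzSub k T).map e) (by
      rintro _ ⟨τ, hτ, rfl⟩ z
      exact hτ z.1 z.2)
    exact Module.Finite.equiv (Submodule.equivMapOfInjective e he _).symm
  have h2 : Module.Finite ℝ (enrichSub hΩ k k' T) := by
    have := finite_stressSub hΩ k k' T
    exact Module.Finite.of_injective (Submodule.inclusion (show enrichSub hΩ k k' T ≤ stressSub hΩ k k' T
      from le_sup_right)) (Submodule.inclusion_injective _)
  unfold dispSub
  infer_instance

/-! ### The `L²` product of piecewise polynomial vector fields -/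

/-- The `L²` product of piecewise polynomial vector fields. -/
def prodVec (T : Triangulation Ω) : VecField T →ₗ[ℝ] VecField T →ₗ[ℝ] ℝ :=
  LinearMap.mk₂ ℝ (fun v w => ∑ K : T.cells, ∫ x in K.1.body, ∑ i, pval (v K i) x * pval (w K i) x)
    (fun v v' w => by
      rw [← Finset.sum_add_distrib]
      refine Finset.sum_congr rfl fun K _ => ?_
      rw [← integral_add (K.1.integrableOn (by fun_prop)) (K.1.integrableOn (by fun_prop))]
      simp [add_mul, Finset.sum_add_distrib])
    (fun c v w => by
      rw [smul_eq_mul, Finset.mul_sum]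
      refine Finset.sum_congr rfl fun K _ => ?_
      rw [← integral_const_mul]
      simp [mul_assoc, mul_add])
    (fun v w w' => by
      rw [← Finset.sum_add_distrib]
      refine Finset.sum_congr rfl fun K _ => ?_
      rw [← integral_add (K.1.integrableOn (by fun_prop)) (K.1.integrableOn (by fun_prop))]
      simp [mul_add, Finset.sum_add_distrib])
    (fun c v w => by
      rw [smul_eq_mul, Finset.mul_sum]
      refine Finset.sum_congr rfl fun K _ => ?_
      rw [← integral_const_mul]
      simp [mul_left_comm, mul_add])

lemma prodVec_apply (T : Triangulation Ω) (v w : VecField T) : prodVec T v w =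
    ∑ K : T.cells, ∫ x in K.1.body, ∑ i, pval (v K i) x * pval (w K i) x := rfl

lemma prodVec_comm (T : Triangulation Ω) (v w : VecField T) : prodVec T v w = prodVec T w v := by
  simp only [prodVec_apply, mul_comm]

lemma eq_zero_of_prodVec_self (T : Triangulation Ω) {v : VecField T} (h : prodVec T v v = 0) :
    v = 0 := by
  rw [prodVec_apply, Finset.sum_eq_zero_iff_of_nonneg (fun K _ => integral_nonneg fun x =>
    Finset.sum_nonneg fun i _ => mul_self_nonneg _)] at h
  ext1 K
  have hK : ∫ x in K.1.body, pval (∑ i, v K i * v K i) x = 0 := by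
    simpa [pval_sum] using h K (Finset.mem_univ K)
  have h0 := K.1.integral_pval_eq_zero (fun x _ => by
    simp only [pval_sum, pval_mul]
    exact Finset.sum_nonneg fun i _ => mul_self_nonneg _) hK
  ext1 i
  refine MvPolynomial.funext fun y => ?_
  have h1 : pval (∑ i, v K i * v K i) (WithLp.toLp 2 y) = 0 := by rw [h0, pval_zero]
  simp only [pval_sum, pval_mul] at h1
  rw [Finset.sum_eq_zero_iff_of_nonneg (fun i _ => mul_self_nonneg _)] at h1
  simpa [pval] using h1 i (Finset.mem_univ i)

lemma innerVec_vecFun (hΩ : IsPolygonal Ω) (T : Triangulation Ω) (v w : VecField T) :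
    innerVec Ω (vecFun T v) (vecFun T w) = prodVec T v w := by
  unfold innerVec
  rw [prodVec_apply]
  exact T.integral_eq hΩ (fun K => by fun_prop)
    (fun K x hx => by simp only [vecFun_apply, scalFun_eq T _ K hx])

lemma innerVec_weakDiv (hΩ : IsPolygonal Ω) (T : Triangulation Ω) {τ : MatField T}
    (hτ : MemHDiv Ω (matFun T τ)) (w : VecField T) :
    innerVec Ω (weakDiv Ω (matFun T τ)) (vecFun T w) = prodVec T (pdiv T τ) w := by
  rw [← innerVec_vecFun hΩ]
  unfold innerVec
  refine integral_congr_ae ?_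
  filter_upwards [weakDiv_ae_eq hΩ T hτ] with x hx
  rw [hx]

/-- Orthogonal projection to a finite-dimensional subspace, for a definite bilinear form. -/
lemma exists_orthogonal_projection {V : Type*} [AddCommGroup V] [Module ℝ V]
    (B : V →ₗ[ℝ] V →ₗ[ℝ] ℝ) (hB : ∀ v, B v v = 0 → v = 0) (M : Submodule ℝ V)
    [Module.Finite ℝ M] (v : V) : ∃ m ∈ M, ∀ m' ∈ M, B (v - m) m' = 0 := by
  -- Definiteness makes the form injective from `M` to its dual, hence surjective by dimension; `m`
  -- represents the functional `B v` on `M`.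
  let f : M →ₗ[ℝ] Module.Dual ℝ M := (B.domRestrict₁₂ M M)
  have hf : Function.Injective f := by
    rw [injective_iff_map_eq_zero]
    intro m hm
    exact Subtype.ext (hB _ (DFunLike.congr_fun hm m))
  have hs : Function.Surjective f :=
    (LinearMap.injective_iff_surjective_of_finrank_eq_finrank
      (Subspace.dual_finrank_eq (K := ℝ) (V := M)).symm).1 hf
  obtain ⟨m, hm⟩ := hs ((B v).domRestrict M)
  refine ⟨m, m.2, fun m' hm' => ?_⟩
  have := DFunLike.congr_fun hm ⟨m', hm'⟩
  simp only [f, LinearMap.domRestrict₁₂_apply, LinearMap.domRestrict_apply] at this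
  rw [map_sub, LinearMap.sub_apply, sub_eq_zero, this]

/-! ### Displacements orthogonal to the divergence of all bubbles -/

lemma prodVec_single (T : Triangulation Ω) [DecidableEq T.cells] (K : T.cells)
    (τ : Matrix (Fin 2) (Fin 2) Poly) (w : VecField T) :
    prodVec T (pdiv T (Pi.single K τ)) w =
      ∫ x in K.1.body, ∑ i, pval (∑ l, MvPolynomial.pderiv l (τ i l)) x * pval (w K i) x := by
  rw [prodVec_apply, Finset.sum_eq_single K]
  · simp only [pdiv, Pi.single_eq_same]
  · intro L _ hL
    simp [pdiv, Pi.single_eq_of_ne hL]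
  · simp

lemma single_mem_bubbleSpace (hΩ : IsPolygonal Ω) {k : ℕ} (T : Triangulation Ω)
    [DecidableEq T.cells] (K : T.cells) {τ : Matrix (Fin 2) (Fin 2) Poly}
    (hτ : τ ∈ BubbleS k K.1) : Pi.single K τ ∈ BubbleSpace k T := by
  have h : ∀ L : T.cells, (Pi.single K τ : MatField T) L ∈ BubbleS k L.1 := by
    intro L
    by_cases hL : L = K
    · subst hL
      rwa [Pi.single_eq_same]
    · rw [Pi.single_eq_of_ne hL]
      exact ⟨PolyS.zero k, fun i j hij x hx ν hν => by rw [mval_zero, Matrix.zero_mulVec]⟩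
  exact ⟨memHDiv_of_normalZero hΩ T (fun L => (h L).1.1)
    (fun L => NormalZero.of_mem_bubbleS (h L)), h⟩

/-- In the integration by parts the normal trace kills the edge terms and the symmetry of `τ` the
volume term. -/
lemma prodVec_pdiv_eq_zero (T : Triangulation Ω) {τ : MatField T} {w : VecField T}
    (hs : ∀ K, (τ K).IsSymm) (h : ∀ K, NormalZero K.1 (τ K)) (hw : ∀ K, IsRigid (w K)) :
    prodVec T (pdiv T τ) w = 0 := by
  rw [prodVec_apply]
  refine Finset.sum_eq_zero fun K _ => ?_
  simp only [pdiv]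
  rw [(h K).green_div, (hw K).sum_mul_pderiv (hs K)]
  simp

/-- The degrees fit: `w` has degree at most `k - 1`, so its strain has degree at most `k - 2`, which
is what an edge bubble of degree `k` admits as factor. Elements of `div Λ` may have higher degree,
so this does not apply to a general discrete displacement. -/
lemma isRigid_of_orthogonal_bubbles (hΩ : IsPolygonal Ω) {k : ℕ} (hk : 2 ≤ k)
    {T : Triangulation Ω} {w : VecField T} (hw : w ∈ VHZ k T)
    (h : ∀ τ ∈ BubbleSpace k T, prodVec T (pdiv T τ) w = 0) (K : T.cells) : IsRigid (w K) := by
  classical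
  refine K.1.isRigid_of_edgeStrain fun j => K.1.edgeStrain_eq_zero j ?_
  rw [← prodVec_single T K (K.1.edgeBubble j (K.1.edgeStrain j (w K))) w]
  refine h _ (single_mem_bubbleSpace hΩ T K (K.1.edgeBubble_mem_bubbleS j hk ?_))
  exact K.1.totalDegree_edgeStrain j (hw K)

/-- A discrete displacement that is orthogonal to the divergence of all discrete stress fields is
a rigid motion on each cell. -/
lemma isRigid_of_orthogonal (hΩ : IsPolygonal Ω) {k k' : ℕ} (hk : 2 ≤ k)
    {T : Triangulation Ω} {u : VecField T} (hu : u ∈ DispSpace k k' T)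
    (h : ∀ τ ∈ StressSpace k k' T, prodVec T (pdiv T τ) u = 0) (K : T.cells) :
    IsRigid (u K) := by
  rw [← mem_dispSub hΩ] at hu
  obtain ⟨w, hw, _, ⟨τ, hτ, rfl⟩, rfl⟩ := Submodule.mem_sup.1 hu
  have hfin : Module.Finite ℝ (bubbleSub hΩ k T) := by
    have := finite_stressSub hΩ k k' T
    exact Module.Finite.of_injective (Submodule.inclusion (show bubbleSub hΩ k T ≤ stressSub hΩ k k' T
      from le_sup_right.trans le_sup_left)) (Submodule.inclusion_injective _)
  -- Removing from `w` its projection to the divergences of the bubbles keeps the degree at most `k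
  -- - 1`, so the remainder falls under the previous lemma.
  obtain ⟨_, ⟨β, hβ, rfl⟩, ho⟩ := exists_orthogonal_projection (prodVec T)
    (fun v => eq_zero_of_prodVec_self T) ((bubbleSub hΩ k T).map (pdivLin T)) w
  have hβ' : β ∈ BubbleSpace k T := hβ
  have hτ' : τ ∈ Enrich k k' T := hτ
  have hβd : pdivLin T β ∈ vhzSub k T := fun K i => by
    simp only [pdivLin_apply, pdiv]
    exact MvPolynomial.totalDegree_finsetSum_le fun j _ =>
      totalDegree_pderiv_le _ _ ((hβ'.2 K).1.2 i j)
  have hr : ∀ K, IsRigid ((w - pdivLin T β) K) := by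
    refine isRigid_of_orthogonal_bubbles hΩ hk ((vhzSub k T).sub_mem hw hβd) fun σ hσ => ?_
    rw [prodVec_comm]
    exact ho _ ⟨σ, hσ, rfl⟩
  have hmem : β + τ ∈ StressSpace k k' T := by
    rw [← mem_stressSub hΩ]
    exact Submodule.add_mem _ ((le_sup_right.trans le_sup_left : bubbleSub hΩ k T ≤ _) hβ)
      ((le_sup_right : enrichSub hΩ k k' T ≤ _) hτ)
  have h1 := h _ hmem
  -- Now `u` is the rigid remainder plus `div (β + τ)`, and the two are orthogonal. Since `β + τ` is
  -- an admissible test stress, `div (β + τ)` is orthogonal to itself and vanishes.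
  have h2 : prodVec T (pdiv T (β + τ)) (w - pdivLin T β) = 0 := by
    rw [← pdivLin_apply, map_add, map_add, LinearMap.add_apply]
    rw [pdivLin_apply (τ := τ)]
    nth_rw 1 [pdivLin_apply]
    rw [prodVec_pdiv_eq_zero T (fun K => (hβ'.2 K).1.1)
        (fun K => NormalZero.of_mem_bubbleS (hβ'.2 K)) hr,
      prodVec_pdiv_eq_zero T (fun K => Enrich.isSymm hτ' K)
        (fun K => Enrich.normalZero hτ' K) hr, add_zero]
  have e : w + pdivLin T τ = (w - pdivLin T β) + pdiv T (β + τ) := by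
    rw [← pdivLin_apply, map_add]
    abel
  rw [e, map_add, h2, zero_add] at h1
  rw [e, eq_zero_of_prodVec_self T h1, add_zero]
  exact hr K

/-! ### Neighbouring cells -/

/-- The edge of `K` opposite to the vertex `j` and the edge of `L` opposite to the vertex `l`
coincide, with the cells on different sides. -/
structure IsOpposite (K L : Triangle) (j l : Fin 3) : Prop where
  points : (L.points (l + 1) = K.points (j + 1) ∧ L.points (l + 2) = K.points (j + 2)) ∨
    (L.points (l + 1) = K.points (j + 2) ∧ L.points (l + 2) = K.points (j + 1))
  sgnrm : ∀ i, L.sgnrm l i = - K.sgnrm j i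

lemma Triangle.bary_edge (K : Triangle) (j : Fin 3) (t : ℝ) :
    pval (K.bary j) (AffineMap.lineMap (K.points (j + 1)) (K.points (j + 2)) t) = 0 ∧
    pval (K.bary (j + 1)) (AffineMap.lineMap (K.points (j + 1)) (K.points (j + 2)) t) = 1 - t ∧
    pval (K.bary (j + 2)) (AffineMap.lineMap (K.points (j + 1)) (K.points (j + 2)) t) = t := by
  simp [K.bary_lineMap, K.bary_points]

lemma Triangle.det_mul_bary' (K : Triangle) (j : Fin 3) (x : Plane) :
    K.det * pval (K.bary j) x =
      K.nrm j 0 * (x 0 - K.points (j + 2) 0) + K.nrm j 1 * (x 1 - K.points (j + 2) 1) := by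
  have h := K.sum_nrm_mul j
  rw [Fin.sum_univ_two] at h
  rw [K.det_mul_bary]
  linear_combination h

/-- Applied with `a`, `b` the signed double areas of two cells, `s` the relative direction of their
common edge, and `x`, `y` the barycentric coordinates of one point with respect to that edge. -/
lemma sign_eq_of_mul_eq {a b s x y : ℝ} (ha : a ≠ 0) (hb : b ≠ 0) (hs : s = 1 ∨ s = -1)
    (hx : 0 ≤ x) (hy : y < 0) (h : a * x = s * (b * y)) :
    (SignType.sign a : ℝ) * s = - (SignType.sign b : ℝ) := by
  rcases hs with rfl | rfl <;> rcases lt_or_gt_of_ne ha with ha | ha <;>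
    rcases lt_or_gt_of_ne hb with hb | hb <;>
    simp only [sign_neg, sign_pos, ha, hb] <;> norm_num <;> nlinarith

/-- A single witness decides the side: a point beyond the edge as seen from `K`, but not beyond it
as seen from `L`. -/
lemma isOpposite_of_points {K L : Triangle} {j l : Fin 3}
    (hp : (L.points (l + 1) = K.points (j + 1) ∧ L.points (l + 2) = K.points (j + 2)) ∨
      (L.points (l + 1) = K.points (j + 2) ∧ L.points (l + 2) = K.points (j + 1)))
    {y : Plane} (hK : pval (K.bary j) y < 0) (hL : 0 ≤ pval (L.bary l) y) :
    IsOpposite K L j l := by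
  refine ⟨hp, ?_⟩
  rcases hp with ⟨h1, h2⟩ | ⟨h1, h2⟩
  · have hn : ∀ i, L.nrm l i = 1 * K.nrm j i := by
      intro i; fin_cases i <;> simp [Triangle.nrm, h1, h2]
    have := sign_eq_of_mul_eq L.det_ne_zero K.det_ne_zero (Or.inl rfl) hL hK (by
      rw [L.det_mul_bary, K.det_mul_bary, hn, hn, h1]; ring)
    intro i
    rw [Triangle.sgnrm, hn, ← mul_assoc, this, Triangle.sgnrm, neg_mul]
  · have hn : ∀ i, L.nrm l i = -1 * K.nrm j i := by
      intro i; fin_cases i <;> simp [Triangle.nrm, h1, h2]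
    have := sign_eq_of_mul_eq L.det_ne_zero K.det_ne_zero (Or.inr rfl) hL hK (by
      rw [L.det_mul_bary, K.det_mul_bary', hn, hn, h1]; ring)
    intro i
    rw [Triangle.sgnrm, hn, ← mul_assoc, this, Triangle.sgnrm, neg_mul]

/-- Finitely many closed cells: those that miss `x` also miss a neighbourhood of `x`. -/
lemma Triangulation.eventually_mem (T : Triangulation Ω) (x : Plane) :
    ∀ᶠ y in nhds x, ∀ L : T.cells, y ∈ L.1.body → x ∈ L.1.body := by
  rw [Filter.eventually_all]
  intro L
  by_cases hx : x ∈ L.1.body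
  · exact Filter.Eventually.of_forall fun _ _ => hx
  · filter_upwards [L.1.isClosed_body.isOpen_compl.mem_nhds hx] with y hy hyL
    exact absurd hyL hy

/-- Every edge is either outside of `Ω` or shared with a cell on the other side. -/
lemma Triangulation.exists_neighbor (hΩ : IsPolygonal Ω) (T : Triangulation Ω) (K : T.cells)
    (j : Fin 3) :
    (∀ x ∈ openSegment ℝ (K.1.points (j + 1)) (K.1.points (j + 2)), x ∉ Ω) ∨
      ∃ L : T.cells, L ≠ K ∧ ∃ l, IsOpposite K.1 L.1 j l := by
  by_contra! hcon
  obtain ⟨⟨x, hx, hxΩ⟩, hno⟩ := hcon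
  rw [openSegment_eq_image_lineMap] at hx
  obtain ⟨t, ⟨ht0, ht1⟩, rfl⟩ := hx
  set x := (AffineMap.lineMap (K.1.points (j + 1)) (K.1.points (j + 2)) t : Plane) with hxdef
  obtain ⟨b0, b1, b2⟩ := K.1.bary_edge j t
  rw [← hxdef] at b0 b1 b2
  have hc : Filter.Tendsto (fun s : ℝ => (AffineMap.lineMap x (K.1.points j) s : Plane))
      (nhds 0) (nhds x) := by
    have := (AffineMap.lineMap_continuous (R := ℝ) (p := x) (q := K.1.points j)).tendsto 0
    simpa using this
  -- A negative parameter moves `x` across the edge, away from vertex `j`. It is taken so small that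
  -- the new point is still in `Ω` and that every cell containing it also contains `x`.
  obtain ⟨s, hs, hs0⟩ := (((hc.eventually ((T.eventually_mem x).and (hΩ.isOpen.mem_nhds hxΩ))).filter_mono
    nhdsWithin_le_nhds).and (self_mem_nhdsWithin : Iio (0 : ℝ) ∈ nhdsWithin 0 (Iio 0))).exists
  obtain ⟨hmem, hyΩ⟩ := hs
  set y := (AffineMap.lineMap x (K.1.points j) s : Plane) with hydef
  have hyK : pval (K.1.bary j) y < 0 := by
    rw [hydef, K.1.bary_lineMap, b0, K.1.bary_points]
    simpa using hs0
  obtain ⟨L, hyL⟩ : ∃ L : T.cells, y ∈ L.1.body := by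
    have := subset_closure hyΩ
    rw [← T.cover] at this
    simpa using this
  have hxL := hmem L hyL
  have hLK : L ≠ K := by
    rintro rfl
    rw [Triangle.body_eq] at hyL
    exact absurd (hyL j) (not_le.2 hyK)
  have hxK : x ∈ K.1.body := by
    rw [K.1.body_eq]
    intro i
    have h3 : i = j ∨ i = j + 1 ∨ i = j + 2 := by
      clear * -
      revert i j
      decide
    rcases h3 with rfl | rfl | rfl
    · exact b0.ge
    · rw [b1]; linarith
    · rw [b2]; linarith
  -- Conformity applied at `x`, which belongs to both cells. It is not a vertex, so the intersection
  -- is an edge; since the coordinates `j + 1` and `j + 2` of `x` are positive, it is the edge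
  -- opposite to `j`.
  rcases T.conforming K.1 K.2 L.1 L.2 (fun h => hLK (Subtype.ext h.symm)) with
    h | ⟨i, m, -, h⟩ | ⟨i, i', m, m', hii, hi, hi', h⟩
  · exact (h ▸ ⟨hxK, hxL⟩ : x ∈ (∅ : Set Plane))
  · have hx' : x = K.1.points i := by
      have : x ∈ K.1.body ∩ L.1.body := ⟨hxK, hxL⟩
      rwa [h] at this
    rw [hx', K.1.bary_points] at b1 b2
    split_ifs at b1 <;> linarith
  · have hx' : x ∈ segment ℝ (K.1.points i) (K.1.points i') := h ▸ ⟨hxK, hxL⟩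
    have c1 : ¬ (i ≠ j + 1 ∧ i' ≠ j + 1) := fun hc => by
      rw [K.1.bary_eq_zero_of_mem_segment hc.1 hc.2 hx'] at b1
      linarith
    have c2 : ¬ (i ≠ j + 2 ∧ i' ≠ j + 2) := fun hc => by
      rw [K.1.bary_eq_zero_of_mem_segment hc.1 hc.2 hx'] at b2
      linarith
    have h3 : (i = j + 1 ∧ i' = j + 2) ∨ (i = j + 2 ∧ i' = j + 1) := by
      clear * - c1 c2
      revert i i' j
      decide
    have hmm : m ≠ m' := by
      rintro rfl
      exact hii (K.1.independent.injective (hi.trans hi'.symm))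
    obtain ⟨l, hl⟩ : ∃ l : Fin 3, (m = l + 1 ∧ m' = l + 2) ∨ (m = l + 2 ∧ m' = l + 1) := by
      clear * - hmm
      revert m m'
      decide
    have hyl : 0 ≤ pval (L.1.bary l) y := by
      rw [Triangle.body_eq] at hyL
      exact hyL l
    refine hno L hLK l (isOpposite_of_points ?_ hyK hyl)
    rcases h3 with ⟨rfl, rfl⟩ | ⟨rfl, rfl⟩ <;> rcases hl with ⟨rfl, rfl⟩ | ⟨rfl, rfl⟩ <;>
      simp [hi, hi']

/-! ### Edge functions -/

/-- The weighted mean over the segment from `a` to `b`. -/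
def edgeMean (a b : Plane) (G : Plane → ℝ) : ℝ :=
  ∫ t in (0 : ℝ)..1, t * (1 - t) * G (AffineMap.lineMap a b t)

lemma edgeMean_symm (a b : Plane) (G : Plane → ℝ) : edgeMean a b G = edgeMean b a G := by
  have := intervalIntegral.integral_comp_sub_left (a := 0) (b := 1)
    (fun t => t * (1 - t) * G (AffineMap.lineMap b a t)) (1 : ℝ)
  simp only [AffineMap.lineMap_apply_one_sub, sub_sub_cancel, sub_self, sub_zero] at this
  simp only [edgeMean]
  rw [← this]
  congr! 2 with t
  ring

lemma edgeMean_eq_zero {a b : Plane} {G : Plane → ℝ} (h : ∀ x ∈ openSegment ℝ a b, G x = 0) :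
    edgeMean a b G = 0 := by
  unfold edgeMean
  rw [intervalIntegral.integral_of_le zero_le_one, integral_Ioc_eq_integral_Ioo]
  refine setIntegral_eq_zero_of_forall_eq_zero fun t ht => ?_
  rw [h, mul_zero]
  rw [openSegment_eq_image_lineMap]
  exact mem_image_of_mem _ ht

lemma edgeMean_sub (a b : Plane) {F G : Plane → ℝ} (hF : Continuous F) (hG : Continuous G) :
    edgeMean a b (fun x => F x - G x) = edgeMean a b F - edgeMean a b G := by
  unfold edgeMean
  rw [← intervalIntegral.integral_sub (Continuous.intervalIntegrable (by fun_prop) _ _)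
    (Continuous.intervalIntegrable (by fun_prop) _ _)]
  simp only [mul_sub]

lemma eq_zero_of_edgeMean_eq_zero {a b : Plane} {G : Plane → ℝ} (hG : Continuous G)
    (hn : ∀ x, 0 ≤ G x) (h : edgeMean a b G = 0) {x : Plane} (hx : x ∈ openSegment ℝ a b) :
    G x = 0 := by
  rw [openSegment_eq_image_lineMap] at hx
  obtain ⟨t, ht, rfl⟩ := hx
  unfold edgeMean at h
  have hc : Continuous fun t : ℝ => t * (1 - t) * G (AffineMap.lineMap a b t) := by fun_prop
  rw [intervalIntegral.integral_of_le zero_le_one, integral_Ioc_eq_integral_Ioo,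
    setIntegral_eq_zero_iff_of_nonneg_ae ((ae_restrict_iff' measurableSet_Ioo).2
      (Filter.Eventually.of_forall fun t ht =>
        mul_nonneg (mul_nonneg ht.1.le (by linarith [ht.2])) (hn _)))
      (hc.integrableOn_Icc.mono_set Ioo_subset_Icc_self)] at h
  have := Measure.eqOn_open_of_ae_eq h isOpen_Ioo hc.continuousOn continuousOn_const ht
  have h2 : t * (1 - t) ≠ 0 := (mul_pos ht.1 (by linarith [ht.2])).ne'
  exact (mul_eq_zero.1 this).resolve_left h2

/-- The quadratic edge bubble, as a factor, selects one edge. -/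
lemma Triangle.sum_edgeInt (K : Triangle) (j : Fin 3) (c : Fin 3 → ℝ) (G : Fin 3 → Plane → ℝ) :
    ∑ i, c i * K.edgeInt i (fun x => pval (K.bary (j + 1) * K.bary (j + 2)) x * G i x) =
      c j * edgeMean (K.points (j + 1)) (K.points (j + 2)) (G j) := by
  rw [Finset.sum_eq_single j]
  · congr 1
    simp only [Triangle.edgeInt, edgeMean]
    congr! 2 with t
    obtain ⟨-, b1, b2⟩ := K.bary_edge j t
    rw [pval_mul, b1, b2]
    ring
  · intro i _ hij
    rw [K.edgeInt_zero, mul_zero]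
    intro x hx
    have h0 : pval (K.bary i) x = 0 := K.bary_eq_zero_of_mem_segment (by simp) (by simp)
      (openSegment_subset_segment ℝ _ _ hx)
    have h3 : i = j + 1 ∨ i = j + 2 := by
      clear * - hij
      revert i j
      decide
    rcases h3 with rfl | rfl <;> simp [h0]
  · simp

/-- The matrix field `λ_p λ_q Q` that belongs to the edge `[p, q]` opposite to `j`. -/
def Triangle.edgeField (K : Triangle) (j : Fin 3) (Q : Matrix (Fin 2) (Fin 2) Poly) :
    Matrix (Fin 2) (Fin 2) Poly := (K.bary (j + 1) * K.bary (j + 2)) • Q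

/-- Apart from the normal, the result depends only on `Q`, `φ` and the edge, so two cells that share
the edge and `Q` contribute opposite values. -/
lemma Triangle.integral_pderiv_edgeField (K : Triangle) (j : Fin 3)
    (Q : Matrix (Fin 2) (Fin 2) Poly) {φ : Plane → ℝ} (hφ : ContDiff ℝ 1 φ) (a b i : Fin 2) :
    ∫ x in K.body, pderiv i (fun x => pval (K.edgeField j Q a b) x * φ x) x =
      - (K.sgnrm j i * edgeMean (K.points (j + 1)) (K.points (j + 2))
        fun x => pval (Q a b) x * φ x) := by
  rw [K.green ((contDiff_one_pval _).mul hφ),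
    ← K.sum_edgeInt j (fun m => K.sgnrm m i) (fun _ x => pval (Q a b) x * φ x)]
  simp only [Triangle.edgeField, Matrix.smul_apply, smul_eq_mul, pval_mul, mul_assoc]

/-- The volume term vanishes for a rigid motion, so the pairing is a weighted edge integral of `Qν ·
w`. -/
lemma Triangle.integral_div_edgeField (K : Triangle) (j : Fin 3)
    {Q : Matrix (Fin 2) (Fin 2) Poly} (hQ : Q.IsSymm) {w : Fin 2 → Poly} (hw : IsRigid w) :
    ∫ x in K.body, ∑ i, pval (∑ l, MvPolynomial.pderiv l (K.edgeField j Q i l)) x * pval (w i) x =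
      - edgeMean (K.points (j + 1)) (K.points (j + 2))
        fun x => ∑ i, (∑ l, K.sgnrm j l * pval (Q i l) x) * pval (w i) x := by
  have hs : (K.edgeField j Q).IsSymm := hQ.smul _
  rw [K.green_div, hw.sum_mul_pderiv hs]
  have := K.sum_edgeInt j (fun _ => SignType.sign K.det)
    (fun m x => ∑ i, (∑ l, K.nrm m l * pval (Q i l) x) * pval (w i) x)
  simp only [pval_zero, integral_zero, sub_zero, neg_inj]
  convert! this using 1
  · refine Finset.sum_congr rfl fun m _ => ?_
    congr 2
    ext x
    simp only [Triangle.edgeField, Matrix.smul_apply, smul_eq_mul, pval_mul, Fin.sum_univ_two]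
    ring
  · simp only [edgeMean, Triangle.sgnrm]
    rw [← intervalIntegral.integral_const_mul]
    congr! 2 with t
    simp only [Fin.sum_univ_two]
    ring

/-- The symmetric matrix field with `Q n = d`. -/
def symmExt (n : Fin 2 → ℝ) (d : Fin 2 → Poly) : Matrix (Fin 2) (Fin 2) Poly :=
  Matrix.of fun a b => MvPolynomial.C ((n 0 ^ 2 + n 1 ^ 2)⁻¹) *
      (d a * MvPolynomial.C (n b) + MvPolynomial.C (n a) * d b) -
    MvPolynomial.C ((n 0 ^ 2 + n 1 ^ 2)⁻¹ ^ 2 * (n a * n b)) *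
      (d 0 * MvPolynomial.C (n 0) + d 1 * MvPolynomial.C (n 1))

lemma symmExt_isSymm (n : Fin 2 → ℝ) (d : Fin 2 → Poly) : (symmExt n d).IsSymm := by
  refine Matrix.IsSymm.ext fun a b => ?_
  simp only [symmExt, Matrix.of_apply, mul_comm (n a) (n b)]
  ring

/-- The field is `(d nᵀ + n dᵀ)/|n|² - (n · d) n nᵀ/|n|⁴`; applied to `n`, the last term cancels the
excess of the second. So a symmetric field can have any normal component, without raising the
degree. -/
lemma sum_mul_symmExt {n : Fin 2 → ℝ} (hn : n ≠ 0) (d : Fin 2 → Poly) (i : Fin 2) (x : Plane) :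
    ∑ l, n l * pval (symmExt n d i l) x = pval (d i) x := by
  have h : n 0 ^ 2 + n 1 ^ 2 ≠ 0 := by
    intro h
    refine hn (funext fun i => ?_)
    fin_cases i
    · exact pow_eq_zero_iff two_ne_zero |>.1 (by simp; nlinarith [sq_nonneg (n 0), sq_nonneg (n 1)])
    · exact pow_eq_zero_iff two_ne_zero |>.1 (by simp; nlinarith [sq_nonneg (n 0), sq_nonneg (n 1)])
  simp only [symmExt, Matrix.of_apply, pval_sub, pval_mul, pval_add, pval_C, Fin.sum_univ_two]
  fin_cases i <;> simp <;> field_simp <;> ring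

lemma totalDegree_C_mul_le {p : Poly} {m : ℕ} (hp : p.totalDegree ≤ m) (c : ℝ) :
    (MvPolynomial.C c * p).totalDegree ≤ m := by
  rw [MvPolynomial.C_mul']
  exact totalDegree_smul_le' hp c

lemma totalDegree_symmExt (n : Fin 2 → ℝ) {d : Fin 2 → Poly} {m : ℕ}
    (h : ∀ i, (d i).totalDegree ≤ m) (a b : Fin 2) : (symmExt n d a b).totalDegree ≤ m := by
  simp only [symmExt, Matrix.of_apply, mul_comm (d _)]
  refine (MvPolynomial.totalDegree_sub _ _).trans (max_le ?_ ?_) <;>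
  exact totalDegree_C_mul_le
    (totalDegree_add_le (totalDegree_C_mul_le (h _) _) (totalDegree_C_mul_le (h _) _)) _

lemma Triangle.sgnrm_ne_zero (K : Triangle) (j : Fin 3) : K.sgnrm j ≠ 0 := by
  intro h
  have h1 : ∀ i, K.nrm j i = 0 := fun i => by
    have := congrFun h i
    refine (mul_eq_zero.1 this).resolve_left ?_
    rcases lt_or_gt_of_ne K.det_ne_zero with hd | hd <;> simp [hd]
  have := K.det_mul_bary j (K.points j)
  simp [h1, K.bary_points, K.det_ne_zero] at this

/-- Two barycentric factors times an affine field have degree at most 3; this is where `3 ≤ k`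
enters. -/
lemma Triangle.edgeField_mem_polyS (K : Triangle) (j : Fin 3) {k : ℕ} (hk : 3 ≤ k)
    {Q : Matrix (Fin 2) (Fin 2) Poly} (hs : Q.IsSymm) (hQ : ∀ a b, (Q a b).totalDegree ≤ 1) :
    K.edgeField j Q ∈ PolyS k :=
  ⟨hs.smul _, fun a b => K.totalDegree_bary_mul _ _ (by omega) ((hQ a b).trans (by omega))⟩

/-- The field vanishes on the two other edges, and test functions vanish on an edge that misses `Ω`,
so extension by zero creates no jump visible in `Ω`. -/
lemma scalFun_single_memH1 (hΩ : IsPolygonal Ω) (T : Triangulation Ω) [DecidableEq T.cells]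
    (K : T.cells) (j : Fin 3)
    (hb : ∀ x ∈ openSegment ℝ (K.1.points (j + 1)) (K.1.points (j + 2)), x ∉ Ω)
    (Q : Matrix (Fin 2) (Fin 2) Poly) (a b : Fin 2) :
    MemH1 Ω (scalFun T fun M => (Pi.single K (K.1.edgeField j Q) : MatField T) M a b) := by
  refine memH1_of_forall hΩ T _ fun φ hφ i => ?_
  rw [Finset.sum_eq_single K]
  · simp only [Pi.single_eq_same]
    rw [K.1.integral_pderiv_edgeField j Q hφ.contDiff_one, edgeMean_eq_zero, mul_zero, neg_zero]
    intro x hx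
    rw [image_eq_zero_of_notMem_tsupport fun hx' => hb x hx (hφ.2.2 hx'), mul_zero]
  · intro L _ hL
    simp [Pi.single_eq_of_ne hL, pderiv_eq]
  · simp

lemma IsOpposite.edgeMean_eq {K L : Triangle} {j l : Fin 3} (h : IsOpposite K L j l)
    (G : Plane → ℝ) : edgeMean (L.points (l + 1)) (L.points (l + 2)) G =
      edgeMean (K.points (j + 1)) (K.points (j + 2)) G := by
  rcases h.points with ⟨h1, h2⟩ | ⟨h1, h2⟩
  · rw [h1, h2]
  · rw [h1, h2, edgeMean_symm]

/-- The two pieces have the same trace on the common edge and opposite normals there, so the edge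
terms cancel. -/
lemma scalFun_pair_memH1 (hΩ : IsPolygonal Ω) (T : Triangulation Ω) [DecidableEq T.cells]
    {K L : T.cells} (hne : L ≠ K) {j l : Fin 3} (ho : IsOpposite K.1 L.1 j l)
    (Q : Matrix (Fin 2) (Fin 2) Poly) (a b : Fin 2) :
    MemH1 Ω (scalFun T fun M => (Pi.single K (K.1.edgeField j Q) +
      Pi.single L (L.1.edgeField l Q) : MatField T) M a b) := by
  refine memH1_of_forall hΩ T _ fun φ hφ i => ?_
  rw [Finset.sum_eq_add K L hne.symm]
  · simp only [Pi.add_apply, Pi.single_eq_same, Pi.single_eq_of_ne hne, Pi.single_eq_of_ne hne.symm,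
      add_zero, zero_add]
    rw [K.1.integral_pderiv_edgeField j Q hφ.contDiff_one,
      L.1.integral_pderiv_edgeField l Q hφ.contDiff_one, ho.edgeMean_eq, ho.sgnrm]
    ring
  · intro M _ hM
    simp [Pi.single_eq_of_ne hM.1, Pi.single_eq_of_ne hM.2, pderiv_eq]
  · simp
  · simp

lemma single_edgeField_mem (T : Triangulation Ω) [DecidableEq T.cells] (K : T.cells) (j : Fin 3)
    {k : ℕ} (hk : 3 ≤ k) {Q : Matrix (Fin 2) (Fin 2) Poly} (hs : Q.IsSymm)
    (hQ : ∀ a b, (Q a b).totalDegree ≤ 1) (M : T.cells) :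
    (Pi.single K (K.1.edgeField j Q) : MatField T) M ∈ PolyS k := by
  by_cases hM : M = K
  · subst hM
    rw [Pi.single_eq_same]
    exact M.1.edgeField_mem_polyS j hk hs hQ
  · rw [Pi.single_eq_of_ne hM]
    exact PolyS.zero k

section EdgeJumps

variable {k : ℕ} {T : Triangulation Ω} {u : VecField T}

/-- A piecewise rigid motion that is orthogonal to the divergence of all continuous stress fields
vanishes on the cells with a boundary edge. -/
lemma eq_zero_of_boundary_edge (hΩ : IsPolygonal Ω) (hk : 3 ≤ k) (hu : ∀ K, IsRigid (u K))
    (h : ∀ τ ∈ SigmaTilde k T, prodVec T (pdiv T τ) u = 0) {K : T.cells} {j : Fin 3}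
    (hb : ∀ x ∈ openSegment ℝ (K.1.points (j + 1)) (K.1.points (j + 2)), x ∉ Ω) :
    ∀ x ∈ openSegment ℝ (K.1.points (j + 1)) (K.1.points (j + 2)), ∀ i, pval (u K i) x = 0 := by
  classical
  -- With `Qν = u` the pairing becomes, up to sign, the weighted edge integral of `|u|²`.
  have hs := symmExt_isSymm (K.1.sgnrm j) (u K)
  have h1 := h (Pi.single K (K.1.edgeField j (symmExt (K.1.sgnrm j) (u K))))
    ⟨fun a b => by
      simp only [matFun_apply]
      exact scalFun_single_memH1 hΩ T K j hb _ a b,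
    single_edgeField_mem T K j hk hs (totalDegree_symmExt _ (hu K).totalDegree_le)⟩
  rw [prodVec_single, K.1.integral_div_edgeField j hs (hu K), neg_eq_zero] at h1
  simp only [sum_mul_symmExt (K.1.sgnrm_ne_zero j)] at h1
  intro x hx i
  have h2 := eq_zero_of_edgeMean_eq_zero (by fun_prop)
    (fun x => Finset.sum_nonneg fun i _ => mul_self_nonneg _) h1 hx
  rw [Finset.sum_eq_zero_iff_of_nonneg (fun i _ => mul_self_nonneg _)] at h2
  simpa using h2 i (Finset.mem_univ i)

/-- A piecewise rigid motion that is orthogonal to the divergence of all continuous stress fields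
is continuous across interior edges. -/
lemma eq_of_interior_edge (hΩ : IsPolygonal Ω) (hk : 3 ≤ k) (hu : ∀ K, IsRigid (u K))
    (h : ∀ τ ∈ SigmaTilde k T, prodVec T (pdiv T τ) u = 0) {K L : T.cells} (hne : L ≠ K)
    {j l : Fin 3} (ho : IsOpposite K.1 L.1 j l) :
    ∀ x ∈ openSegment ℝ (K.1.points (j + 1)) (K.1.points (j + 2)), ∀ i,
      pval (u K i) x = pval (u L i) x := by
  classical
  -- The same `Q` with `Qν = d` is used on both sides. The opposite normal of `L` makes the sum the
  -- edge mean of `d · u K - d · u L = |d|²`.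
  set d := u K - u L with hd
  have hdr : IsRigid d := (hu K).sub (hu L)
  have hs := symmExt_isSymm (K.1.sgnrm j) d
  have h1 := h (Pi.single K (K.1.edgeField j (symmExt (K.1.sgnrm j) d)) +
      Pi.single L (L.1.edgeField l (symmExt (K.1.sgnrm j) d)))
    ⟨fun a b => by
      simp only [matFun_apply]
      exact scalFun_pair_memH1 hΩ T hne ho _ a b,
    fun M => PolyS.add
      (single_edgeField_mem T K j hk hs (totalDegree_symmExt _ hdr.totalDegree_le) M)
      (single_edgeField_mem T L l hk hs (totalDegree_symmExt _ hdr.totalDegree_le) M)⟩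
  rw [← pdivLin_apply, map_add, map_add, LinearMap.add_apply, pdivLin_apply, pdivLin_apply,
    prodVec_single, prodVec_single, K.1.integral_div_edgeField j hs (hu K),
    L.1.integral_div_edgeField l hs (hu L), ho.edgeMean_eq] at h1
  simp only [ho.sgnrm, neg_mul, Finset.sum_neg_distrib] at h1
  simp only [sum_mul_symmExt (K.1.sgnrm_ne_zero j)] at h1
  have e : edgeMean (K.1.points (j + 1)) (K.1.points (j + 2))
      (fun x => ∑ i, pval (d i) x * pval (d i) x) = 0 := by
    have h3 := edgeMean_sub (K.1.points (j + 1)) (K.1.points (j + 2))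
      (F := fun x => ∑ i, pval (d i) x * pval (u K i) x)
      (G := fun x => ∑ i, pval (d i) x * pval (u L i) x) (by fun_prop) (by fun_prop)
    have h4 : edgeMean (K.1.points (j + 1)) (K.1.points (j + 2))
      (fun x => -∑ i, pval (d i) x * pval (u L i) x) =
        - edgeMean (K.1.points (j + 1)) (K.1.points (j + 2))
          (fun x => ∑ i, pval (d i) x * pval (u L i) x) := by
      simp only [edgeMean, mul_neg, intervalIntegral.integral_neg]
    rw [h4] at h1
    have h5 : (fun x => ∑ i, pval (d i) x * pval (d i) x) = fun x =>
        ∑ i, pval (d i) x * pval (u K i) x - ∑ i, pval (d i) x * pval (u L i) x := by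
      ext x
      rw [← Finset.sum_sub_distrib]
      refine Finset.sum_congr rfl fun i _ => ?_
      nth_rw 2 [hd]
      rw [Pi.sub_apply, pval_sub, mul_sub]
    rw [h5, h3]
    linarith
  intro x hx i
  have h2 := eq_zero_of_edgeMean_eq_zero (by fun_prop)
    (fun x => Finset.sum_nonneg fun i _ => mul_self_nonneg _) e hx
  rw [Finset.sum_eq_zero_iff_of_nonneg (fun i _ => mul_self_nonneg _)] at h2
  have := h2 i (Finset.mem_univ i)
  rw [mul_self_eq_zero, hd, Pi.sub_apply, pval_sub, sub_eq_zero] at this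
  exact this

end EdgeJumps

/-! ### Piecewise rigid motions without jumps vanish -/

/-- The directional derivative of a barycentric coordinate. -/
def Triangle.slope (K : Triangle) (j : Fin 3) (d : Plane) : ℝ :=
  K.det⁻¹ * (K.nrm j 0 * d 0 + K.nrm j 1 * d 1)

lemma Triangle.bary_add_smul (K : Triangle) (j : Fin 3) (x d : Plane) (t : ℝ) :
    pval (K.bary j) (x + t • d) = pval (K.bary j) x + t * K.slope j d := by
  simp only [K.pval_bary, Triangle.slope, PiLp.add_apply, PiLp.smul_apply, smul_eq_mul]
  ring

/-- Positive coordinates stay positive for a short time, and vanishing ones do not decrease. -/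
lemma Triangle.exists_pos_mem_body (K : Triangle) {x d : Plane}
    (h : ∀ j, 0 < pval (K.bary j) x ∨ (pval (K.bary j) x = 0 ∧ 0 ≤ K.slope j d)) :
    ∃ t : ℝ, 0 < t ∧ x + t • d ∈ K.body := by
  have key : ∀ᶠ t : ℝ in nhdsWithin 0 (Ioi 0), ∀ j, 0 ≤ pval (K.bary j) (x + t • d) := by
    rw [Filter.eventually_all]
    intro j
    rcases h j with hj | ⟨hj, hs⟩
    · have hc : Continuous fun t : ℝ => pval (K.bary j) (x + t • d) := by fun_prop
      have : ∀ᶠ t : ℝ in nhds 0, 0 < pval (K.bary j) (x + t • d) :=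
        hc.continuousAt.eventually (lt_mem_nhds (by simpa using hj))
      exact (this.filter_mono nhdsWithin_le_nhds).mono fun t ht => ht.le
    · filter_upwards [self_mem_nhdsWithin] with t ht
      rw [K.bary_add_smul, hj, zero_add]
      exact mul_nonneg (le_of_lt ht) hs
  obtain ⟨t, ht, ht0⟩ := (key.and self_mem_nhdsWithin).exists
  exact ⟨t, ht0, by rw [K.body_eq]; exact ht⟩

/-- Up to the positive factor `|det|` the slope is the product of `d` with the oriented normal,
which changes sign between neighbours: a direction that leaves `K` enters `L`. -/
lemma IsOpposite.slope_pos {K L : Triangle} {j l : Fin 3} (h : IsOpposite K L j l) {d : Plane}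
    (hd : K.slope j d < 0) : 0 < L.slope l d := by
  have e : ∀ (M : Triangle) (m : Fin 3),
      |M.det| * M.slope m d = M.sgnrm m 0 * d 0 + M.sgnrm m 1 * d 1 := by
    intro M m
    have := M.det_ne_zero
    rw [← sign_mul_self M.det]
    simp only [Triangle.slope, Triangle.sgnrm]
    field_simp
  have h1 := e K j
  have h2 := e L l
  rw [h.sgnrm, h.sgnrm] at h2
  have hK := abs_pos.2 K.det_ne_zero
  have hL := abs_pos.2 L.det_ne_zero
  have h3 : 0 < |L.det| * L.slope l d := by
    have := mul_neg_of_pos_of_neg hK hd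
    linarith
  exact (mul_pos_iff_of_pos_left hL).1 h3

lemma IsRigid.eq_zero_of_openSegment {w : Fin 2 → Poly} (h : IsRigid w) {a b : Plane} (hab : a ≠ b)
    (h0 : ∀ x ∈ openSegment ℝ a b, ∀ i, pval (w i) x = 0) : w = 0 := by
  have hm : ∀ t ∈ Ioo (0 : ℝ) 1, AffineMap.lineMap a b t ∈ openSegment ℝ a b := fun t ht => by
    rw [openSegment_eq_image_lineMap]
    exact mem_image_of_mem _ ht
  refine h.eq_zero (x := AffineMap.lineMap a b (1 / 3 : ℝ)) (y := AffineMap.lineMap a b (2 / 3 : ℝ))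
    (fun he => ?_) (h0 _ (hm _ (by norm_num))) (h0 _ (hm _ (by norm_num)))
  have := AffineMap.lineMap_injective ℝ hab he
  norm_num at this

lemma Triangle.points_ne (K : Triangle) (j : Fin 3) : K.points (j + 1) ≠ K.points (j + 2) :=
  fun h => absurd (K.independent.injective h) (by simp)

/-- There is a direction in which no vertex is seen from `x`. -/
lemma exists_generic_direction (T : Triangulation Ω) (x : Plane) : ∃ d : Plane, d 0 = 1 ∧
    ∀ (K : T.cells) (i : Fin 3) (t : ℝ), 0 < t → x + t • d ≠ K.1.points i := by
  -- The slope `m` avoids the finitely many slopes from `x` to vertices. A vertex with the same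
  -- first coordinate as `x` only contributes the default value of a division by zero; it is never
  -- met, since the ray moves with unit speed in that coordinate.
  obtain ⟨m, hm⟩ := Set.Infinite.exists_notMem_finset (Set.infinite_univ (α := ℝ))
    (Finset.univ.image fun z : T.cells × Fin 3 =>
      (z.1.1.points z.2 1 - x 1) / (z.1.1.points z.2 0 - x 0))
  refine ⟨!₂[1, m], by simp, fun K i t ht he => hm.2 (Finset.mem_image.2 ⟨(K, i), by simp, ?_⟩)⟩
  have h0 := congrArg (fun p : Plane => p 0) he
  have h1 := congrArg (fun p : Plane => p 1) he
  simp at h0 h1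
  rw [← h0, ← h1]
  have := ht.ne'
  simp
  field_simp

/-- A ray that starts in a cell of a nonempty family leaves the union of the family in a point
that is in the relative interior of an edge, provided that it avoids the vertices. -/
lemma exists_exit_point (T : Triangulation Ω) (N : Set T.cells) {K₀ : T.cells} (h₀ : K₀ ∈ N) :
    ∃ (d x : Plane) (K : T.cells) (j : Fin 3), K ∈ N ∧
      x ∈ openSegment ℝ (K.1.points (j + 1)) (K.1.points (j + 2)) ∧ K.1.slope j d < 0 ∧
      ∀ L ∈ N, ∀ t : ℝ, 0 < t → x + t • d ∉ L.1.body := by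
  obtain ⟨x₀, hx₀⟩ := K₀.1.interior_nonempty
  obtain ⟨d, hd0, hd⟩ := exists_generic_direction T x₀
  -- The times at which the ray is in the family. This set is closed, and bounded because the first
  -- coordinate grows with unit speed on bounded cells; its supremum is the exit time.
  set S : Set ℝ := {t | 0 ≤ t} ∩ ⋃ K ∈ N, (fun t : ℝ => x₀ + t • d) ⁻¹' K.1.body with hS
  have hγ : Continuous fun t : ℝ => x₀ + t • d := by fun_prop
  have hcl : IsClosed S := by
    refine (isClosed_le continuous_const continuous_id).inter ?_
    exact (Set.toFinite N).isClosed_biUnion fun K _ => K.1.isClosed_body.preimage hγ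
  have hbd : BddAbove S := by
    have hb : ∀ K : T.cells, BddAbove ((fun y : Plane => y 0 - x₀ 0) '' K.1.body) := fun K =>
      (K.1.isCompact_body.image (by fun_prop)).bddAbove
    choose B hB using hb
    refine ⟨∑ K, |B K|, fun t ht => ?_⟩
    obtain ⟨-, ht⟩ := ht
    simp only [mem_iUnion, mem_preimage, exists_prop] at ht
    obtain ⟨K, -, hK⟩ := ht
    have h1 : t ≤ B K := by
      have := hB K (mem_image_of_mem _ hK)
      simpa [hd0] using this
    exact h1.trans ((le_abs_self _).trans (Finset.single_le_sum (f := fun K => |B K|)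
      (fun K _ => abs_nonneg _) (Finset.mem_univ K)))
  have hne : S.Nonempty := ⟨0, le_refl (0 : ℝ), by
    simp only [mem_iUnion, mem_preimage, exists_prop]
    exact ⟨K₀, h₀, by simpa using interior_subset hx₀⟩⟩
  have hmem := hcl.csSup_mem hne hbd
  set s := sSup S with hs
  have hmax : ∀ L ∈ N, ∀ t : ℝ, 0 < t → x₀ + s • d + t • d ∉ L.1.body := by
    intro L hL t ht hmem'
    have : s + t ∈ S := by
      refine ⟨add_nonneg hmem.1 ht.le, ?_⟩
      simp only [mem_iUnion, mem_preimage, exists_prop]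
      exact ⟨L, hL, by rwa [add_smul, ← add_assoc]⟩
    linarith [le_csSup hbd this]
  -- The direction avoids the vertices only at positive times, so the exit time must be positive;
  -- this is why the ray starts in the interior of a cell.
  have hs0 : 0 < s := by
    refine lt_of_le_of_ne hmem.1 fun h => ?_
    obtain ⟨t, ht, ht'⟩ := K₀.1.exists_pos_mem_body (x := x₀) (d := d) fun j =>
      Or.inl (by rw [K₀.1.interior_body] at hx₀; exact hx₀ j)
    exact hmax K₀ h₀ t ht (by rwa [← h, zero_smul, add_zero])
  obtain ⟨-, hmem2⟩ := hmem
  simp only [mem_iUnion, mem_preimage, exists_prop] at hmem2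
  obtain ⟨K, hKN, hK⟩ := hmem2
  have hnv := fun i => hd K i s hs0
  set x := x₀ + s • d with hx
  rw [K.1.body_eq] at hK
  -- If no vanishing coordinate decreased along `d`, the ray would stay in `K` for a while after the
  -- exit time.
  obtain ⟨j, hj0, hj⟩ : ∃ j, pval (K.1.bary j) x = 0 ∧ K.1.slope j d < 0 := by
    by_contra! hcon
    obtain ⟨t, ht, ht'⟩ := K.1.exists_pos_mem_body (x := x) (d := d) fun j => by
      rcases (hK j).lt_or_eq with h | h
      · exact Or.inl h
      · exact Or.inr ⟨h.symm, hcon j h.symm⟩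
    exact hmax K hKN t ht ht'
  have hsum : pval (K.1.bary j) x + pval (K.1.bary (j + 1)) x + pval (K.1.bary (j + 2)) x = 1 := by
    have := K.1.sum_bary x
    rw [Fin.sum_univ_three] at this
    fin_cases j <;> simp <;> linarith
  have hpt : x = pval (K.1.bary j) x • K.1.points j +
      pval (K.1.bary (j + 1)) x • K.1.points (j + 1) +
      pval (K.1.bary (j + 2)) x • K.1.points (j + 2) := by
    conv_lhs => rw [← K.1.pointOf_bary x]
    rw [Triangle.pointOf, Fin.sum_univ_three]
    fin_cases j <;> simp <;> abel
  rw [hj0, zero_smul, zero_add] at hpt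
  rw [hj0, zero_add] at hsum
  -- If another coordinate vanished, `x` would be a vertex, contrary to the choice of the direction.
  have h1 : pval (K.1.bary (j + 1)) x ≠ 0 := fun h => by
    rw [h, zero_add] at hsum
    rw [h, hsum, zero_smul, one_smul, zero_add] at hpt
    exact hnv _ hpt
  have h2 : pval (K.1.bary (j + 2)) x ≠ 0 := fun h => by
    rw [h, add_zero] at hsum
    rw [h, hsum, zero_smul, one_smul, add_zero] at hpt
    exact hnv _ hpt
  exact ⟨d, x, K, j, hKN, ⟨_, _, (hK _).lt_of_ne' h1, (hK _).lt_of_ne' h2, hsum, hpt.symm⟩, hj, hmax⟩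

/-- An extremal argument at the point where a ray leaves the cells with nonzero `u`: on a boundary
edge, or next to a cell with zero `u`, the trace vanishes and so does `u K`; otherwise the ray
continues in the neighbour, which belongs to the family. -/
lemma eq_zero_of_orthogonal_sigmaTilde (hΩ : IsPolygonal Ω) {k : ℕ} (hk : 3 ≤ k)
    {T : Triangulation Ω} {u : VecField T} (hu : ∀ K, IsRigid (u K))
    (h : ∀ τ ∈ SigmaTilde k T, prodVec T (pdiv T τ) u = 0) : u = 0 := by
  by_contra hne
  obtain ⟨K₀, hK₀⟩ : ∃ K, u K ≠ 0 := by
    by_contra! hc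
    exact hne (funext hc)
  obtain ⟨d, x, K, j, hK, hx, hd, hmax⟩ :=
    exists_exit_point T {K | u K ≠ 0} (K₀ := K₀) hK₀
  refine hK ?_
  rcases T.exists_neighbor hΩ K j with hb | ⟨L, hLK, l, ho⟩
  · exact (hu K).eq_zero_of_openSegment (K.1.points_ne j)
      (eq_zero_of_boundary_edge hΩ hk hu h hb)
  · have hKL := eq_of_interior_edge hΩ hk hu h hLK ho
    by_cases hL : u L = 0
    · refine (hu K).eq_zero_of_openSegment (K.1.points_ne j) fun y hy i => ?_
      rw [hKL y hy i, hL, Pi.zero_apply, pval_zero]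
    · exfalso
      have hx' : x ∈ openSegment ℝ (L.1.points (l + 1)) (L.1.points (l + 2)) := by
        rcases ho.points with ⟨h1, h2⟩ | ⟨h1, h2⟩
        · rwa [h1, h2]
        · rwa [h1, h2, openSegment_symm]
      rw [openSegment_eq_image_lineMap] at hx'
      obtain ⟨t, ⟨ht0, ht1⟩, rfl⟩ := hx'
      obtain ⟨b0, b1, b2⟩ := L.1.bary_edge l t
      obtain ⟨s, hs, hs'⟩ := L.1.exists_pos_mem_body (d := d) fun i => by
        have h3 : i = l ∨ i = l + 1 ∨ i = l + 2 := by
          clear * -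
          revert i l
          decide
        rcases h3 with rfl | rfl | rfl
        · exact Or.inr ⟨b0, (ho.slope_pos hd).le⟩
        · exact Or.inl (by rw [b1]; linarith)
        · exact Or.inl (by rw [b2]; exact ht0)
      exact hmax L hL s hs hs'

/-- The discrete divergence is onto: its adjoint has a trivial kernel. -/
lemma eq_zero_of_orthogonal (hΩ : IsPolygonal Ω) {k k' : ℕ} (hk : 3 ≤ k)
    {T : Triangulation Ω} {u : VecField T} (hu : u ∈ DispSpace k k' T)
    (h : ∀ τ ∈ StressSpace k k' T, prodVec T (pdiv T τ) u = 0) : u = 0 := by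
  refine eq_zero_of_orthogonal_sigmaTilde hΩ hk
    (isRigid_of_orthogonal hΩ (by omega) hu h) fun τ hτ => h τ ?_
  rw [← mem_stressSub hΩ]
  exact (le_sup_left.trans le_sup_left : sigmaTildeSub hΩ k T ≤ _) hτ

/-! ### Stability of the quadrature rule -/

/-- Pull-back of polynomials to the reference triangle. -/
def Triangle.pull (K : Triangle) : Poly →ₐ[ℝ] Poly :=
  MvPolynomial.aeval fun i => MvPolynomial.C (K.points 0 i) +
    (MvPolynomial.C (K.points 1 i - K.points 0 i) * MvPolynomial.X 0 +
      MvPolynomial.C (K.points 2 i - K.points 0 i) * MvPolynomial.X 1)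

lemma Triangle.pval_pull (K : Triangle) (p : Poly) (x : Plane) :
    pval (K.pull p) x = pval p (K.aff x) := by
  induction p using MvPolynomial.induction_on with
  | C a => simp [Triangle.pull]
  | add p q hp hq => simp [hp, hq]
  | mul_X p i hp =>
    rw [map_mul, pval_mul, hp, pval_mul, pval_X, K.aff_eq]
    simp [Triangle.pull, K.lin_apply]

lemma totalDegree_aeval_le {f : Fin 2 → Poly} (hf : ∀ i, (f i).totalDegree ≤ 1) (p : Poly) :
    (MvPolynomial.aeval (R := ℝ) f p).totalDegree ≤ p.totalDegree := by
  rw [MvPolynomial.aeval_def, MvPolynomial.eval₂_eq]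
  refine MvPolynomial.totalDegree_finsetSum_le fun m hm => ?_
  refine (MvPolynomial.totalDegree_mul _ _).trans ?_
  rw [MvPolynomial.algebraMap_eq, MvPolynomial.totalDegree_C, zero_add]
  refine (MvPolynomial.totalDegree_finsetProd _ _).trans ?_
  refine le_trans ?_ (MvPolynomial.le_totalDegree hm)
  refine Finset.sum_le_sum fun i _ => (MvPolynomial.totalDegree_pow _ _).trans ?_
  exact (Nat.mul_le_mul_left _ (hf i)).trans (mul_one _).le

lemma Triangle.totalDegree_pull_le (K : Triangle) (p : Poly) :
    (K.pull p).totalDegree ≤ p.totalDegree := by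
  refine totalDegree_aeval_le (fun i => ?_) p
  exact totalDegree_add_le (by simp) (totalDegree_add_le
    (totalDegree_C_mul_le (MvPolynomial.totalDegree_X _).le _)
    (totalDegree_C_mul_le (MvPolynomial.totalDegree_X _).le _))

lemma Triangle.pull_bary (K : Triangle) (j : Fin 3) : K.pull (K.bary j) = refTriangle.bary j := by
  refine MvPolynomial.funext fun y => ?_
  have := (K.pval_pull (K.bary j) (WithLp.toLp 2 y)).trans (K.bary_aff j _)
  simpa [pval] using this

/-- An affine substitution does not raise degrees and carries bubble to bubble, so the unisolvence
imposed on the reference triangle serves every cell. -/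
lemma Triangle.pull_mem_Pkk (K : Triangle) {k k' : ℕ} {p : Poly} (h : p ∈ Pkk k k' K) :
    K.pull p ∈ Pkk k k' refTriangle := by
  obtain ⟨q, s, hq, hs, rfl⟩ := h
  refine ⟨K.pull q, K.pull s, (K.totalDegree_pull_le q).trans hq,
    (K.totalDegree_pull_le s).trans hs, ?_⟩
  simp only [map_add, map_mul, Triangle.bubble, K.pull_bary]

lemma sum_smul_mem_Pkk {k k' : ℕ} {K : Triangle} {ι : Type*} (s : Finset ι) (c : ι → ℝ)
    {φ : ι → Poly} (h : ∀ i, φ i ∈ Pkk k k' K) : ∑ i ∈ s, c i • φ i ∈ Pkk k k' K := by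
  choose q r hq hr e using h
  refine ⟨∑ i ∈ s, c i • q i, ∑ i ∈ s, c i • r i,
    MvPolynomial.totalDegree_finsetSum_le fun i _ => totalDegree_smul_le' (hq i) _,
    MvPolynomial.totalDegree_finsetSum_le fun i _ => totalDegree_smul_le' (hr i) _, ?_⟩
  rw [Finset.mul_sum, ← Finset.sum_add_distrib]
  refine Finset.sum_congr rfl fun i _ => ?_
  rw [e i, smul_add, mul_smul_comm]

lemma Triangle.area_eq (K : Triangle) : K.area = |K.det| * refTriangle.area := by
  have := K.integral_body fun _ => 1
  simpa [Triangle.area] using this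

lemma Triangle.area_pos (K : Triangle) : 0 < K.area := by
  have h1 : volume K.body ≠ 0 := fun h =>
    (isOpen_interior.measure_pos volume K.interior_nonempty).ne'
      (measure_mono_null interior_subset h)
  exact ENNReal.toReal_pos h1 K.isCompact_body.measure_lt_top.ne

variable {k k' : ℕ}

/-- In the nodal basis, `p = ∑ cᵢ φᵢ`. Weighted Cauchy-Schwarz gives `p² ≤ (∑ wᵢ cᵢ²)(∑ φᵢ²/wᵢ)`
pointwise, and the last factor is integrated. -/
lemma LumpingRule.exists_bound_refTriangle (Q : LumpingRule k k') : ∃ C : ℝ, 0 < C ∧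
    ∀ p ∈ Pkk k k' refTriangle, ∫ x in refTriangle.body, pval p x ^ 2 ≤
      C * ∑ i, Q.weight i * pval p (refTriangle.pointOf (Q.node i)) ^ 2 := by
  choose φ hφ _ using fun i => Q.unisolvent (Pi.single i 1)
  have hC : 0 ≤ ∫ x in refTriangle.body, ∑ i, pval (φ i) x ^ 2 / Q.weight i :=
    integral_nonneg fun x => Finset.sum_nonneg fun i _ =>
      div_nonneg (sq_nonneg _) (Q.weight_pos i).le
  -- Adding 1 makes the constant strictly positive without further argument.
  refine ⟨(∫ x in refTriangle.body, ∑ i, pval (φ i) x ^ 2 / Q.weight i) + 1, by linarith,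
    fun p hp => ?_⟩
  set c := fun i => pval p (refTriangle.pointOf (Q.node i)) with hc
  have hrep : p = ∑ i, c i • φ i := by
    obtain ⟨r, -, hr⟩ := Q.unisolvent c
    rw [hr p ⟨hp, fun i => rfl⟩, hr (∑ i, c i • φ i)
      ⟨sum_smul_mem_Pkk _ _ fun i => (hφ i).1, fun i => ?_⟩]
    simp [pval_sum, (hφ _).2, Pi.single_apply]
  have hN : 0 ≤ ∑ i, Q.weight i * c i ^ 2 := Finset.sum_nonneg fun i _ =>
    mul_nonneg (Q.weight_pos i).le (sq_nonneg _)
  have hpt : ∀ x, pval p x ^ 2 ≤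
      (∑ i, Q.weight i * c i ^ 2) * ∑ i, pval (φ i) x ^ 2 / Q.weight i := by
    intro x
    have : pval p x = ∑ i, c i * pval (φ i) x := by
      conv_lhs => rw [hrep]
      simp [pval_sum]
    rw [this]
    refine Finset.sum_sq_le_sum_mul_sum_of_sq_le_mul _
      (fun i _ => mul_nonneg (Q.weight_pos i).le (sq_nonneg _))
      (fun i _ => div_nonneg (sq_nonneg _) (Q.weight_pos i).le) fun i _ => le_of_eq ?_
    have := (Q.weight_pos i).ne'
    field_simp
  have hcont : Continuous fun x => ∑ i, pval (φ i) x ^ 2 / Q.weight i :=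
    continuous_finsetSum _ fun i _ => by
      simp only [div_eq_mul_inv]
      fun_prop
  calc ∫ x in refTriangle.body, pval p x ^ 2
      ≤ ∫ x in refTriangle.body, (∑ i, Q.weight i * c i ^ 2) *
          ∑ i, pval (φ i) x ^ 2 / Q.weight i :=
        integral_mono (refTriangle.integrableOn (by fun_prop))
          (refTriangle.integrableOn (hcont.const_mul _)) hpt
    _ ≤ _ := by
        rw [integral_const_mul]
        nlinarith

/-- Both sides scale with `|K.det|`, so the constant does not depend on the shape of `K`. The
division by `refTriangle.area` compensates for the area contained in the weights of `Q.quad`. -/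
lemma LumpingRule.exists_bound (Q : LumpingRule k k') : ∃ C : ℝ, 0 < C ∧
    ∀ K : Triangle, ∀ p ∈ Pkk k k' K, ∫ x in K.body, pval p x ^ 2 ≤
      C * Q.quad K fun x => pval p x ^ 2 := by
  obtain ⟨C, hC, h⟩ := Q.exists_bound_refTriangle
  have hr := refTriangle.area_pos
  refine ⟨C / refTriangle.area, div_pos hC hr, fun K p hp => ?_⟩
  have h1 := h _ (K.pull_mem_Pkk hp)
  simp only [K.pval_pull, K.aff_pointOf _ (Q.node_sum _)] at h1
  rw [K.integral_body]
  refine (mul_le_mul_of_nonneg_left h1 (abs_nonneg _)).trans (le_of_eq ?_)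
  simp only [LumpingRule.quad, K.area_eq, Finset.mul_sum]
  refine Finset.sum_congr rfl fun i _ => ?_
  field_simp

/-! ### Coercivity -/

/-- The smallest eigenvalue of `𝒜` is `1/(2(μ+λ))`, attained at the identity. The difference of the
two sides is `λ/μ` times the squared norm of the trace-free part. -/
lemma ddot_compliance {lam mu : ℝ} (hlam : 0 < lam) (hmu : 0 < mu)
    (A : Matrix (Fin 2) (Fin 2) ℝ) :
    ddot A A ≤ 2 * (mu + lam) * ddot (compliance lam mu A) A := by
  have h1 : 0 < mu + lam := by linarith
  have e : 2 * (mu + lam) * ddot (compliance lam mu A) A - ddot A A =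
      lam / mu * (2⁻¹ * (A 0 0 - A 1 1) ^ 2 + A 0 1 ^ 2 + A 1 0 ^ 2) := by
    simp only [ddot, compliance, Fin.sum_univ_two, Matrix.smul_apply, Matrix.sub_apply,
      Matrix.trace_fin_two, Matrix.one_apply, smul_eq_mul]
    have h2 : 2 * mu + 2 * lam ≠ 0 := by positivity
    simp
    field_simp
    ring
  have : 0 ≤ lam / mu * (2⁻¹ * (A 0 0 - A 1 1) ^ 2 + A 0 1 ^ 2 + A 1 0 ^ 2) := by positivity
  linarith

lemma ddot_self_nonneg (A : Matrix (Fin 2) (Fin 2) ℝ) : 0 ≤ ddot A A :=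
  Finset.sum_nonneg fun _ _ => Finset.sum_nonneg fun _ _ => mul_self_nonneg _

lemma normMat_sq (hΩ : IsPolygonal Ω) (T : Triangulation Ω) (τ : MatField T) :
    normMat Ω (matFun T τ) ^ 2 =
      ∑ K : T.cells, ∑ i, ∑ j, ∫ x in K.1.body, pval (τ K i j) x ^ 2 := by
  rw [normMat, Real.sq_sqrt (integral_nonneg fun x => ddot_self_nonneg _)]
  rw [T.integral_eq hΩ (g := fun K x => ∑ i, ∑ j, pval (τ K i j) x ^ 2) (fun K => by fun_prop)
    (fun K x hx => by simp only [ddot, matFun_apply, scalFun_eq T _ K hx, pow_two])]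
  refine Finset.sum_congr rfl fun K _ => ?_
  rw [integral_finsetSum _ fun i _ => K.1.integrableOn (by fun_prop)]
  refine Finset.sum_congr rfl fun i _ => ?_
  rw [integral_finsetSum _ fun j _ => K.1.integrableOn (by fun_prop)]

/-- The mass-lumped form is coercive, uniformly in the domain and in the triangulation. -/
lemma LumpingRule.exists_coercive (Q : LumpingRule k k') {lam mu : ℝ} (hlam : 0 < lam)
    (hmu : 0 < mu) : ∃ C : ℝ, 0 < C ∧ ∀ Ω : Set Plane, IsPolygonal Ω → ∀ T : Triangulation Ω,
      ∀ τ ∈ StressSpace k k' T,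
        C * normMat Ω (matFun T τ) ^ 2 ≤ lumped Q lam mu T τ τ := by
  obtain ⟨C, hC, h⟩ := Q.exists_bound
  have hM : 0 < C * (2 * (mu + lam)) := by positivity
  refine ⟨(C * (2 * (mu + lam)))⁻¹, inv_pos.2 hM, fun Ω hΩ T τ hτ => ?_⟩
  rw [inv_mul_le_iff₀ hM, normMat_sq hΩ, lumped, Finset.mul_sum]
  refine Finset.sum_le_sum fun K _ => ?_
  calc ∑ i, ∑ j, ∫ x in K.1.body, pval (τ K i j) x ^ 2
      ≤ ∑ i, ∑ j, C * Q.quad K.1 fun x => pval (τ K i j) x ^ 2 :=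
        Finset.sum_le_sum fun i _ => Finset.sum_le_sum fun j _ =>
          h K.1 _ (StressSpace.mem_Pkk hτ K i j)
    _ = C * ∑ n, (K.1.area * Q.weight n) *
          ddot (mval (τ K) (K.1.pointOf (Q.node n))) (mval (τ K) (K.1.pointOf (Q.node n))) := by
        simp only [LumpingRule.quad, ddot, mval, Matrix.of_apply, Fin.sum_univ_two,
          ← Finset.mul_sum, ← Finset.sum_add_distrib, ← mul_add, pow_two]
    _ ≤ C * ∑ n, (K.1.area * Q.weight n) * (2 * (mu + lam) *
          ddot (compliance lam mu (mval (τ K) (K.1.pointOf (Q.node n))))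
            (mval (τ K) (K.1.pointOf (Q.node n)))) := by
        refine mul_le_mul_of_nonneg_left (Finset.sum_le_sum fun n _ => ?_) hC.le
        exact mul_le_mul_of_nonneg_left (ddot_compliance hlam hmu _)
          (mul_nonneg K.1.area_pos.le (Q.weight_pos n).le)
    _ = _ := by
        simp only [LumpingRule.quad, Finset.mul_sum]
        exact Finset.sum_congr rfl fun n _ => by ring

lemma eq_zero_of_normMat (hΩ : IsPolygonal Ω) (T : Triangulation Ω) {τ : MatField T}
    (h : normMat Ω (matFun T τ) ^ 2 = 0) : τ = 0 := by
  rw [normMat_sq hΩ] at h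
  have hn : ∀ (K : T.cells) i j, 0 ≤ ∫ x in K.1.body, pval (τ K i j) x ^ 2 := fun K i j =>
    integral_nonneg fun x => sq_nonneg _
  ext1 K; ext1 i j
  rw [Finset.sum_eq_zero_iff_of_nonneg fun K _ => Finset.sum_nonneg fun i _ =>
    Finset.sum_nonneg fun j _ => hn K i j] at h
  have h2 := h K (Finset.mem_univ K)
  rw [Finset.sum_eq_zero_iff_of_nonneg fun i _ => Finset.sum_nonneg fun j _ => hn K i j] at h2
  have h3 := h2 i (Finset.mem_univ i)
  rw [Finset.sum_eq_zero_iff_of_nonneg fun j _ => hn K i j] at h3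
  have h4 := h3 j (Finset.mem_univ j)
  simp only [← pval_pow] at h4
  have := K.1.integral_pval_eq_zero (fun x _ => by rw [pval_pow]; exact sq_nonneg _) h4
  simpa using this

/-! ### The saddle point problem -/

lemma ddot_add_left (A A' B : Matrix (Fin 2) (Fin 2) ℝ) :
    ddot (A + A') B = ddot A B + ddot A' B := by
  simp [ddot, Fin.sum_univ_two]; ring

lemma ddot_add_right (A B B' : Matrix (Fin 2) (Fin 2) ℝ) :
    ddot A (B + B') = ddot A B + ddot A B' := by
  simp [ddot, Fin.sum_univ_two]; ring

lemma ddot_smul_left (c : ℝ) (A B : Matrix (Fin 2) (Fin 2) ℝ) :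
    ddot (c • A) B = c * ddot A B := by
  simp [ddot, Fin.sum_univ_two]; ring

lemma ddot_smul_right (c : ℝ) (A B : Matrix (Fin 2) (Fin 2) ℝ) :
    ddot A (c • B) = c * ddot A B := by
  simp [ddot, Fin.sum_univ_two]; ring

lemma compliance_add (lam mu : ℝ) (A B : Matrix (Fin 2) (Fin 2) ℝ) :
    compliance lam mu (A + B) = compliance lam mu A + compliance lam mu B := by
  ext i j
  simp [compliance, Matrix.trace_fin_two]
  ring

lemma compliance_smul (lam mu c : ℝ) (A : Matrix (Fin 2) (Fin 2) ℝ) :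
    compliance lam mu (c • A) = c • compliance lam mu A := by
  ext i j
  simp [compliance, Matrix.trace_fin_two]
  ring

lemma LumpingRule.quad_add (Q : LumpingRule k k') (K : Triangle) (f g : Plane → ℝ) :
    Q.quad K (fun x => f x + g x) = Q.quad K f + Q.quad K g := by
  simp [LumpingRule.quad, mul_add, Finset.sum_add_distrib]

lemma LumpingRule.quad_const_mul (Q : LumpingRule k k') (K : Triangle) (c : ℝ) (f : Plane → ℝ) :
    Q.quad K (fun x => c * f x) = c * Q.quad K f := by
  simp [LumpingRule.quad, Finset.mul_sum, mul_left_comm]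

/-- The lumped form as a bilinear map. -/
def lumpedBilin (Q : LumpingRule k k') (lam mu : ℝ) (T : Triangulation Ω) :
    MatField T →ₗ[ℝ] MatField T →ₗ[ℝ] ℝ :=
  LinearMap.mk₂ ℝ (lumped Q lam mu T)
    (fun σ σ' τ => by
      simp only [lumped, Pi.add_apply, mval_add, compliance_add, ddot_add_left, Q.quad_add,
        Finset.sum_add_distrib])
    (fun c σ τ => by
      simp only [lumped, Pi.smul_apply, mval_smul, compliance_smul, ddot_smul_left,
        Q.quad_const_mul, Finset.mul_sum, smul_eq_mul])
    (fun σ τ τ' => by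
      simp only [lumped, Pi.add_apply, mval_add, ddot_add_right, Q.quad_add,
        Finset.sum_add_distrib])
    (fun c σ τ => by
      simp only [lumped, Pi.smul_apply, mval_smul, ddot_smul_right,
        Q.quad_const_mul, Finset.mul_sum, smul_eq_mul])

/-- Unique solvability of finite-dimensional saddle point problems. -/
lemma existsUnique_saddle {S D : Type*} [AddCommGroup S] [Module ℝ S] [Module.Finite ℝ S]
    [AddCommGroup D] [Module ℝ D] [Module.Finite ℝ D] (a : S →ₗ[ℝ] S →ₗ[ℝ] ℝ)
    (b : S →ₗ[ℝ] D →ₗ[ℝ] ℝ) (ha : ∀ σ, a σ σ = 0 → σ = 0)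
    (hb : ∀ u, (∀ τ, b τ u = 0) → u = 0) (F : D →ₗ[ℝ] ℝ) :
    ∃! s : S × D, (∀ τ, a s.1 τ + b τ s.2 = 0) ∧ ∀ v, - b s.1 v = F v := by
  -- The whole system as one map between spaces of equal dimension, so injectivity gives existence
  -- and uniqueness.
  let A : (S × D) →ₗ[ℝ] (Module.Dual ℝ S × Module.Dual ℝ D) :=
    (a.coprod b.flip).prod ((-b).comp (LinearMap.fst ℝ S D))
  have hA : ∀ s : S × D, ∀ G : Module.Dual ℝ D, A s = (0, G) ↔
      (∀ τ, a s.1 τ + b τ s.2 = 0) ∧ ∀ v, - b s.1 v = G v := by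
    intro s G
    simp [A, Prod.ext_iff, LinearMap.ext_iff]
  have hinj : Function.Injective A := by
    rw [injective_iff_map_eq_zero]
    rintro ⟨σ, u⟩ hs
    obtain ⟨h1, h2⟩ := (hA (σ, u) 0).1 hs
    -- Testing the second equation with `u` removes the coupling term from the first one tested with
    -- `σ`, leaving `a σ σ = 0`.
    have h3 := h2 u
    have h4 := h1 σ
    simp only [LinearMap.zero_apply, neg_eq_zero] at h3 h4
    rw [h3, add_zero] at h4
    have hσ := ha σ h4
    subst hσ
    have hu : u = 0 := hb u fun τ => by simpa using h1 τ
    rw [hu]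
    rfl
  have hsurj : Function.Surjective A := by
    refine (LinearMap.injective_iff_surjective_of_finrank_eq_finrank ?_).1 hinj
    rw [Module.finrank_prod, Module.finrank_prod]
    congr 1
    · exact (Subspace.dual_finrank_eq (K := ℝ) (V := S)).symm
    · exact (Subspace.dual_finrank_eq (K := ℝ) (V := D)).symm
  obtain ⟨s, hs⟩ := hsurj (0, F)
  exact ⟨s, (hA s F).1 hs, fun s' hs' => hinj (((hA s' F).2 hs').trans hs.symm)⟩

lemma existsUnique_saddle_submodule {V W : Type*} [AddCommGroup V] [Module ℝ V] [AddCommGroup W]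
    [Module ℝ W] (S : Submodule ℝ V) [Module.Finite ℝ S] (D : Submodule ℝ W) [Module.Finite ℝ D]
    (a : V →ₗ[ℝ] V →ₗ[ℝ] ℝ) (b : V →ₗ[ℝ] W →ₗ[ℝ] ℝ) (ha : ∀ σ ∈ S, a σ σ = 0 → σ = 0)
    (hb : ∀ u ∈ D, (∀ τ ∈ S, b τ u = 0) → u = 0) (F : W →ₗ[ℝ] ℝ) :
    ∃! s : V × W, (s.1 ∈ S ∧ s.2 ∈ D) ∧ (∀ τ ∈ S, a s.1 τ + b τ s.2 = 0) ∧
      ∀ v ∈ D, - b s.1 v = F v := by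
  obtain ⟨⟨σ, u⟩, ⟨h1, h2⟩, huniq⟩ := existsUnique_saddle (a.domRestrict₁₂ S S)
    (b.domRestrict₁₂ S D) (fun σ hσ => Subtype.ext (ha σ σ.2 hσ))
    (fun u hu => Subtype.ext (hb u u.2 fun τ hτ => hu ⟨τ, hτ⟩)) (F.domRestrict D)
  refine ⟨(σ, u), ⟨⟨σ.2, u.2⟩, fun τ hτ => h1 ⟨τ, hτ⟩, fun v hv => h2 ⟨v, hv⟩⟩, ?_⟩
  rintro ⟨σ', u'⟩ ⟨⟨hσ', hu'⟩, h1', h2'⟩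
  have h := huniq (⟨σ', hσ'⟩, ⟨u', hu'⟩) ⟨fun τ => h1' τ τ.2, fun v => h2' v v.2⟩
  rw [Prod.ext_iff] at h
  exact Prod.ext (congrArg Subtype.val h.1) (congrArg Subtype.val h.2)

/-- The load functional on piecewise polynomial displacements. -/
def loadLin (T : Triangulation Ω) {f : Plane → Fin 2 → ℝ}
    (hf : MemL2Vec Ω f) : VecField T →ₗ[ℝ] ℝ where
  toFun v := innerVec Ω f (vecFun T v)
  map_add' v w := by
    have hI : ∀ v : VecField T, Integrable (fun x => ∑ i, f x i * vecFun T v x i)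
        (volume.restrict Ω) := fun v => integrable_finsetSum _ fun i _ => by
      simp only [vecFun_apply]
      exact MemLp.integrable_mul (hf i) (memL2_scalFun Ω T _)
    simp only [innerVec, vecFun_add, Pi.add_apply, mul_add, Finset.sum_add_distrib]
    exact integral_add (hI v) (hI w)
  map_smul' c v := by
    simp only [innerVec, vecFun_smul, Pi.smul_apply, smul_eq_mul, mul_left_comm _ c,
      ← Finset.mul_sum, integral_const_mul, RingHom.id_apply]

/-- Everything defined almost everywhere is replaced by subspaces and bilinear maps of polynomial
families, to which the abstract saddle point result applies. -/
lemma isLumpedSolution_iff (hΩ : IsPolygonal Ω) (Q : LumpingRule k k') (lam mu : ℝ)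
    (T : Triangulation Ω) {f : Plane → Fin 2 → ℝ} (hf : MemL2Vec Ω f) (σ : MatField T)
    (u : VecField T) : IsLumpedSolution Q lam mu T f σ u ↔
      (σ ∈ stressSub hΩ k k' T ∧ u ∈ dispSub hΩ k k' T) ∧
      (∀ τ ∈ stressSub hΩ k k' T,
        lumpedBilin Q lam mu T σ τ + (prodVec T).comp (pdivLin T) τ u = 0) ∧
      ∀ v ∈ dispSub hΩ k k' T, - (prodVec T).comp (pdivLin T) σ v = loadLin T hf v := by
  have e : ∀ τ ∈ stressSub hΩ k k' T, ∀ v,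
      innerVec Ω (weakDiv Ω (matFun T τ)) (vecFun T v) = (prodVec T).comp (pdivLin T) τ v :=
    fun τ hτ v => innerVec_weakDiv hΩ T
      (StressSpace.memHDiv hΩ ((mem_stressSub hΩ k k' T τ).1 hτ)) v
  constructor
  · intro h
    have hσ := (mem_stressSub hΩ k k' T σ).2 h.stress_mem
    refine ⟨⟨hσ, (mem_dispSub hΩ k k' T u).2 h.displacement_mem⟩, fun τ hτ => ?_, fun v hv => ?_⟩
    · rw [← e τ hτ]
      exact h.constitutive τ ((mem_stressSub hΩ k k' T τ).1 hτ)
    · rw [← e σ hσ]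
      exact h.equilibrium v ((mem_dispSub hΩ k k' T v).1 hv)
  · rintro ⟨⟨hσ, hu⟩, h1, h2⟩
    refine ⟨(mem_stressSub hΩ k k' T σ).1 hσ, (mem_dispSub hΩ k k' T u).1 hu, fun τ hτ => ?_,
      fun v hv => ?_⟩
    · rw [← mem_stressSub hΩ] at hτ
      rw [e τ hτ]
      exact h1 τ hτ
    · rw [← mem_dispSub hΩ] at hv
      rw [e σ hσ]
      exact h2 v hv

/-- The mass-lumped scheme has exactly one solution. -/
lemma existsUnique_isLumpedSolution (hk : 3 ≤ k) (Q : LumpingRule k k') {lam mu : ℝ}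
    (hlam : 0 < lam) (hmu : 0 < mu) (hΩ : IsPolygonal Ω) (T : Triangulation Ω)
    {f : Plane → Fin 2 → ℝ} (hf : MemL2Vec Ω f) :
    ∃! s : MatField T × VecField T, IsLumpedSolution Q lam mu T f s.1 s.2 := by
  have := finite_stressSub hΩ k k' T
  have := finite_dispSub hΩ k k' T
  obtain ⟨C, hC, hcoer⟩ := Q.exists_coercive hlam hmu
  simp only [isLumpedSolution_iff hΩ Q lam mu T hf]
  refine existsUnique_saddle_submodule _ _ _ _ (fun σ hσ h0 => ?_) (fun u hu h0 => ?_) _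
  · have h1 := hcoer Ω hΩ T σ ((mem_stressSub hΩ k k' T σ).1 hσ)
    rw [show lumped Q lam mu T σ σ = 0 from h0] at h1
    have h2 := sq_nonneg (normMat Ω (matFun T σ))
    exact eq_zero_of_normMat hΩ T (by nlinarith)
  · exact eq_zero_of_orthogonal hΩ hk ((mem_dispSub hΩ k k' T u).1 hu)
      fun τ hτ => h0 τ ((mem_stressSub hΩ k k' T τ).2 hτ)

end LumpedElasticity

end

/-! ### Uniform coercivity and unique solvability -/

open LumpedElasticity in
theorem lemma4p1 (k k' : ℕ) (hk : 3 ≤ k) (hkk' : k < k') (Q : LumpingRule k k')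
    (lam mu : ℝ) (hlam : 0 < lam) (hmu : 0 < mu) :
    (∃ C : ℝ, 0 < C ∧ ∀ Ω : Set Plane, IsPolygonal Ω → ∀ T : Triangulation Ω,
      ∀ τ ∈ StressSpace k k' T,
        C * normMat Ω (matFun T τ) ^ 2 ≤ lumped Q lam mu T τ τ) ∧
    (∀ Ω : Set Plane, IsPolygonal Ω → ∀ T : Triangulation Ω,
      ∀ f : Plane → Fin 2 → ℝ, MemL2Vec Ω f →
        ∃! s : MatField T × VecField T, IsLumpedSolution Q lam mu T f s.1 s.2) := by
  exact ⟨Q.exists_coercive hlam hmu, fun _ hΩ T _ hf =>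
    existsUnique_isLumpedSolution hk Q hlam hmu hΩ T hf⟩
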